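/- Setup. Let $m\ge 3$ and let $\{1,\dots,n\}$ be divided into consecutive nonempty intervals, the colors $C^{(1)},\dots,C^{(m)}$. Let $\mathbf k=(k_1,\dots,k_n)$ be nonnegative integers with $\sum_i k_i=n-3$ such that within each color the positive exponents stand on an initial segment and are weakly increasing there. Write $k_S=\sum_{i\in S}k_i$. A number $i$ is boxed if $k_i>0$; the smallest number in each of the first three colors is crossed out. A set is monochromatic if its elements have the same color. Decorations. A decoration $D$ consists of a set partition of the boxed numbers into monochromatic blocks (called hues), an assignment of a hue to every number that is not crossed out, and a set of underlined numbers, such that: for each hue $B$, all elements of $B$ except $\min B$ have hue $B$ and are underlined, $\min B$ is not underlined, and exactly $k_B$ numbers in total have hue $B$; and every underlined unboxed number has a hue of its own color. Let $u(D)$ be the number of underlined numbers and $(-1)^{u(D)}$ the sign of $D$. Let $\mathcal D(\mathbf k)$ be the set of decorations, and $\mathcal{MD}(\mathbf k)$ the set of mismatched ones, in which no unboxed number has a hue of its own color. A sign-reversing involution is an involution that changes the sign of every element it does not fix. The map $\underline\varphi$ on $\mathcal D(\mathbf k)$ toggles the underline of the smallest unboxed number that has a hue of its own color; if there is none, it does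 nothing. Chains. Let $D\in\mathcal{MD}(\mathbf k)$, let $C$ be a color, and let $I$ be the set of boxed numbers of color $C$ that are neither crossed out nor underlined and have a hue of color $C$. The number chain decomposition lists $I$ as follows. Open a chain with $i_1=\min I$. If $i_1,\dots,i_s$ are listed, $I$ is not exhausted, and $b$ is the minimum of the hue of $i_s$, then: if $b\in I\setminus\{i_1,\dots,i_s\}$, the current chain continues with $i_{s+1}=b$; otherwise it is closed and a new chain is opened with $i_{s+1}=\min(I\setminus\{i_1,\dots,i_s\})$. The order of this list is the number chain order. The hue chain decomposition is the corresponding sequence of the hues of $i_1,i_2,\dots$, with the same division into chains. The permission list of a set $S$ of numbers whose hues have color $C$ lists first the elements of $S$ of color $C$ in number chain order, then the others in ascending order. Permission. A singleton hue $\{t\}$ has permission to merge with a hue $B_t$ of the same color $C$, where $r=\min B_t$, if $t<r$; the number $r$ has hue $\{t\}$; $r$ is the first number of hue $\{t\}$ in number chain order; and in the permission list of the set of all non-underlined numbers of hue $\{t\}$ or $B_t$, other than $r$ and other than the number immediately preceding $r$ in its chain (if any), all numbers of hue $B_t$ precede all numbers of hue $\{t\}$. The map $\varphi^{\mathrm{hue}}$.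 For $D\in\mathcal{MD}(\mathbf k)$ let $a$ (if it exists) be the smallest minimum of a non-singleton hue, $B$ the hue with minimum $a$, and $t$ (if it exists) the smallest number such that $\{t\}$ has permission to merge with some hue $B_t$. - Split: if $a$ exists and either $t$ does not exist or $a<t$, replace $B$ by $\{a\}$ and $B'=B\setminus\{a\}$. Let $r=\min B'$. If a number chain of $D$ that starts with a number less than $r$ contains a number of hue $B$, let $q$ be the first number of hue $B$ in number chain order. Give $r$ the hue $\{a\}$ and remove its underline; give the other elements of $B'$, and $q$ if it exists, the hue $B'$; among the remaining numbers of hue $B$, in the order of their permission list in $D$, give hue $B'$ to the first ones until $k_{B'}$ numbers have hue $B'$, and hue $\{a\}$ to the rest. - Merge: if $t$ exists and either $a$ does not exist or $t<a$, replace $\{t\}$ and $B_t$ by $\{t\}\cup B_t$, give this hue to all numbers of hue $\{t\}$ or $B_t$, and underline $\min B_t$. - If neither $a$ nor $t$ exists, do nothing. A fixed point decoration is a mismatched decoration all of whose hues are singletons and in which no hue has permission to merge with a hue. Let $$A(\mathbf k)=\sum_{\mathcal P}(-1)^{\sum_{B\in\mathcal P}(|B|-1)}\binom{\ell(\mathcal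 P)-3}{\,k_{B}-|B|+1 \;:\; B\in\mathcal P\,},$$ where $\mathcal P$ runs over the set partitions of $\{1,\dots,n\}$ into monochromatic blocks, $\ell(\mathcal P)$ is the number of blocks, and the multinomial coefficient is $0$ if some $k_B-|B|+1$ is negative. Theorem. 1. $A(\mathbf k)=\sum_{D\in\mathcal D(\mathbf k)}(-1)^{u(D)}$. 2. $\underline\varphi$ is a sign-reversing involution on $\mathcal D(\mathbf k)$ whose fixed points are exactly the elements of $\mathcal{MD}(\mathbf k)$, and $A(\mathbf k)=\sum_{D\in\mathcal{MD}(\mathbf k)}(-1)^{u(D)}$. 3. In a mismatched decoration, $\{t\}$ has permission to merge with at most one hue, and $\varphi^{\mathrm{hue}}$ is a well-defined sign-reversing involution on $\mathcal{MD}(\mathbf k)$. 4. The fixed points of $\varphi^{\mathrm{hue}}$ are exactly the fixed point decorations; they have no underlined numbers, and all have sign $+1$. 5. $A(\mathbf k)$ equals the number of fixed point decorations. -/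

import Mathlib

/-- The combinatorial data of a product of `ψ` classes on a multicolored space with `n` marked
points and `m ≥ 3` colors. The marked points are the elements of `Fin n`; the color classes are
consecutive nonempty intervals (of sizes `r₁, …, r_m`), encoded by a monotone surjective color
function; `k i` is the exponent at the point `i`. Within each color the positive exponents stand on
an initial segment and are weakly increasing there, and the exponents add up to `n - 3`. -/
structure ColoredExponents (n m : ℕ) where
  color : Fin n → Fin m
  k : Fin n → ℕ
  three_le : 3 ≤ m
  color_monotone : Monotone color
  color_surjective : Function.Surjective color
  sum_k : (∑ i, k i) + 3 = n
  k_sorted : ∀ i j, i < j → color i = color j → 0 < k j → 0 < k i ∧ k i ≤ k j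

/-- A way of marking the numbers in `Fin n`: a finite set of hues (each hue `C_B` is represented by
its block `B`), the hue of every number, and the set of underlined numbers. A number without hue
gets the value `∅`, which is never a block. -/
structure Marking (n : ℕ) where
  hues : Finset (Finset (Fin n))
  hue : Fin n → Finset (Fin n)
  under : Finset (Fin n)

namespace Marking

/-- A marking is a triple. -/
def equivProd (n : ℕ) :
    Marking n ≃ Finset (Finset (Fin n)) × (Fin n → Finset (Fin n)) × Finset (Fin n) where
  toFun D := (D.hues, D.hue, D.under)
  invFun x := ⟨x.1, x.2.1, x.2.2⟩
  left_inv _ := rfl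
  right_inv _ := rfl

instance (n : ℕ) : DecidableEq (Marking n) := (equivProd n).decidableEq

instance (n : ℕ) : Fintype (Marking n) := Fintype.ofEquiv _ (equivProd n).symm

/-- The sign `(-1)^{u(D)}`, where `u(D)` is the number of underlined numbers. -/
def sign {n : ℕ} (D : Marking n) : ℤ := (-1) ^ D.under.card

end Marking

/-- `φ` restricts to a sign-reversing involution of the finite set `X` with sign `ε`. -/
def IsSignReversingInvolution {α : Type*} (X : Finset α) (ε : α → ℤ) (φ : α → α) : Prop :=
  (∀ x ∈ X, φ x ∈ X) ∧ (∀ x ∈ X, φ (φ x) = x) ∧ (∀ x ∈ X, φ x ≠ x → ε (φ x) = -ε x)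

/-- The chains of the number chain decomposition that remain to be written when the number `cur` has
just been written and `R` is the set of numbers not yet listed. The first chain of the output is the
rest, beginning with `cur`, of the current chain. If `b`, the minimum of the hue of `cur`, belongs to
`R`, the chain continues with `b`; otherwise it is closed and a new one is opened at `min R`. -/
def chainsFrom {n : ℕ} (hue : Fin n → Finset (Fin n)) (cur : Fin n) (R : Finset (Fin n)) :
    List (List (Fin n)) :=
  if h : ∃ hB : (hue cur).Nonempty, (hue cur).min' hB ∈ R then
    (chainsFrom hue ((hue cur).min' h.1) (R.erase ((hue cur).min' h.1))).modifyHead (cur :: ·)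
  else if hR : R.Nonempty then
    [cur] :: chainsFrom hue (R.min' hR) (R.erase (R.min' hR))
  else [[cur]]
termination_by R.card
decreasing_by
  · exact Finset.card_erase_lt_of_mem h.2
  · exact Finset.card_erase_lt_of_mem (R.min'_mem hR)

namespace ColoredExponents

variable {n m : ℕ} (P : ColoredExponents n m)

/-- `k_S`, the sum of the exponents over `S`. -/
def kSum (S : Finset (Fin n)) : ℕ := ∑ i ∈ S, P.k i

/-- The boxed numbers are those with positive exponent. -/
def boxed : Finset (Fin n) := Finset.univ.filter fun i => 0 < P.k i

/-- The crossed out numbers: the smallest number in each of the first three colors. -/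
def crossed : Finset (Fin n) :=
  Finset.univ.filter fun i => (P.color i : ℕ) < 3 ∧ ∀ j, P.color j = P.color i → i ≤ j

/-- All elements of `B` have the same color. -/
def Monochromatic (B : Finset (Fin n)) : Prop := ∀ i ∈ B, ∀ j ∈ B, P.color i = P.color j

instance (B : Finset (Fin n)) : Decidable (P.Monochromatic B) := by
  unfold Monochromatic; infer_instance

/-- The number `i` has a hue, and that hue matches the color of `i`. -/
def HueMatches (D : Marking n) (i : Fin n) : Prop := ∃ b ∈ D.hue i, P.color b = P.color i

instance (D : Marking n) (i : Fin n) : Decidable (P.HueMatches D i) := by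
  unfold HueMatches; infer_instance

/-- The decorations with parameters `k`. -/
structure IsDecoration (D : Marking n) : Prop where
  /-- The hues form a partition of the boxed numbers, with monochromatic blocks. -/
  hues_nonempty : ∀ B ∈ D.hues, B.Nonempty
  hues_disjoint : ∀ B ∈ D.hues, ∀ B' ∈ D.hues, B ≠ B' → Disjoint B B'
  hues_union : D.hues.biUnion id = P.boxed
  hues_monochromatic : ∀ B ∈ D.hues, P.Monochromatic B
  /-- Exactly the numbers that are not crossed out have a hue. -/
  hue_crossed : ∀ i ∈ P.crossed, D.hue i = ∅
  hue_mem : ∀ i, i ∉ P.crossed → D.hue i ∈ D.hues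
  /-- All numbers of a block `B` but the smallest one have hue `B`. -/
  hue_block : ∀ B ∈ D.hues, ∀ i ∈ B, (∃ j ∈ B, j < i) → D.hue i = B
  /-- In total, `k_B` numbers have hue `B`. -/
  hue_card : ∀ B ∈ D.hues, (Finset.univ.filter fun i => D.hue i = B).card = P.kSum B
  /-- The underlined boxed numbers are the non-minimal elements of the blocks. -/
  under_boxed : ∀ i ∈ P.boxed, i ∈ D.under ↔ ∃ B ∈ D.hues, i ∈ B ∧ ∃ j ∈ B, j < i
  /-- The underlined unboxed numbers are arbitrary among those whose hue matches their color. -/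
  under_unboxed : ∀ i ∉ P.boxed, i ∈ D.under → P.HueMatches D i

open Classical in
/-- The set `𝒟(k)` of all decorations. -/
noncomputable def decorations : Finset (Marking n) := Finset.univ.filter P.IsDecoration

/-- The decoration is mismatched: no unboxed number has a hue that matches its color. -/
def IsMismatched (D : Marking n) : Prop := ∀ i ∉ P.boxed, ¬ P.HueMatches D i

open Classical in
/-- The set `ℳ𝒟(k)` of all mismatched decorations. -/
noncomputable def mismatchedDecorations : Finset (Marking n) := P.decorations.filter P.IsMismatched

/-! ### The first involution -/

/-- The unboxed numbers whose hue matches their color. -/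
def matchedUnboxed (D : Marking n) : Finset (Fin n) :=
  Finset.univ.filter fun i => i ∉ P.boxed ∧ P.HueMatches D i

/-- Toggle the underline of the smallest unboxed number whose hue matches its color, if any. -/
def phiUnder (D : Marking n) : Marking n :=
  if h : (P.matchedUnboxed D).Nonempty then
    { D with under := symmDiff D.under {(P.matchedUnboxed D).min' h} }
  else D

/-! ### Chains and permission -/

/-- The set `I` for the color `c`: boxed numbers of color `c` that are not crossed out, not
underlined, and whose hue matches their color. -/
def chainSet (D : Marking n) (c : Fin m) : Finset (Fin n) :=
  Finset.univ.filter fun i =>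
    i ∈ P.boxed ∧ P.color i = c ∧ i ∉ P.crossed ∧ i ∉ D.under ∧ P.HueMatches D i

/-- The number chain decomposition in the color `c`, as the list of its chains. -/
def numberChains (D : Marking n) (c : Fin m) : List (List (Fin n)) :=
  if h : (P.chainSet D c).Nonempty then
    chainsFrom D.hue ((P.chainSet D c).min' h) ((P.chainSet D c).erase ((P.chainSet D c).min' h))
  else []

/-- The number chain order in the color `c`: the decomposition without its parentheses. -/
def chainOrder (D : Marking n) (c : Fin m) : List (Fin n) := (P.numberChains D c).flatten

/-- The permission list of a set `S` of numbers whose hues have color `c`: first the elements of `S`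
of color `c` in number chain order, then the other elements of `S` in ascending order. -/
def permissionList (D : Marking n) (c : Fin m) (S : Finset (Fin n)) : List (Fin n) :=
  (P.chainOrder D c).filter (fun i => i ∈ S) ++ (S.filter fun i => P.color i ≠ c).sort (· ≤ ·)

/-- The singleton hue `{t}` wants to merge with the hue `B` of the same color, where `r = min B`. -/
def WantsToMerge (D : Marking n) (t : Fin n) (B : Finset (Fin n)) (r : Fin n) : Prop :=
  {t} ∈ D.hues ∧ B ∈ D.hues ∧ B.min = (r : WithTop (Fin n)) ∧ P.color r = P.color t ∧ t < r ∧
    D.hue r = {t}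

instance (D : Marking n) (t : Fin n) (B : Finset (Fin n)) (r : Fin n) :
    Decidable (P.WantsToMerge D t B r) := by
  unfold WantsToMerge; infer_instance

/-- The number `q` immediately precedes `r` in one of the number chains of the color `c`. -/
def PrecedesInChain (D : Marking n) (c : Fin m) (q r : Fin n) : Prop :=
  ∃ l ∈ P.numberChains D c, [q, r] <:+: l

instance (D : Marking n) (c : Fin m) (q r : Fin n) : Decidable (P.PrecedesInChain D c q r) := by
  unfold PrecedesInChain; infer_instance

/-- The set `S` in the second condition for permission: the non-underlined numbers with hue `{t}` or
`B`, other than `r` and other than the number preceding `r` in its chain (if any). -/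
def permissionSet (D : Marking n) (t : Fin n) (B : Finset (Fin n)) (r : Fin n) :
    Finset (Fin n) :=
  Finset.univ.filter fun x =>
    x ∉ D.under ∧ (D.hue x = {t} ∨ D.hue x = B) ∧ x ≠ r ∧ ¬ P.PrecedesInChain D (P.color t) x r

/-- The singleton hue `{t}` has permission to merge with `B`: it wants to; `r = min B` is the first
number of hue `{t}` in number chain order; and in the permission list of the set `S` above, no
number of hue `{t}` comes before a number of hue `B`. -/
def HasPermission (D : Marking n) (t : Fin n) (B : Finset (Fin n)) : Prop :=
  ∃ r, P.WantsToMerge D t B r ∧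
    (P.chainOrder D (P.color t)).find? (fun i => D.hue i = {t}) = some r ∧
    (P.permissionList D (P.color t) (P.permissionSet D t B r)).Pairwise
      (fun x y => ¬ (D.hue x = {t} ∧ D.hue y = B))

instance (D : Marking n) (t : Fin n) (B : Finset (Fin n)) :
    Decidable (P.HasPermission D t B) := by
  unfold HasPermission; infer_instance

/-! ### The second involution -/

/-- The minima of the non-singleton hues. -/
def splitCandidates (D : Marking n) : Finset (Fin n) :=
  Finset.univ.filter fun i => ∃ B ∈ D.hues, 1 < B.card ∧ B.min = (i : WithTop (Fin n))

/-- The numbers `t` such that `{t}` has permission to merge with some hue. -/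
def mergeCandidates (D : Marking n) : Finset (Fin n) :=
  Finset.univ.filter fun t => ∃ B ∈ D.hues, P.HasPermission D t B

/-- The unique non-singleton hue with minimum `a` (written as the union of all of them). -/
def splitBlock (D : Marking n) (a : Fin n) : Finset (Fin n) :=
  (D.hues.filter fun B => 1 < B.card ∧ B.min = (a : WithTop (Fin n))).sup id

/-- The unique hue with which `{t}` has permission to merge (written as the union of all of them). -/
def mergeBlock (D : Marking n) (t : Fin n) : Finset (Fin n) :=
  (D.hues.filter fun B => P.HasPermission D t B).sup id

/-- The number `q` of the split procedure for the block `B` with `B' = B \ {min B}` in the color `c`: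
if some chain that starts with a number less than `r = min B'` contains a number of hue `B`, then
`q` is the first number of hue `B` in number chain order. -/
def splitQ (D : Marking n) (c : Fin m) (B B' : Finset (Fin n)) : Option (Fin n) :=
  if ∃ l ∈ P.numberChains D c,
      (∃ i ∈ l.head?, (i : WithTop (Fin n)) < B'.min) ∧ ∃ x ∈ l, D.hue x = B then
    (P.chainOrder D c).find? (fun i => D.hue i = B)
  else none

/-- The hues after the first three steps of splitting `B` into `{a}` and `B'`: the number `min B'`
gets hue `{a}`; the other numbers in `B'` and the number `q` (if it exists) get hue `B'`. -/
def splitHueAux (D : Marking n) (a : Fin n) (B B' : Finset (Fin n)) (x : Fin n) :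
    Finset (Fin n) :=
  if B'.min = (x : WithTop (Fin n)) then {a}
  else if x ∈ B' then B'
  else if P.splitQ D (P.color a) B B' = some x then B'
  else D.hue x

/-- The numbers of hue `B` that become `B'` in the fourth step: an initial piece of the permission
list of the numbers that still have hue `B`, such that the number of all numbers of hue `B'` becomes
`k_{B'}`. -/
def splitInitial (D : Marking n) (a : Fin n) (B B' : Finset (Fin n)) : List (Fin n) :=
  (P.permissionList D (P.color a)
      (Finset.univ.filter fun x => P.splitHueAux D a B B' x = B)).take
    (P.kSum B' - (Finset.univ.filter fun x => P.splitHueAux D a B B' x = B').card)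

/-- Split `B` into `{a}` and `B'`; the underline of `min B'` is removed. -/
def splitInto (D : Marking n) (a : Fin n) (B B' : Finset (Fin n)) : Marking n where
  hues := insert {a} (insert B' (D.hues.erase B))
  hue x :=
    if P.splitHueAux D a B B' x = B then
      if x ∈ P.splitInitial D a B B' then B' else {a}
    else P.splitHueAux D a B B' x
  under := D.under.filter fun x => B'.min ≠ (x : WithTop (Fin n))

/-- Split the non-singleton hue with minimum `a`. -/
def splitAt (D : Marking n) (a : Fin n) : Marking n :=
  P.splitInto D a (splitBlock D a) ((splitBlock D a).erase a)

/-- Merge the hues `{t}` and `B` into one hue, and underline `min B`. -/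
def mergeWith (D : Marking n) (t : Fin n) (B : Finset (Fin n)) : Marking n where
  hues := insert (insert t B) ((D.hues.erase {t}).erase B)
  hue x := if D.hue x = {t} ∨ D.hue x = B then insert t B else D.hue x
  under := D.under ∪ B.filter fun x => B.min = (x : WithTop (Fin n))

/-- The map `φ^hue`. The minimum of a `Finset` is `⊤` when it is empty, so the first comparison says
that `m` exists, and `m < t` or `t` does not exist; similarly for the second one. -/
def phiHue (D : Marking n) : Marking n :=
  if h : (splitCandidates D).Nonempty ∧ (splitCandidates D).min < (P.mergeCandidates D).min then
    P.splitAt D ((splitCandidates D).min' h.1)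
  else if h : (P.mergeCandidates D).Nonempty ∧
      (P.mergeCandidates D).min < (splitCandidates D).min then
    mergeWith D ((P.mergeCandidates D).min' h.1)
      (P.mergeBlock D ((P.mergeCandidates D).min' h.1))
  else D

/-- A fixed point decoration is a mismatched decoration all of whose hues are singletons, none of
which has permission to merge with another. -/
def IsFixedPoint (D : Marking n) : Prop :=
  D ∈ P.mismatchedDecorations ∧ (∀ B ∈ D.hues, B.card = 1) ∧ ∀ t B, ¬ P.HasPermission D t B

open Classical in
/-- The set of all fixed point decorations. -/
noncomputable def fixedPointDecorations : Finset (Marking n) := Finset.univ.filter P.IsFixedPoint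

/-! ### The alternating sum -/

/-- The multinomial coefficient of `ℓ(𝒫) - 3` over the numbers `k_B - |B| + 1` for `B ∈ 𝒫`, and zero
if one of these is negative. (The numbers `k_B - |B| + 1` add up to `ℓ(𝒫) - 3`, because the
exponents add up to `n - 3`.) -/
def multinomialTerm (Q : Finpartition (Finset.univ : Finset (Fin n))) : ℕ :=
  if ∀ B ∈ Q.parts, B.card ≤ P.kSum B + 1 then
    Nat.multinomial Q.parts fun B => P.kSum B + 1 - B.card
  else 0

/-- The alternating multinomial sum over all set partitions with monochromatic blocks. -/
def alternatingSum : ℤ :=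
  ∑ Q : Finpartition (Finset.univ : Finset (Fin n)) with ∀ B ∈ Q.parts, P.Monochromatic B,
    (-1) ^ (∑ B ∈ Q.parts, (B.card - 1)) * (P.multinomialTerm Q : ℤ)

end ColoredExponents

/-!
A decoration amounts to a partition of all numbers into monochromatic blocks, namely the hues
enlarged by the underlined unboxed numbers, together with an assignment of a block to each minimum
of a block that is not crossed out. Every block `B` is assigned `k_B - |B| + 1` times, so these
assignments are counted by the multinomial coefficient. The underlined numbers are the other
elements of the blocks, whence the sign.

Toggling the underline of an unboxed number that has a hue of its own color preserves all
conditions on a decoration, which leaves the mismatched ones.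

The number chain order is a walk: after `i` comes the minimum of the hue of `i`, or the smallest
remaining number if that is not available. Merging `{t}` with `B` contracts the step from
`r = min B` to `t` of this walk. Hence the order of all other numbers remains the same, permission
to merge says that the numbers of hue `B` are the first ones among those of the merged hue, and
splitting inverts merging. The size of the numbers `a` and `t` decides which of the two is applied,
and this decision is reversed by the operation because permission for numbers smaller than `t` is
unaffected.
-/

open scoped List

/-! ### The order in which a list presents its elements -/

section ListedBefore

variable {β : Type*} {L M : List β} {p : β → Bool} {x y z : β}

/-- The order in which a duplicate-free list presents its elements: `x` is listed before `y`. (If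
`L` has duplicates, some occurrence of `x` comes before some occurrence of `y`.) -/
def ListedBefore (L : List β) (x y : β) : Prop := [x, y] <+ L

theorem listedBefore_cons : ListedBefore (z :: L) x y ↔ x = z ∧ y ∈ L ∨ ListedBefore L x y := by
  rw [ListedBefore, List.cons_sublist_cons', List.singleton_sublist, or_comm, ListedBefore]

theorem not_listedBefore_nil : ¬ ListedBefore [] x y := by simp [ListedBefore]

theorem listedBefore_append : ListedBefore (L ++ M) x y ↔
    ListedBefore L x y ∨ x ∈ L ∧ y ∈ M ∨ ListedBefore M x y := by
  induction L with
  | nil => simp [not_listedBefore_nil]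
  | cons z L ih =>
    rw [List.cons_append, listedBefore_cons, ih, listedBefore_cons, List.mem_append, List.mem_cons]
    tauto

theorem listedBefore_filter : ListedBefore (L.filter p) x y ↔ ListedBefore L x y ∧ p x ∧ p y := by
  induction L with
  | nil => simp [not_listedBefore_nil]
  | cons z L ih =>
    rw [listedBefore_cons, List.filter_cons]
    split_ifs with hz
    · rw [listedBefore_cons, ih, List.mem_filter]
      grind
    · rw [ih]
      grind

theorem ListedBefore.mem_left (h : ListedBefore L x y) : x ∈ L := h.subset (by simp)

theorem ListedBefore.mem_right (h : ListedBefore L x y) : y ∈ L := h.subset (by simp)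

theorem ListedBefore.asymm (hL : L.Nodup) (h : ListedBefore L x y) : ¬ ListedBefore L y x := by
  intro h'
  induction L with
  | nil => exact not_listedBefore_nil h
  | cons z L ih =>
    rw [List.nodup_cons] at hL
    rw [listedBefore_cons] at h h'
    rcases h with ⟨rfl, -⟩ | h <;> rcases h' with ⟨rfl, h'⟩ | h'
    · exact hL.1 h'
    · exact hL.1 h'.mem_right
    · exact hL.1 h.mem_right
    · exact ih hL.2 h h'

theorem ListedBefore.ne (hL : L.Nodup) (h : ListedBefore L x y) : x ≠ y := by
  rintro rfl
  exact h.asymm hL h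

theorem ListedBefore.trans (hL : L.Nodup) (h : ListedBefore L x y) (h' : ListedBefore L y z) :
    ListedBefore L x z := by
  induction L with
  | nil => exact absurd h not_listedBefore_nil
  | cons w L ih =>
    rw [List.nodup_cons] at hL
    rw [listedBefore_cons] at h h' ⊢
    rcases h with ⟨rfl, h⟩ | h <;> rcases h' with ⟨rfl, -⟩ | h'
    · exact absurd h hL.1
    · exact Or.inl ⟨rfl, h'.mem_right⟩
    · exact absurd h.mem_right hL.1
    · exact Or.inr (ih hL.2 h h')

theorem listedBefore_or_listedBefore (hx : x ∈ L) (hy : y ∈ L) (hxy : x ≠ y) :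
    ListedBefore L x y ∨ ListedBefore L y x := by
  induction L with
  | nil => simp at hx
  | cons z L ih =>
    simp only [listedBefore_cons]
    grind

theorem not_listedBefore_head (hL : (y :: L).Nodup) : ¬ ListedBefore (y :: L) x y := by
  rw [List.nodup_cons] at hL
  rw [listedBefore_cons, not_or]
  exact ⟨fun h => hL.1 h.2, fun h => hL.1 h.mem_right⟩

theorem listedBefore_iff_lt [LinearOrder β] (hL : L.Pairwise (· < ·)) (hx : x ∈ L) (hy : y ∈ L) :
    ListedBefore L x y ↔ x < y := by
  refine ⟨List.pairwise_iff_forall_sublist.1 hL, fun hxy => ?_⟩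
  refine (listedBefore_or_listedBefore hx hy hxy.ne).resolve_right fun h => ?_
  exact hxy.asymm (List.pairwise_iff_forall_sublist.1 hL h)

theorem find?_eq_some_iff_of_nodup (hL : L.Nodup) :
    L.find? p = some x ↔ x ∈ L ∧ p x ∧ ∀ y, ListedBefore L y x → ¬ p y := by
  induction L with
  | nil => simp
  | cons z L ih =>
    rw [List.nodup_cons] at hL
    by_cases hz : p z
    · rw [List.find?_cons_of_pos hz, Option.some_inj]
      refine ⟨?_, fun ⟨hx, _, hfirst⟩ => ?_⟩
      · rintro rfl
        exact ⟨by simp, hz, fun y hy => absurd hy (not_listedBefore_head (List.nodup_cons.2 hL))⟩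
      · by_contra hne
        exact hfirst z (listedBefore_cons.2
          (Or.inl ⟨rfl, (List.mem_cons.1 hx).resolve_left (Ne.symm hne)⟩)) hz
    · rw [List.find?_cons_of_neg hz, ih hL.2]
      simp only [listedBefore_cons]
      grind

theorem listedBefore_of_mem_take {j : ℕ} (hx : x ∈ L.take j) (hy : y ∈ L)
    (hy' : y ∉ L.take j) : ListedBefore L x y := by
  rw [← List.take_append_drop j L, List.mem_append] at hy
  rw [← List.take_append_drop j L, listedBefore_append]
  exact Or.inr (Or.inl ⟨hx, hy.resolve_left hy'⟩)

theorem take_countP_eq_filter (h : L.Pairwise fun x y => p y → p x) :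
    L.take (L.countP p) = L.filter p := by
  induction L with
  | nil => simp
  | cons z L ih =>
    rw [List.pairwise_cons] at h
    by_cases hz : p z
    · rw [List.countP_cons_of_pos hz, List.take_succ_cons, ih h.2, List.filter_cons_of_pos hz]
    · have hL : ∀ x ∈ L, ¬ p x := fun x hx hp => hz (h.1 x hx hp)
      rw [List.countP_cons_of_neg hz, List.countP_eq_zero.2 hL, List.filter_cons_of_neg hz,
        List.filter_eq_nil_iff.2 hL, List.take_zero]

end ListedBefore

/-! ### Walks along target maps -/

section Walk

variable {α : Type*} [LinearOrder α]

/-- The list `L` is produced by the following walk: the next element is the target `o` of the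
previous one if `o` has not been listed before, and the smallest remaining element otherwise. The
target of `x` is `g x`, where `⊤` stands for a missing target. The number chain order is a walk
along `x ↦ min (hue x)`. -/
def IsWalk (g : α → WithTop α) : WithTop α → List α → Prop
  | _, [] => True
  | o, y :: L =>
    y ∉ L ∧ (o = y ∨ (∀ z ∈ L, o ≠ z) ∧ ∀ z ∈ L, y < z) ∧ IsWalk g (g y) L

namespace IsWalk

variable {g g' : α → WithTop α} {o o' : WithTop α} {L L' : List α} {x y z : α}

theorem nodup (h : IsWalk g o L) : L.Nodup := by
  induction L generalizing o with
  | nil => exact List.nodup_nil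
  | cons y L ih => exact List.nodup_cons.2 ⟨h.1, ih h.2.2⟩

theorem head_eq (h : IsWalk g o (x :: L)) (h' : IsWalk g o (y :: L')) (hx : x = y ∨ x ∈ L')
    (hy : y = x ∨ y ∈ L) : x = y := by
  rcases hx with hx | hx
  · exact hx
  rcases hy with hy | hy
  · exact hy.symm
  rcases h.2.1 with hox | hox <;> rcases h'.2.1 with hoy | hoy
  · exact WithTop.coe_injective (hox.symm.trans hoy)
  · exact absurd hox (hoy.1 x hx)
  · exact absurd hoy (hox.1 y hy)
  · exact absurd (hox.2 y hy) (hoy.2 x hx).asymm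

theorem eq_of_mem_iff (h : IsWalk g o L) (h' : IsWalk g o L') (hm : ∀ x, x ∈ L ↔ x ∈ L') :
    L = L' := by
  induction L generalizing o L' with
  | nil => exact (List.eq_nil_iff_forall_not_mem.2 fun x hx => by simpa using (hm x).2 hx).symm
  | cons y L ih =>
    cases L' with
    | nil => simpa using (hm y).1 (by simp)
    | cons y' L' =>
      obtain rfl := h.head_eq h' (List.mem_cons.1 ((hm y).1 (by simp)))
        (List.mem_cons.1 ((hm y').2 (by simp)))
      rw [ih h.2.2 h'.2.2]
      intro x
      have hx := hm x
      have hxL : x ∈ L → x ≠ y := fun hx hxy => h.1 (hxy ▸ hx)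
      have hxL' : x ∈ L' → x ≠ y := fun hx hxy => h'.1 (hxy ▸ hx)
      rw [List.mem_cons, List.mem_cons] at hx
      tauto

theorem not_listedBefore_start (h : IsWalk g y L) : ¬ ListedBefore L x y := by
  cases L with
  | nil => exact not_listedBefore_nil
  | cons w L =>
    rcases h.2.1 with hw | hw
    · obtain rfl := WithTop.coe_injective hw
      exact not_listedBefore_head h.nodup
    · rw [listedBefore_cons, not_or]
      exact ⟨fun hy => hw.1 y hy.2 rfl, fun hy => hw.1 y hy.mem_right rfl⟩

theorem target_ne_of_between (h : IsWalk g o L) (hxz : ListedBefore L x z)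
    (hzy : ListedBefore L z y) : g x ≠ y := by
  induction L generalizing o with
  | nil => exact absurd hxz not_listedBefore_nil
  | cons w L ih =>
    have hzL : z ∈ L := by
      rcases listedBefore_cons.1 hxz with hxz | hxz
      exacts [hxz.2, hxz.mem_right]
    have hzyL : ListedBefore L z y :=
      (listedBefore_cons.1 hzy).resolve_left fun hzw => h.1 (hzw.1 ▸ hzL)
    rcases listedBefore_cons.1 hxz with ⟨rfl, -⟩ | hxz
    · intro hxy
      have hL := h.2.2
      rw [hxy] at hL
      exact hL.not_listedBefore_start hzyL
    · exact ih h.2.2 hxz hzyL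

theorem congr_target (h : IsWalk g o L) (ho : o' = o ∨ ∀ z ∈ L, o' ≠ z ∧ o ≠ z)
    (hg : ∀ x ∈ L, g' x = g x ∨ ∀ z, ListedBefore L x z → g' x ≠ z ∧ g x ≠ z) :
    IsWalk g' o' L := by
  induction L generalizing o o' with
  | nil => trivial
  | cons y L ih =>
    refine ⟨h.1, ?_, ih h.2.2 ?_ fun x hx => ?_⟩
    · rcases ho with rfl | ho
      · exact h.2.1
      · exact Or.inr ⟨fun z hz => (ho z (by simp [hz])).1,
          (h.2.1.resolve_left (ho y (by simp)).2).2⟩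
    · exact (hg y (by simp)).imp_right fun hy z hz =>
        hy z (listedBefore_cons.2 (Or.inl ⟨rfl, hz⟩))
    · exact (hg x (by simp [hx])).imp_right fun hx z hz =>
        hx z (listedBefore_cons.2 (Or.inr hz))

theorem contract_head {r t : α} (h : IsWalk g o (r :: L)) (hr : g r = t) (htr : t < r)
    (hg : ∀ x ∈ L, g' x = if g x = r then ↑t else g x) :
    IsWalk g' (if o = r then ↑t else o) L := by
  have hL : IsWalk g t L := hr ▸ h.2.2
  refine hL.congr_target ?_ fun x hx => ?_
  · split_ifs with ho
    · exact Or.inl rfl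
    · obtain ⟨hoL, hrL⟩ := h.2.1.resolve_left ho
      refine Or.inr fun z hz => ⟨hoL z hz, ?_⟩
      exact WithTop.coe_injective.ne (htr.trans (hrL z hz)).ne
  · rw [hg x hx]
    split_ifs with hxr
    · refine Or.inr fun z hz => ⟨fun htz => ?_, fun hxz => ?_⟩
      · exact hL.not_listedBefore_start (WithTop.coe_injective htz ▸ hz)
      · exact h.1 (WithTop.coe_injective (hxz.symm.trans hxr) ▸ hz.mem_right)
    · exact Or.inl rfl

/-- Contracting the step from `r` to its target `t` removes `r` from the walk: what was directed to
`r` is now directed to `t`. The condition `t < r` ensures that a chain opened at `r` has already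
passed `t`. -/
theorem filter_ne {r t : α} (h : IsWalk g o L) (hr : g r = t) (htr : t < r) (hrL : r ∈ L)
    (hg : ∀ x ∈ L, x ≠ r → g' x = if g x = r then ↑t else g x) :
    IsWalk g' (if o = r then ↑t else o) (L.filter (· ≠ r)) := by
  induction L generalizing o with
  | nil => trivial
  | cons y L ih =>
    by_cases hyr : y = r
    · subst hyr
      have hne : ∀ x ∈ L, x ≠ y := fun x hx hxy => h.1 (hxy ▸ hx)
      rw [List.filter_cons_of_neg (by simp), List.filter_eq_self.2 (by simpa using hne)]
      exact h.contract_head hr htr fun x hx => hg x (by simp [hx]) (hne x hx)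
    · have hrL : r ∈ L := (List.mem_cons.1 hrL).resolve_left (Ne.symm hyr)
      have ho : o ≠ r := by
        rintro rfl
        rcases h.2.1 with hoy | hoy
        · exact hyr (WithTop.coe_injective hoy.symm)
        · exact hoy.1 r hrL rfl
      rw [List.filter_cons_of_pos (by simpa using hyr), if_neg ho]
      refine ⟨fun hy => h.1 (List.mem_filter.1 hy).1, ?_, ?_⟩
      · exact h.2.1.imp_right fun hoy => ⟨fun z hz => hoy.1 z (List.mem_filter.1 hz).1,
          fun z hz => hoy.2 z (List.mem_filter.1 hz).1⟩
      · rw [hg y (by simp) hyr]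
        exact ih h.2.2 hrL fun x hx => hg x (by simp [hx])

end IsWalk

end Walk

/-! ### Number chains -/

section ChainsFrom

variable {n : ℕ}

theorem exists_chainsFrom_eq_cons (hue : Fin n → Finset (Fin n)) (cur : Fin n)
    (R : Finset (Fin n)) : ∃ l LL, chainsFrom hue cur R = (cur :: l) :: LL := by
  fun_induction chainsFrom hue cur R with
  | case1 cur R h ih =>
    obtain ⟨l, LL, hl⟩ := ih
    exact ⟨_, LL, by rw [hl, List.modifyHead_cons]⟩
  | case2 => exact ⟨_, _, rfl⟩
  | case3 => exact ⟨_, _, rfl⟩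

theorem mem_flatten_chainsFrom {hue : Fin n → Finset (Fin n)} {cur x : Fin n}
    {R : Finset (Fin n)} : x ∈ (chainsFrom hue cur R).flatten ↔ x = cur ∨ x ∈ R := by
  fun_induction chainsFrom hue cur R with
  | case1 cur R h ih =>
    obtain ⟨l, LL, hl⟩ := exists_chainsFrom_eq_cons hue ((hue cur).min' h.1)
      (R.erase ((hue cur).min' h.1))
    rw [hl] at ih ⊢
    rw [List.modifyHead_cons, List.flatten_cons, List.cons_append, List.mem_cons,
      ← List.flatten_cons, ih, Finset.mem_erase]
    by_cases hx : x = (hue cur).min' h.1 <;> simp [hx, h.2]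
  | case2 cur R _ hR ih =>
    rw [List.flatten_cons, List.singleton_append, List.mem_cons, ih, Finset.mem_erase]
    by_cases hx : x = R.min' hR <;> simp [hx, R.min'_mem hR]
  | case3 cur R _ hR => simp [Finset.not_nonempty_iff_eq_empty.1 hR]

theorem isWalk_flatten_chainsFrom {hue : Fin n → Finset (Fin n)} {cur : Fin n}
    {R : Finset (Fin n)} {o : WithTop (Fin n)} (hcur : cur ∉ R)
    (ho : o = cur ∨ (∀ z ∈ R, o ≠ z) ∧ ∀ z ∈ R, cur < z) :
    IsWalk (fun x => (hue x).min) o (chainsFrom hue cur R).flatten := by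
  fun_induction chainsFrom hue cur R generalizing o with
  | case1 cur R h ih =>
    have hmem (z) : z ∈ (chainsFrom hue ((hue cur).min' h.1)
        (R.erase ((hue cur).min' h.1))).flatten ↔ z ∈ R := by
      rw [mem_flatten_chainsFrom, Finset.mem_erase]
      by_cases hz : z = (hue cur).min' h.1 <;> simp [hz, h.2]
    have hwalk := ih (Finset.notMem_erase _ R) (Or.inl (Finset.coe_min' h.1).symm)
    obtain ⟨l, LL, hl⟩ := exists_chainsFrom_eq_cons hue ((hue cur).min' h.1)
      (R.erase ((hue cur).min' h.1))
    rw [hl] at hwalk hmem ⊢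
    rw [List.modifyHead_cons, List.flatten_cons, List.cons_append, ← List.flatten_cons]
    exact ⟨by rwa [hmem], by simpa only [hmem] using ho, hwalk⟩
  | case2 cur R h hR ih =>
    have hmem (z) : z ∈ (chainsFrom hue (R.min' hR) (R.erase (R.min' hR))).flatten ↔ z ∈ R := by
      rw [mem_flatten_chainsFrom, Finset.mem_erase]
      by_cases hz : z = R.min' hR <;> simp [hz, R.min'_mem hR]
    have target_ne : ∀ z ∈ R, (hue cur).min ≠ z := by
      intro z hz hmin
      have hB : (hue cur).Nonempty := ⟨z, Finset.mem_of_min hmin⟩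
      exact h ⟨hB, by rwa [WithTop.coe_injective ((Finset.coe_min' hB).trans hmin)]⟩
    rw [List.flatten_cons, List.singleton_append]
    refine ⟨by rwa [hmem], by simpa only [hmem] using ho, ih (Finset.notMem_erase _ R)
      (Or.inr ⟨fun z hz => ?_, fun z hz => ?_⟩)⟩
    · exact target_ne z (Finset.mem_of_mem_erase hz)
    · exact R.min'_lt_of_mem_erase_min' hR hz
  | case3 => exact ⟨by simp, Or.inr (by simp), trivial⟩

end ChainsFrom

namespace ColoredExponents

variable {n m : ℕ} (P : ColoredExponents n m) (D : Marking n) (c : Fin m)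

theorem isWalk_chainOrder : IsWalk (fun x => (D.hue x).min) ⊤ (P.chainOrder D c) := by
  rw [chainOrder, numberChains]
  split_ifs with h
  · exact isWalk_flatten_chainsFrom (Finset.notMem_erase _ _)
      (Or.inr ⟨by simp, fun z hz => Finset.min'_lt_of_mem_erase_min' _ h hz⟩)
  · trivial

theorem nodup_chainOrder : (P.chainOrder D c).Nodup := (P.isWalk_chainOrder D c).nodup

variable {P D c}

theorem mem_chainOrder {x : Fin n} : x ∈ P.chainOrder D c ↔ x ∈ P.chainSet D c := by
  rw [chainOrder, numberChains]
  split_ifs with h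
  · rw [mem_flatten_chainsFrom, Finset.mem_erase]
    by_cases hx : x = (P.chainSet D c).min' h <;> simp [hx, Finset.min'_mem]
  · simp [Finset.not_nonempty_iff_eq_empty.1 h]

theorem PrecedesInChain.listedBefore {x y : Fin n} (h : P.PrecedesInChain D c x y) :
    ListedBefore (P.chainOrder D c) x y := by
  obtain ⟨l, hl, hxy⟩ := h
  exact hxy.sublist.trans (List.sublist_flatten_of_mem hl)

end ColoredExponents

namespace ColoredExponents

variable {n m : ℕ} {P : ColoredExponents n m} {D : Marking n}

/-! ### Decorations -/

theorem mem_mismatchedDecorations :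
    D ∈ P.mismatchedDecorations ↔ P.IsDecoration D ∧ P.IsMismatched D := by
  simp [mismatchedDecorations, decorations]

theorem mem_boxed {i : Fin n} : i ∈ P.boxed ↔ 0 < P.k i := by simp [boxed]

namespace IsDecoration

theorem eq_of_mem (hD : P.IsDecoration D) {B B' : Finset (Fin n)} (hB : B ∈ D.hues)
    (hB' : B' ∈ D.hues) {i : Fin n} (hi : i ∈ B) (hi' : i ∈ B') : B = B' := by
  by_contra h
  exact Finset.disjoint_left.1 (hD.hues_disjoint B hB B' hB' h) hi hi'

theorem mem_boxed_iff (hD : P.IsDecoration D) {i : Fin n} : i ∈ P.boxed ↔ ∃ B ∈ D.hues, i ∈ B := by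
  rw [← hD.hues_union]
  simp

theorem boxed_of_mem (hD : P.IsDecoration D) {B : Finset (Fin n)} (hB : B ∈ D.hues) {i : Fin n}
    (hi : i ∈ B) : i ∈ P.boxed :=
  hD.mem_boxed_iff.2 ⟨B, hB, hi⟩

theorem notMem_crossed (hD : P.IsDecoration D) {x : Fin n} (h : D.hue x ∈ D.hues) :
    x ∉ P.crossed :=
  fun hx => (hD.hues_nonempty _ h).ne_empty (hD.hue_crossed x hx)

theorem hueMatches_iff (hD : P.IsDecoration D) {x b : Fin n} (h : D.hue x ∈ D.hues)
    (hb : b ∈ D.hue x) : P.HueMatches D x ↔ P.color b = P.color x := by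
  refine ⟨?_, fun hcolor => ⟨b, hb, hcolor⟩⟩
  rintro ⟨b', hb', hcolor⟩
  rw [← hcolor]
  exact hD.hues_monochromatic _ h b hb b' hb'

theorem hue_mem_of_hueMatches (hD : P.IsDecoration D) {x : Fin n} (h : P.HueMatches D x) :
    D.hue x ∈ D.hues := by
  obtain ⟨b, hb, _⟩ := h
  exact hD.hue_mem x fun hx => Finset.ne_empty_of_mem hb (hD.hue_crossed x hx)

theorem mem_under_iff (hD : P.IsDecoration D) (hM : P.IsMismatched D) {x : Fin n} :
    x ∈ D.under ↔ ∃ B ∈ D.hues, x ∈ B ∧ ∃ j ∈ B, j < x := by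
  by_cases hx : x ∈ P.boxed
  · exact hD.under_boxed x hx
  · constructor
    · exact fun h => absurd (hD.under_unboxed x hx h) (hM x hx)
    · rintro ⟨B, hB, hxB, _⟩
      exact absurd (hD.boxed_of_mem hB hxB) hx

theorem mem_under_iff_of_mem (hD : P.IsDecoration D) {B : Finset (Fin n)} (hB : B ∈ D.hues)
    {x : Fin n} (hx : x ∈ B) : x ∈ D.under ↔ ∃ j ∈ B, j < x := by
  rw [hD.under_boxed x (hD.boxed_of_mem hB hx)]
  constructor
  · rintro ⟨B', hB', hxB', h⟩
    rwa [hD.eq_of_mem hB hB' hx hxB']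
  · exact fun h => ⟨B, hB, hx, h⟩

theorem min_notMem_under (hD : P.IsDecoration D) {B : Finset (Fin n)} (hB : B ∈ D.hues) {x : Fin n}
    (hx : B.min = (x : WithTop (Fin n))) : x ∉ D.under := by
  rw [hD.mem_under_iff_of_mem hB (Finset.mem_of_min hx)]
  rintro ⟨j, hj, hjx⟩
  exact absurd (Finset.min_le_of_eq hj hx) (not_le.2 hjx)

theorem mem_chainSet_iff (hD : P.IsDecoration D) (hM : P.IsMismatched D) {c : Fin m} {x : Fin n} :
    x ∈ P.chainSet D c ↔ P.color x = c ∧ x ∉ D.under ∧ P.HueMatches D x := by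
  simp only [chainSet, Finset.mem_filter, Finset.mem_univ, true_and]
  constructor
  · rintro ⟨_, hcolor, _, hunder, hmatch⟩
    exact ⟨hcolor, hunder, hmatch⟩
  · rintro ⟨hcolor, hunder, hmatch⟩
    exact ⟨by_contra fun hx => hM x hx hmatch, hcolor,
      hD.notMem_crossed (hD.hue_mem_of_hueMatches hmatch), hunder, hmatch⟩

theorem mem_chainOrder_iff_of_hue (hD : P.IsDecoration D) (hM : P.IsMismatched D) {x b : Fin n}
    {B : Finset (Fin n)} (hx : D.hue x = B) (hb : b ∈ B) :
    x ∈ P.chainOrder D (P.color b) ↔ P.color x = P.color b ∧ x ∉ D.under := by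
  rw [mem_chainOrder, hD.mem_chainSet_iff hM]
  exact ⟨fun h => ⟨h.1, h.2.1⟩, fun h => ⟨h.1, h.2, b, hx ▸ hb, h.1.symm⟩⟩

end IsDecoration

/-! ### The order of the permission lists -/

theorem color_eq_of_mem_chainOrder {c : Fin m} {x : Fin n} (hx : x ∈ P.chainOrder D c) :
    P.color x = c := by
  rw [mem_chainOrder, chainSet, Finset.mem_filter] at hx
  exact hx.2.2.1

/-- The permission list of the set of all numbers. The permission list of any other set presents its
elements in the same order. -/
def permissionOrder (P : ColoredExponents n m) (D : Marking n) (c : Fin m) : List (Fin n) :=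
  P.permissionList D c Finset.univ

theorem permissionOrder_eq_append {c : Fin m} : P.permissionOrder D c =
    P.chainOrder D c ++ (Finset.univ.filter fun i => P.color i ≠ c).sort (· ≤ ·) := by
  simp [permissionOrder, permissionList]

theorem mem_permissionOrder {c : Fin m} {x : Fin n} :
    x ∈ P.permissionOrder D c ↔ x ∈ P.chainOrder D c ∨ P.color x ≠ c := by
  simp [permissionOrder_eq_append]

theorem nodup_permissionOrder : (P.permissionOrder D c).Nodup := by
  rw [permissionOrder_eq_append, List.nodup_append']
  refine ⟨P.nodup_chainOrder D c, Finset.sort_nodup _ _, fun x hx hx' => ?_⟩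
  exact (Finset.mem_filter.1 ((Finset.mem_sort _).1 hx')).2 (color_eq_of_mem_chainOrder hx)

theorem permissionList_eq_filter {c : Fin m} {S : Finset (Fin n)} :
    P.permissionList D c S = (P.permissionOrder D c).filter (· ∈ S) := by
  rw [permissionOrder_eq_append, List.filter_append, permissionList]
  congr 1
  refine List.Perm.eq_of_pairwise' (Finset.pairwise_sort _ _)
    ((Finset.pairwise_sort _ _).filter _) ((List.perm_ext_iff_of_nodup (Finset.sort_nodup _ _)
      ((Finset.sort_nodup _ _).filter _)).2 fun x => ?_)
  simp [and_comm]

theorem listedBefore_permissionOrder {c : Fin m} {x y : Fin n} :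
    ListedBefore (P.permissionOrder D c) x y ↔ ListedBefore (P.chainOrder D c) x y ∨
      x ∈ P.chainOrder D c ∧ P.color y ≠ c ∨ P.color x ≠ c ∧ P.color y ≠ c ∧ x < y := by
  have hsort : ListedBefore ((Finset.univ.filter fun i => P.color i ≠ c).sort (· ≤ ·)) x y ↔
      P.color x ≠ c ∧ P.color y ≠ c ∧ x < y := by
    have hlt := listedBefore_iff_lt (x := x) (y := y)
      (Finset.sortedLT_sort (Finset.univ.filter fun i => P.color i ≠ c)).pairwise
    simp only [Finset.mem_sort, Finset.mem_filter, Finset.mem_univ, true_and] at hlt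
    refine ⟨fun h => ?_, fun h => (hlt h.1 h.2.1).2 h.2.2⟩
    have hx := h.mem_left
    have hy := h.mem_right
    simp only [Finset.mem_sort, Finset.mem_filter, Finset.mem_univ, true_and] at hx hy
    exact ⟨hx, hy, (hlt hx hy).1 h⟩
  rw [permissionOrder_eq_append, listedBefore_append, hsort]
  simp only [Finset.mem_sort, Finset.mem_filter, Finset.mem_univ, true_and]

theorem listedBefore_permissionOrder_iff_of_mem {c : Fin m} {x y : Fin n}
    (hy : y ∈ P.chainOrder D c) :
    ListedBefore (P.permissionOrder D c) x y ↔ ListedBefore (P.chainOrder D c) x y := by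
  simp [listedBefore_permissionOrder, color_eq_of_mem_chainOrder hy]

/-! ### Permission -/

/-- The number `r` is the first number of hue `H` in the number chain order of the color `c`. -/
def IsFirstOfHue (P : ColoredExponents n m) (D : Marking n) (c : Fin m) (H : Finset (Fin n))
    (r : Fin n) : Prop :=
  r ∈ P.chainOrder D c ∧ D.hue r = H ∧ ∀ x, ListedBefore (P.chainOrder D c) x r → D.hue x ≠ H

theorem find?_chainOrder_eq_some_iff {c : Fin m} {H : Finset (Fin n)} {r : Fin n} :
    (P.chainOrder D c).find? (fun i => D.hue i = H) = some r ↔ P.IsFirstOfHue D c H r := by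
  rw [find?_eq_some_iff_of_nodup (P.nodup_chainOrder D c)]
  simp [IsFirstOfHue]

theorem IsFirstOfHue.unique {c : Fin m} {H : Finset (Fin n)} {r r' : Fin n}
    (h : P.IsFirstOfHue D c H r) (h' : P.IsFirstOfHue D c H r') : r = r' :=
  Option.some_injective _
    ((find?_chainOrder_eq_some_iff.2 h).symm.trans (find?_chainOrder_eq_some_iff.2 h'))

theorem mem_permissionSet {t r x : Fin n} {B : Finset (Fin n)} :
    x ∈ P.permissionSet D t B r ↔ x ∉ D.under ∧ (D.hue x = {t} ∨ D.hue x = B) ∧ x ≠ r ∧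
      ¬ P.PrecedesInChain D (P.color t) x r := by
  simp [permissionSet]

theorem hasPermission_iff_forall_mem_permissionSet {t : Fin n} {B : Finset (Fin n)} :
    P.HasPermission D t B ↔ ∃ r, P.WantsToMerge D t B r ∧
      P.IsFirstOfHue D (P.color t) {t} r ∧ ∀ x ∈ P.permissionSet D t B r,
        ∀ y ∈ P.permissionSet D t B r, D.hue x = {t} → D.hue y = B →
          ¬ ListedBefore (P.permissionOrder D (P.color t)) x y := by
  simp only [HasPermission, find?_chainOrder_eq_some_iff, List.pairwise_iff_forall_sublist,
    permissionList_eq_filter, ← ListedBefore.eq_def, listedBefore_filter, decide_eq_true_eq]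
  refine exists_congr fun r => and_congr_right fun _ => and_congr_right fun _ => ?_
  exact ⟨fun h x hx y hy hxt hyB hxy => h ⟨hxy, hx, hy⟩ ⟨hxt, hyB⟩,
    fun h x y hxy hhue => h x hxy.2.1 y hxy.2.2 hhue.1 hhue.2 hxy.1⟩

theorem IsDecoration.hasPermission_unique (hD : P.IsDecoration D) {t : Fin n}
    {B B' : Finset (Fin n)} (h : P.HasPermission D t B) (h' : P.HasPermission D t B') :
    B = B' := by
  obtain ⟨r, hw, hfirst, _⟩ := hasPermission_iff_forall_mem_permissionSet.1 h
  obtain ⟨r', hw', hfirst', _⟩ := hasPermission_iff_forall_mem_permissionSet.1 h'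
  obtain rfl := hfirst.unique hfirst'
  exact hD.eq_of_mem hw.2.1 hw'.2.1 (Finset.mem_of_min hw.2.2.1) (Finset.mem_of_min hw'.2.2.1)

variable {E : Marking n} {t r x y : Fin n} {c : Fin m} {B H : Finset (Fin n)}

namespace IsDecoration

theorem notMem_under_of_hue_eq_singleton (hE : P.IsDecoration E) (hM : P.IsMismatched E)
    (hx : E.hue x = {t}) : x ∉ E.under := by
  rw [hE.mem_under_iff hM]
  rintro ⟨H, hH, hxH, j, hj, hjx⟩
  have hxhue := hE.hue_block H hH x hxH ⟨j, hj, hjx⟩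
  rw [← hxhue, hx, Finset.mem_singleton] at hxH hj
  exact hjx.ne (hj.trans hxH.symm)

theorem mem_permissionOrder_of_hue (hE : P.IsDecoration E) (hM : P.IsMismatched E) {b : Fin n}
    (hx : E.hue x = H) (hb : b ∈ H) (hux : x ∉ E.under) : x ∈ P.permissionOrder E (P.color b) := by
  rw [mem_permissionOrder, hE.mem_chainOrder_iff_of_hue hM hx hb]
  tauto

theorem hue_eq_of_mem (hE : P.IsDecoration E) (hB : B ∈ E.hues) (hr : r ∈ B) (hx : r ∈ E.hue x) :
    E.hue x = B :=
  hE.eq_of_mem (hE.hue_mem x fun h => Finset.ne_empty_of_mem hx (hE.hue_crossed x h)) hB hx hr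

end IsDecoration

namespace WantsToMerge

theorem singleton_mem_hues (hw : P.WantsToMerge E t B r) : {t} ∈ E.hues := hw.1

theorem mem_hues (hw : P.WantsToMerge E t B r) : B ∈ E.hues := hw.2.1

theorem min_eq (hw : P.WantsToMerge E t B r) : B.min = (r : WithTop (Fin n)) := hw.2.2.1

theorem color_min (hw : P.WantsToMerge E t B r) : P.color r = P.color t := hw.2.2.2.1

theorem lt (hw : P.WantsToMerge E t B r) : t < r := hw.2.2.2.2.1

theorem hue_min (hw : P.WantsToMerge E t B r) : E.hue r = {t} := hw.2.2.2.2.2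

theorem min_mem (hw : P.WantsToMerge E t B r) : r ∈ B := Finset.mem_of_min hw.min_eq

theorem min_le (hw : P.WantsToMerge E t B r) (hx : x ∈ B) : r ≤ x :=
  Finset.min_le_of_eq hx hw.min_eq

theorem min_lt (hw : P.WantsToMerge E t B r) (hx : x ∈ B) (hxr : x ≠ r) : r < x :=
  (hw.min_le hx).lt_of_ne hxr.symm

theorem notMem (hw : P.WantsToMerge E t B r) : t ∉ B := fun ht => (hw.min_le ht).not_gt hw.lt

theorem ne_singleton (hw : P.WantsToMerge E t B r) : B ≠ {t} :=
  fun h => hw.notMem (h ▸ Finset.mem_singleton_self t)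

theorem min_insert (hw : P.WantsToMerge E t B r) : (insert t B).min = (t : WithTop (Fin n)) := by
  rw [Finset.min_insert, hw.min_eq]
  exact min_eq_left (WithTop.coe_le_coe.2 hw.lt.le)

theorem color_eq (hw : P.WantsToMerge E t B r) (hE : P.IsDecoration E) (hx : x ∈ insert t B) :
    P.color x = P.color t := by
  rcases Finset.mem_insert.1 hx with rfl | hx
  · rfl
  · rw [← hw.color_min]
    exact hE.hues_monochromatic B hw.mem_hues x hx r hw.min_mem

theorem min_mem_chainOrder (hw : P.WantsToMerge E t B r) (hE : P.IsDecoration E)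
    (hM : P.IsMismatched E) : r ∈ P.chainOrder E (P.color t) := by
  rw [hE.mem_chainOrder_iff_of_hue hM hw.hue_min (Finset.mem_singleton_self t)]
  exact ⟨hw.color_min, hE.min_notMem_under hw.mem_hues hw.min_eq⟩

theorem min_hue_eq_iff (hw : P.WantsToMerge E t B r) (hE : P.IsDecoration E) :
    (E.hue x).min = r ↔ E.hue x = B :=
  ⟨fun h => hE.hue_eq_of_mem hw.mem_hues hw.min_mem (Finset.mem_of_min h), fun h => h ▸ hw.min_eq⟩

end WantsToMerge

namespace IsDecoration

theorem filter_hue_mem_under (hE : P.IsDecoration E) (hM : P.IsMismatched E) (hB : B ∈ E.hues)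
    (hr : B.min = (r : WithTop (Fin n))) :
    (Finset.univ.filter fun x => E.hue x = B ∧ x ∈ E.under) = B.erase r := by
  ext x
  rw [Finset.mem_filter, Finset.mem_erase, hE.mem_under_iff hM]
  constructor
  · rintro ⟨-, rfl, H, hH, hx, hj⟩
    obtain rfl := hE.hue_block H hH x hx hj
    refine ⟨?_, hx⟩
    rintro rfl
    exact hE.min_notMem_under hH hr ((hE.mem_under_iff_of_mem hH hx).2 hj)
  · rintro ⟨hxr, hx⟩
    have hj : ∃ j ∈ B, j < x :=
      ⟨r, Finset.mem_of_min hr, (Finset.min_le_of_eq hx hr).lt_of_ne hxr.symm⟩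
    exact ⟨Finset.mem_univ x, hE.hue_block B hB x hx hj, B, hB, hx, hj⟩

theorem card_hue_notMem_under (hE : P.IsDecoration E) (hM : P.IsMismatched E) (hB : B ∈ E.hues) :
    (Finset.univ.filter fun x => E.hue x = B ∧ x ∉ E.under).card + B.card = P.kSum B + 1 := by
  obtain ⟨r, hr⟩ := Finset.min_of_nonempty (hE.hues_nonempty B hB)
  have hcard := Finset.card_filter_add_card_filter_not
    (s := Finset.univ.filter fun x => E.hue x = B) (· ∈ E.under)
  rw [Finset.filter_filter, Finset.filter_filter, hE.filter_hue_mem_under hM hB hr,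
    hE.hue_card B hB] at hcard
  have := Finset.card_erase_add_one (Finset.mem_of_min hr)
  omega

theorem card_le_kSum (hE : P.IsDecoration E) (hHB : H ⊆ B) (hB : B ∈ E.hues) :
    H.card ≤ P.kSum H := by
  rw [kSum, Finset.card_eq_sum_ones]
  exact Finset.sum_le_sum fun x hx => mem_boxed.1 (hE.boxed_of_mem hB (hHB hx))

theorem exists_hue_notMem_under (hE : P.IsDecoration E) (hM : P.IsMismatched E)
    (hB : B ∈ E.hues) : ∃ x, E.hue x = B ∧ x ∉ E.under := by
  have hcard := hE.card_hue_notMem_under hM hB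
  have hle := hE.card_le_kSum subset_rfl hB
  obtain ⟨x, hx⟩ := Finset.card_pos.1
    (show 0 < (Finset.univ.filter fun x => E.hue x = B ∧ x ∉ E.under).card by omega)
  exact ⟨x, (Finset.mem_filter.1 hx).2⟩

end IsDecoration

/-- In the permission list, all numbers of hue `B` that are not underlined come before all numbers
of hue `{t}` other than `r`. This is the second condition for permission, without the exception for
the predecessor of `r` in its chain. -/
def BlockComesFirst (P : ColoredExponents n m) (E : Marking n) (t : Fin n) (B : Finset (Fin n))
    (r : Fin n) : Prop :=
  ∀ x y, E.hue x = {t} → x ≠ r → E.hue y = B → y ∉ E.under →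
    ListedBefore (P.permissionOrder E (P.color t)) y x

theorem IsFirstOfHue.listedBefore_permissionOrder (hE : P.IsDecoration E) (hM : P.IsMismatched E)
    (hr : P.IsFirstOfHue E (P.color t) {t} r) (hx : E.hue x = {t}) (hxr : x ≠ r) :
    ListedBefore (P.permissionOrder E (P.color t)) r x := by
  refine (listedBefore_or_listedBefore (mem_permissionOrder.2 (Or.inl hr.1))
    (hE.mem_permissionOrder_of_hue hM hx (Finset.mem_singleton_self t)
      (hE.notMem_under_of_hue_eq_singleton hM hx)) hxr.symm).resolve_right fun h => ?_
  rw [listedBefore_permissionOrder_iff_of_mem hr.1] at h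
  exact hr.2.2 x h hx

/-- If a number of hue `{t}` came before `r`, a number `y` of hue `B` would come before both. The
target of `y` is `r`, but the number following `y` is not. -/
theorem WantsToMerge.isFirstOfHue (hw : P.WantsToMerge E t B r) (hE : P.IsDecoration E)
    (hM : P.IsMismatched E) (h : P.BlockComesFirst E t B r) :
    P.IsFirstOfHue E (P.color t) {t} r := by
  refine ⟨hw.min_mem_chainOrder hE hM, hw.hue_min, fun x hxr hx => ?_⟩
  obtain ⟨y, hyB, hyu⟩ := hE.exists_hue_notMem_under hM hw.mem_hues
  have hyx := h x y hx (hxr.ne (P.nodup_chainOrder E _)) hyB hyu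
  rw [listedBefore_permissionOrder_iff_of_mem hxr.mem_left] at hyx
  exact (P.isWalk_chainOrder E _).target_ne_of_between hyx hxr ((hw.min_hue_eq_iff hE).2 hyB)

/-- The predecessor of `r` in its chain has hue `B` and comes before `r`, hence before all numbers
of hue `{t}`. -/
theorem WantsToMerge.blockComesFirst (hw : P.WantsToMerge E t B r) (hE : P.IsDecoration E)
    (hM : P.IsMismatched E) (hr : P.IsFirstOfHue E (P.color t) {t} r)
    (h : ∀ x ∈ P.permissionSet E t B r, ∀ y ∈ P.permissionSet E t B r, E.hue x = {t} →
      E.hue y = B → ¬ ListedBefore (P.permissionOrder E (P.color t)) x y) :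
    P.BlockComesFirst E t B r := by
  intro x y hxt hxr hyB hyu
  by_cases hyr : ListedBefore (P.chainOrder E (P.color t)) y r
  · exact ((listedBefore_permissionOrder_iff_of_mem hr.1).2 hyr).trans nodup_permissionOrder
      (hr.listedBefore_permissionOrder hE hM hxt hxr)
  · have hux := hE.notMem_under_of_hue_eq_singleton hM hxt
    have hyr' : y ≠ r := fun h => hw.ne_singleton (hyB.symm.trans (h ▸ hw.hue_min))
    have hyx : y ≠ x := fun h => hw.ne_singleton (hyB.symm.trans (h ▸ hxt))
    refine (listedBefore_or_listedBefore ?_ ?_ hyx).resolve_right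
      (h x (mem_permissionSet.2 ⟨hux, Or.inl hxt, hxr, fun hx => ?_⟩)
        y (mem_permissionSet.2 ⟨hyu, Or.inr hyB, hyr', fun hy => hyr hy.listedBefore⟩) hxt hyB)
    · rw [← hw.color_min]
      exact hE.mem_permissionOrder_of_hue hM hyB hw.min_mem hyu
    · exact hE.mem_permissionOrder_of_hue hM hxt (Finset.mem_singleton_self t) hux
    · exact hr.2.2 x hx.listedBefore hxt

theorem IsDecoration.hasPermission_iff (hE : P.IsDecoration E) (hM : P.IsMismatched E) :
    P.HasPermission E t B ↔ ∃ r, P.WantsToMerge E t B r ∧ P.BlockComesFirst E t B r := by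
  rw [hasPermission_iff_forall_mem_permissionSet]
  refine exists_congr fun r => and_congr_right fun hw => ⟨?_, fun h => ⟨?_, ?_⟩⟩
  · exact fun ⟨hr, h⟩ => hw.blockComesFirst hE hM hr h
  · exact hw.isFirstOfHue hE hM h
  · intro x hx y hy hxt hyB hxy
    exact hxy.asymm nodup_permissionOrder
      (h x y hxt (mem_permissionSet.1 hx).2.2.1 hyB (mem_permissionSet.1 hy).1)

/-! ### Merging -/

theorem hue_mergeWith : (mergeWith E t B).hue x =
    if E.hue x = {t} ∨ E.hue x = B then insert t B else E.hue x := rfl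

theorem hue_mergeWith_eq_iff_of_ne (ht : H ≠ {t}) (hB : H ≠ B) (hinsert : H ≠ insert t B) :
    (mergeWith E t B).hue x = H ↔ E.hue x = H := by
  rw [hue_mergeWith]
  split_ifs with h
  · refine ⟨fun h' => absurd h'.symm hinsert, ?_⟩
    rintro rfl
    tauto
  · rfl

theorem mem_hues_mergeWith :
    H ∈ (mergeWith E t B).hues ↔ H = insert t B ∨ (H ∈ E.hues ∧ H ≠ {t} ∧ H ≠ B) := by
  simp only [mergeWith, Finset.mem_insert, Finset.mem_erase]
  tauto

namespace WantsToMerge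

theorem mem_under_mergeWith (hw : P.WantsToMerge E t B r) :
    x ∈ (mergeWith E t B).under ↔ x ∈ E.under ∨ x = r := by
  simp only [mergeWith, Finset.mem_union, Finset.mem_filter, hw.min_eq, WithTop.coe_inj]
  refine or_congr_right ⟨fun h => h.2.symm, ?_⟩
  rintro rfl
  exact ⟨hw.min_mem, rfl⟩

theorem insert_notMem_hues (hw : P.WantsToMerge E t B r) (hE : P.IsDecoration E) :
    insert t B ∉ E.hues := by
  intro h
  refine hw.ne_singleton ?_
  rw [hE.eq_of_mem hw.mem_hues h hw.min_mem (Finset.mem_insert_of_mem hw.min_mem)]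
  exact hE.eq_of_mem h hw.singleton_mem_hues (Finset.mem_insert_self t B)
    (Finset.mem_singleton_self t)

theorem ne_insert (hw : P.WantsToMerge E t B r) (hE : P.IsDecoration E) (hH : H ∈ E.hues) :
    H ≠ insert t B := fun h => hw.insert_notMem_hues hE (h ▸ hH)

theorem hue_mergeWith_eq_insert_iff (hw : P.WantsToMerge E t B r) (hE : P.IsDecoration E) :
    (mergeWith E t B).hue x = insert t B ↔ E.hue x = {t} ∨ E.hue x = B := by
  rw [hue_mergeWith]
  split_ifs with h
  · simp [h]
  · have hx : E.hue x ≠ insert t B := fun hx =>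
      hw.notMem (h (Or.inl (hE.hue_eq_of_mem hw.singleton_mem_hues (Finset.mem_singleton_self t)
        (hx ▸ Finset.mem_insert_self t B)))).elim
    simp [h, hx]

theorem hueMatches_mergeWith (hw : P.WantsToMerge E t B r) (hE : P.IsDecoration E) :
    P.HueMatches (mergeWith E t B) x ↔ P.HueMatches E x := by
  by_cases h : E.hue x = {t} ∨ E.hue x = B
  · have hmatch : P.HueMatches E x ↔ P.color t = P.color x := by
      rcases h with h | h
      · rw [hE.hueMatches_iff (h ▸ hw.singleton_mem_hues) (h ▸ Finset.mem_singleton_self t)]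
      · rw [hE.hueMatches_iff (h ▸ hw.mem_hues) (h ▸ hw.min_mem), hw.color_min]
    rw [hmatch, HueMatches, hue_mergeWith, if_pos h]
    constructor
    · rintro ⟨b, hb, hcolor⟩
      rw [← hcolor, hw.color_eq hE hb]
    · exact fun hcolor => ⟨t, Finset.mem_insert_self t B, hcolor⟩
  · rw [HueMatches, HueMatches, hue_mergeWith, if_neg h]

theorem isMismatched_mergeWith (hw : P.WantsToMerge E t B r) (hE : P.IsDecoration E)
    (hM : P.IsMismatched E) : P.IsMismatched (mergeWith E t B) :=
  fun i hi h => hM i hi ((hw.hueMatches_mergeWith hE).1 h)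

theorem disjoint_insert (hw : P.WantsToMerge E t B r) (hE : P.IsDecoration E) (hH : H ∈ E.hues)
    (hHt : H ≠ {t}) (hHB : H ≠ B) : Disjoint (insert t B) H :=
  Finset.disjoint_insert_left.2
    ⟨fun ht => hHt (hE.eq_of_mem hH hw.singleton_mem_hues ht (Finset.mem_singleton_self t)),
      hE.hues_disjoint B hw.mem_hues H hH hHB.symm⟩

theorem hues_disjoint_mergeWith (hw : P.WantsToMerge E t B r) (hE : P.IsDecoration E) :
    ∀ H ∈ (mergeWith E t B).hues, ∀ H' ∈ (mergeWith E t B).hues, H ≠ H' → Disjoint H H' := by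
  intro H hH H' hH' hne
  rcases mem_hues_mergeWith.1 hH with rfl | h <;> rcases mem_hues_mergeWith.1 hH' with rfl | h'
  · exact absurd rfl hne
  · exact hw.disjoint_insert hE h'.1 h'.2.1 h'.2.2
  · exact (hw.disjoint_insert hE h.1 h.2.1 h.2.2).symm
  · exact hE.hues_disjoint H h.1 H' h'.1 hne

theorem hues_union_mergeWith (hw : P.WantsToMerge E t B r) (hE : P.IsDecoration E) :
    (mergeWith E t B).hues.biUnion id = P.boxed := by
  ext i
  rw [hE.mem_boxed_iff]
  simp only [Finset.mem_biUnion, mem_hues_mergeWith, id]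
  constructor
  · rintro ⟨H, rfl | hH, hi⟩
    · rcases Finset.mem_insert.1 hi with rfl | hi
      exacts [⟨{i}, hw.singleton_mem_hues, Finset.mem_singleton_self i⟩, ⟨B, hw.mem_hues, hi⟩]
    · exact ⟨H, hH.1, hi⟩
  · rintro ⟨H, hH, hi⟩
    by_cases hHt : H = {t}
    · exact ⟨insert t B, Or.inl rfl, Finset.mem_insert.2 (Or.inl (by simpa [hHt] using hi))⟩
    · by_cases hHB : H = B
      exacts [⟨insert t B, Or.inl rfl, Finset.mem_insert_of_mem (hHB ▸ hi)⟩,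
        ⟨H, Or.inr ⟨hH, hHt, hHB⟩, hi⟩]

theorem mem_insert_and_exists_lt_iff (hw : P.WantsToMerge E t B r) :
    (x ∈ insert t B ∧ ∃ j ∈ insert t B, j < x) ↔ x ∈ B := by
  constructor
  · rintro ⟨hx, j, hj, hjx⟩
    refine (Finset.mem_insert.1 hx).resolve_left ?_
    rintro rfl
    rcases Finset.mem_insert.1 hj with rfl | hj
    · exact hjx.false
    · exact (hw.lt.trans_le (hw.min_le hj)).asymm hjx
  · exact fun hx =>
      ⟨Finset.mem_insert_of_mem hx, t, Finset.mem_insert_self t B, hw.lt.trans_le (hw.min_le hx)⟩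

theorem hue_block_mergeWith (hw : P.WantsToMerge E t B r) (hE : P.IsDecoration E)
    (hH : H ∈ (mergeWith E t B).hues) (hx : x ∈ H) (hj : ∃ j ∈ H, j < x) :
    (mergeWith E t B).hue x = H := by
  rcases mem_hues_mergeWith.1 hH with rfl | h
  · have hxB := hw.mem_insert_and_exists_lt_iff.1 ⟨hx, hj⟩
    rw [hw.hue_mergeWith_eq_insert_iff hE]
    rcases eq_or_ne x r with rfl | hxr
    · exact Or.inl hw.hue_min
    · exact Or.inr (hE.hue_block B hw.mem_hues x hxB ⟨r, hw.min_mem, hw.min_lt hxB hxr⟩)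
  · rw [hue_mergeWith_eq_iff_of_ne h.2.1 h.2.2 (hw.ne_insert hE h.1)]
    exact hE.hue_block H h.1 x hx hj

theorem hue_card_mergeWith (hw : P.WantsToMerge E t B r) (hE : P.IsDecoration E)
    (hH : H ∈ (mergeWith E t B).hues) :
    (Finset.univ.filter fun i => (mergeWith E t B).hue i = H).card = P.kSum H := by
  rcases mem_hues_mergeWith.1 hH with rfl | h
  · simp only [hw.hue_mergeWith_eq_insert_iff hE]
    rw [Finset.filter_or, Finset.card_union_of_disjoint, hE.hue_card _ hw.singleton_mem_hues,
      hE.hue_card _ hw.mem_hues, kSum, kSum, kSum, Finset.sum_insert hw.notMem,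
      Finset.sum_singleton]
    exact Finset.disjoint_filter.2 fun x _ hxt hxB => hw.ne_singleton (hxB.symm.trans hxt)
  · simp only [hue_mergeWith_eq_iff_of_ne h.2.1 h.2.2 (hw.ne_insert hE h.1), hE.hue_card H h.1]

theorem mem_under_mergeWith_iff_exists (hw : P.WantsToMerge E t B r) (hE : P.IsDecoration E)
    (hM : P.IsMismatched E) : x ∈ (mergeWith E t B).under ↔
      ∃ H ∈ (mergeWith E t B).hues, x ∈ H ∧ ∃ j ∈ H, j < x := by
  rw [hw.mem_under_mergeWith, hE.mem_under_iff hM]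
  simp only [mem_hues_mergeWith, or_and_right, exists_or, exists_eq_left,
    hw.mem_insert_and_exists_lt_iff]
  constructor
  · rintro (⟨H, hH, hxH, j, hj, hjx⟩ | rfl)
    · have hHt : H ≠ {t} := by
        rintro rfl
        rw [Finset.mem_singleton] at hxH hj
        exact hjx.ne (hj.trans hxH.symm)
      rcases eq_or_ne H B with rfl | hHB
      · exact Or.inl hxH
      · exact Or.inr ⟨H, ⟨hH, hHt, hHB⟩, hxH, j, hj, hjx⟩
    · exact Or.inl hw.min_mem
  · rintro (hxB | ⟨H, hH, hxH, hj⟩)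
    · rcases eq_or_ne x r with rfl | hxr
      · exact Or.inr rfl
      · exact Or.inl ⟨B, hw.mem_hues, hxB, r, hw.min_mem, hw.min_lt hxB hxr⟩
    · exact Or.inl ⟨H, hH.1, hxH, hj⟩

theorem isDecoration_mergeWith (hw : P.WantsToMerge E t B r) (hE : P.IsDecoration E)
    (hM : P.IsMismatched E) : P.IsDecoration (mergeWith E t B) where
  hues_nonempty H hH := by
    rcases mem_hues_mergeWith.1 hH with rfl | h
    exacts [Finset.insert_nonempty t B, hE.hues_nonempty H h.1]
  hues_disjoint := hw.hues_disjoint_mergeWith hE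
  hues_union := hw.hues_union_mergeWith hE
  hues_monochromatic H hH i hi j hj := by
    rcases mem_hues_mergeWith.1 hH with rfl | h
    · rw [hw.color_eq hE hi, hw.color_eq hE hj]
    · exact hE.hues_monochromatic H h.1 i hi j hj
  hue_crossed i hi := by
    rw [hue_mergeWith, hE.hue_crossed i hi, if_neg]
    rintro (h | h)
    exacts [Finset.singleton_ne_empty t h.symm, Finset.ne_empty_of_mem hw.min_mem h.symm]
  hue_mem i hi := by
    rw [mem_hues_mergeWith, hue_mergeWith]
    split_ifs with h
    exacts [Or.inl rfl, Or.inr ⟨hE.hue_mem i hi, not_or.1 h⟩]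
  hue_block _ hH _ := hw.hue_block_mergeWith hE hH
  hue_card _ := hw.hue_card_mergeWith hE
  under_boxed _ _ := hw.mem_under_mergeWith_iff_exists hE hM
  under_unboxed i hi h := by
    rcases hw.mem_under_mergeWith.1 h with h | rfl
    exacts [absurd (hE.under_unboxed i hi h) (hM i hi),
      absurd (hE.boxed_of_mem hw.mem_hues hw.min_mem) hi]

/-! ### Number chains after merging -/

theorem mem_chainSet_mergeWith (hw : P.WantsToMerge E t B r) (hE : P.IsDecoration E)
    (hM : P.IsMismatched E) :
    x ∈ P.chainSet (mergeWith E t B) c ↔ x ∈ P.chainSet E c ∧ x ≠ r := by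
  rw [hE.mem_chainSet_iff hM, (hw.isDecoration_mergeWith hE hM).mem_chainSet_iff
    (hw.isMismatched_mergeWith hE hM), hw.mem_under_mergeWith, hw.hueMatches_mergeWith hE]
  tauto

theorem min_hue_mergeWith (hw : P.WantsToMerge E t B r) (hE : P.IsDecoration E) :
    ((mergeWith E t B).hue x).min = if (E.hue x).min = r then ↑t else (E.hue x).min := by
  rw [hue_mergeWith]
  by_cases hB : E.hue x = B
  · rw [if_pos (Or.inr hB), if_pos ((hw.min_hue_eq_iff hE).2 hB), hw.min_insert]
  · rw [if_neg (mt (hw.min_hue_eq_iff hE).1 hB)]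
    by_cases ht : E.hue x = {t}
    · rw [if_pos (Or.inl ht), hw.min_insert, ht, Finset.min_singleton]
    · rw [if_neg (not_or.2 ⟨ht, hB⟩)]

theorem isWalk_filter_chainOrder (hw : P.WantsToMerge E t B r) (hE : P.IsDecoration E)
    (hM : P.IsMismatched E) : IsWalk (fun x => ((mergeWith E t B).hue x).min) ⊤
      ((P.chainOrder E c).filter (· ≠ r)) := by
  by_cases hr : r ∈ P.chainOrder E c
  · simpa using (P.isWalk_chainOrder E c).filter_ne (by rw [hw.hue_min, Finset.min_singleton])
      hw.lt hr fun x _ _ => hw.min_hue_mergeWith hE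
  · rw [List.filter_eq_self.2 fun x hx => by simpa using ne_of_mem_of_not_mem hx hr]
    refine (P.isWalk_chainOrder E c).congr_target (Or.inl rfl) fun x hx => Or.inl ?_
    refine (hw.min_hue_mergeWith hE).trans (if_neg fun hxr => hr ?_)
    rw [hw.min_hue_eq_iff hE] at hxr
    have hx' := (hE.mem_chainSet_iff hM).1 (mem_chainOrder.1 hx)
    rw [hE.hueMatches_iff (hxr ▸ hw.mem_hues) (hxr ▸ hw.min_mem), hx'.1, hw.color_min] at hx'
    exact hx'.2.2 ▸ hw.min_mem_chainOrder hE hM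

/-- Redirecting the number that points at `r` to the target `t` of `r` removes `r` from the number
chains without affecting the order of the other numbers. -/
theorem chainOrder_mergeWith (hw : P.WantsToMerge E t B r) (hE : P.IsDecoration E)
    (hM : P.IsMismatched E) :
    P.chainOrder (mergeWith E t B) c = (P.chainOrder E c).filter (· ≠ r) := by
  refine (P.isWalk_chainOrder _ c).eq_of_mem_iff (hw.isWalk_filter_chainOrder hE hM) fun x => ?_
  rw [mem_chainOrder, hw.mem_chainSet_mergeWith hE hM, List.mem_filter, mem_chainOrder]
  simp

theorem mem_chainOrder_mergeWith (hw : P.WantsToMerge E t B r) (hE : P.IsDecoration E)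
    (hM : P.IsMismatched E) :
    x ∈ P.chainOrder (mergeWith E t B) c ↔ x ∈ P.chainOrder E c ∧ x ≠ r := by
  simp [hw.chainOrder_mergeWith hE hM]

theorem listedBefore_chainOrder_mergeWith (hw : P.WantsToMerge E t B r) (hE : P.IsDecoration E)
    (hM : P.IsMismatched E) : ListedBefore (P.chainOrder (mergeWith E t B) c) x y ↔
      ListedBefore (P.chainOrder E c) x y ∧ x ≠ r ∧ y ≠ r := by
  simp [hw.chainOrder_mergeWith hE hM, listedBefore_filter]

theorem listedBefore_permissionOrder_mergeWith (hw : P.WantsToMerge E t B r)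
    (hE : P.IsDecoration E) (hM : P.IsMismatched E) (hx : x ≠ r) (hy : y ≠ r) :
    ListedBefore (P.permissionOrder (mergeWith E t B) c) x y ↔
      ListedBefore (P.permissionOrder E c) x y := by
  simp [listedBefore_permissionOrder, hw.listedBefore_chainOrder_mergeWith hE hM,
    hw.mem_chainOrder_mergeWith hE hM, hx, hy]

end WantsToMerge

/-! ### Permission after merging -/

variable {t' r' : Fin n}

theorem IsDecoration.exists_hue_eq_singleton_ne (hE : P.IsDecoration E) (ht' : {t'} ∈ E.hues)
    (ht : {t} ∈ E.hues) (hcolor : P.color t' = P.color t) (hlt : t' < t) (hx : E.hue x = {t'})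
    (hy : E.hue y = {t'}) (hxy : x ≠ y) (r : Fin n) : ∃ z, E.hue z = {t} ∧ z ≠ r := by
  have hk' : 1 < (Finset.univ.filter fun z => E.hue z = {t'}).card :=
    Finset.one_lt_card.2 ⟨x, by simp [hx], y, by simp [hy], hxy⟩
  rw [hE.hue_card _ ht', kSum, Finset.sum_singleton] at hk'
  have hk := P.k_sorted t' t hlt hcolor
    (mem_boxed.1 (hE.boxed_of_mem ht (Finset.mem_singleton_self t)))
  obtain ⟨z, hz, hzr⟩ := Finset.exists_mem_ne (s := Finset.univ.filter fun z => E.hue z = {t})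
    (by rw [hE.hue_card _ ht, kSum, Finset.sum_singleton]; omega) r
  exact ⟨z, (Finset.mem_filter.1 hz).2, hzr⟩

namespace WantsToMerge

theorem ne_min_of_hue_ne (hw : P.WantsToMerge E t B r) (hx : E.hue x ≠ {t}) : x ≠ r :=
  fun h => hx (h ▸ hw.hue_min)

theorem singleton_ne_insert (hw : P.WantsToMerge E t B r) : {t'} ≠ insert t B := by
  intro h
  have ht : t = t' := Finset.mem_singleton.1 (h ▸ Finset.mem_insert_self t B)
  have hr : r = t' := Finset.mem_singleton.1 (h ▸ Finset.mem_insert_of_mem hw.min_mem)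
  exact hw.lt.ne (ht.trans hr.symm)

theorem wantsToMerge_mergeWith_iff (hw : P.WantsToMerge E t B r) (ht : {t'} ≠ ({t} : Finset _))
    (htB : {t'} ≠ B) (hHt : H ≠ {t}) (hHB : H ≠ B) (hH : H ≠ insert t B) :
    P.WantsToMerge (mergeWith E t B) t' H r' ↔ P.WantsToMerge E t' H r' := by
  rw [WantsToMerge, WantsToMerge, mem_hues_mergeWith, mem_hues_mergeWith,
    hue_mergeWith_eq_iff_of_ne ht htB hw.singleton_ne_insert]
  simp [hw.singleton_ne_insert, ht, htB, hHt, hHB, hH]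

theorem blockComesFirst_mergeWith_iff (hw : P.WantsToMerge E t B r) (hE : P.IsDecoration E)
    (hM : P.IsMismatched E) (ht : {t'} ≠ ({t} : Finset _)) (htB : {t'} ≠ B) (hHt : H ≠ {t})
    (hHB : H ≠ B) (hH : H ≠ insert t B) :
    P.BlockComesFirst (mergeWith E t B) t' H r' ↔ P.BlockComesFirst E t' H r' := by
  refine forall_congr' fun x => forall_congr' fun y => ?_
  rw [hue_mergeWith_eq_iff_of_ne ht htB hw.singleton_ne_insert,
    hue_mergeWith_eq_iff_of_ne hHt hHB hH, hw.mem_under_mergeWith]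
  refine imp_congr_right fun hx => imp_congr_right fun _ => imp_congr_right fun hy => ?_
  have hxr := hw.ne_min_of_hue_ne (hx ▸ ht)
  have hyr := hw.ne_min_of_hue_ne (hy ▸ hHt)
  rw [hw.listedBefore_permissionOrder_mergeWith hE hM hyr hxr]
  simp [hyr]

theorem hasPermission_mergeWith_iff (hw : P.WantsToMerge E t B r) (hE : P.IsDecoration E)
    (hM : P.IsMismatched E) (ht : {t'} ≠ ({t} : Finset _)) (htB : {t'} ≠ B) (hHt : H ≠ {t})
    (hHB : H ≠ B) (hH : H ≠ insert t B) :
    P.HasPermission (mergeWith E t B) t' H ↔ P.HasPermission E t' H := by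
  rw [hE.hasPermission_iff hM, (hw.isDecoration_mergeWith hE hM).hasPermission_iff
    (hw.isMismatched_mergeWith hE hM)]
  simp only [hw.wantsToMerge_mergeWith_iff ht htB hHt hHB hH,
    hw.blockComesFirst_mergeWith_iff hE hM ht htB hHt hHB hH]

/-- In front of the numbers of hue `{t'}` other than `t`, one has to find those of hue `{t}`. The
number `r` is the first one of these and there is another one, because the exponents increase. -/
theorem blockComesFirst_singleton (hw : P.WantsToMerge E t B r) (hE : P.IsDecoration E)
    (hM : P.IsMismatched E) (hB : P.BlockComesFirst E t B r)
    (hw' : P.WantsToMerge E t' {t} t)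
    (h : P.BlockComesFirst (mergeWith E t B) t' (insert t B) t) (htB : {t'} ≠ B) :
    P.BlockComesFirst E t' {t} t := by
  have ht : {t'} ≠ ({t} : Finset _) := hw'.ne_singleton.symm
  have hcolor := hw'.color_min
  intro x y hx hxt hy _
  have hxr := hw.ne_min_of_hue_ne (hx ▸ ht)
  have hbefore : ∀ z, E.hue z = {t} → z ≠ r →
      ListedBefore (P.permissionOrder E (P.color t')) z x := by
    intro z hz hzr
    rw [← hw.listedBefore_permissionOrder_mergeWith hE hM hzr hxr]
    refine h x z ((hue_mergeWith_eq_iff_of_ne ht htB hw.singleton_ne_insert).2 hx) hxt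
      ((hw.hue_mergeWith_eq_insert_iff hE).2 (Or.inl hz)) ?_
    rw [hw.mem_under_mergeWith]
    exact not_or.2 ⟨hE.notMem_under_of_hue_eq_singleton hM hz, hzr⟩
  rcases ne_or_eq y r with hyr | rfl
  · exact hbefore y hy hyr
  · obtain ⟨z, hz, hzr⟩ := hE.exists_hue_eq_singleton_ne hw'.singleton_mem_hues
      hw.singleton_mem_hues hcolor.symm hw'.lt hx hw'.hue_min hxt y
    have hyz := (hw.isFirstOfHue hE hM hB).listedBefore_permissionOrder hE hM hz hzr
    rw [hcolor] at hyz
    exact hyz.trans nodup_permissionOrder (hbefore z hz hzr)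

theorem exists_hasPermission_of_mergeWith (hw : P.WantsToMerge E t B r) (hE : P.IsDecoration E)
    (hM : P.IsMismatched E) (hB : P.BlockComesFirst E t B r) (ht : t' < t)
    (h : P.HasPermission (mergeWith E t B) t' H) : ∃ H', P.HasPermission E t' H' := by
  obtain ⟨r', hw', h'⟩ := ((hw.isDecoration_mergeWith hE hM).hasPermission_iff
    (hw.isMismatched_mergeWith hE hM)).1 h
  obtain ⟨ht'mem, ht't, ht'B⟩ := (mem_hues_mergeWith.1 hw'.singleton_mem_hues).resolve_left
    hw.singleton_ne_insert
  by_cases hH : H = insert t B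
  · subst hH
    obtain rfl : t = r' := WithTop.coe_inj.1 (hw.min_insert.symm.trans hw'.min_eq)
    have hhue : E.hue t = {t'} :=
      (hue_mergeWith_eq_iff_of_ne ht't ht'B hw.singleton_ne_insert).1 hw'.hue_min
    have hwt : P.WantsToMerge E t' {t} t :=
      ⟨ht'mem, hw.singleton_mem_hues, Finset.min_singleton, hw'.color_min, ht, hhue⟩
    exact ⟨{t}, (hE.hasPermission_iff hM).2
      ⟨t, hwt, hw.blockComesFirst_singleton hE hM hB hwt h' ht'B⟩⟩
  · obtain ⟨-, hHt, hHB⟩ := (mem_hues_mergeWith.1 hw'.mem_hues).resolve_left hH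
    exact ⟨H, (hw.hasPermission_mergeWith_iff hE hM ht't ht'B hHt hHB hH).1 h⟩

theorem blockComesFirst_insert (hw : P.WantsToMerge E t B r) (hE : P.IsDecoration E)
    (hM : P.IsMismatched E) (hB : P.BlockComesFirst E t B r)
    (hw' : P.WantsToMerge E t' {t} t) (h : P.BlockComesFirst E t' {t} t) (htB : {t'} ≠ B) :
    P.BlockComesFirst (mergeWith E t B) t' (insert t B) t := by
  have ht : {t'} ≠ ({t} : Finset _) := hw'.ne_singleton.symm
  have hcolor := hw'.color_min
  intro x y hx hxt hy hyu
  rw [hue_mergeWith_eq_iff_of_ne ht htB hw.singleton_ne_insert] at hx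
  rw [hw.mem_under_mergeWith, not_or] at hyu
  rw [hw.listedBefore_permissionOrder_mergeWith hE hM hyu.2 (hw.ne_min_of_hue_ne (hx ▸ ht))]
  rcases (hw.hue_mergeWith_eq_insert_iff hE).1 hy with hy | hy
  · exact h x y hx hxt hy hyu.1
  · obtain ⟨z, hz, hzr⟩ := hE.exists_hue_eq_singleton_ne hw'.singleton_mem_hues
      hw.singleton_mem_hues hcolor.symm hw'.lt hx hw'.hue_min hxt r
    have hyz := hB z y hz hzr hy hyu.1
    rw [hcolor] at hyz
    exact hyz.trans nodup_permissionOrder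
      (h x z hx hxt hz (hE.notMem_under_of_hue_eq_singleton hM hz))

theorem exists_hasPermission_mergeWith (hw : P.WantsToMerge E t B r) (hE : P.IsDecoration E)
    (hM : P.IsMismatched E) (hB : P.BlockComesFirst E t B r) (ht : t' < t)
    (h : P.HasPermission E t' H) : ∃ H', P.HasPermission (mergeWith E t B) t' H' := by
  obtain ⟨r', hw', h'⟩ := (hE.hasPermission_iff hM).1 h
  have ht't : {t'} ≠ ({t} : Finset _) := Finset.singleton_inj.not.2 ht.ne
  have ht'B : {t'} ≠ B := fun h =>
    (hw.min_le (h ▸ Finset.mem_singleton_self t')).not_gt (ht.trans hw.lt)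
  have hHB : H ≠ B := by
    rintro rfl
    obtain rfl : r = r' := WithTop.coe_inj.1 (hw.min_eq.symm.trans hw'.min_eq)
    exact ht't (hw'.hue_min.symm.trans hw.hue_min)
  by_cases hHt : H = {t}
  · subst hHt
    obtain rfl : t = r' := (Finset.mem_singleton.1 hw'.min_mem).symm
    refine ⟨insert t B, ((hw.isDecoration_mergeWith hE hM).hasPermission_iff
      (hw.isMismatched_mergeWith hE hM)).2
        ⟨t, ?_, hw.blockComesFirst_insert hE hM hB hw' h' ht'B⟩⟩
    exact ⟨mem_hues_mergeWith.2 (Or.inr ⟨hw'.singleton_mem_hues, ht't, ht'B⟩),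
      mem_hues_mergeWith.2 (Or.inl rfl), hw.min_insert, hw'.color_min, ht,
      (hue_mergeWith_eq_iff_of_ne ht't ht'B hw.singleton_ne_insert).2 hw'.hue_min⟩
  · exact ⟨H, (hw.hasPermission_mergeWith_iff hE hM ht't ht'B hHt hHB
      (hw.ne_insert hE hw'.mem_hues)).2 h⟩

end WantsToMerge

end ColoredExponents

attribute [ext] Marking

theorem eq_cons_filter_of_forall_not_listedBefore {β : Type*} [DecidableEq β] {L : List β} {q : β}
    (hL : L.Nodup) (hq : q ∈ L) (h : ∀ x, ¬ ListedBefore L x q) : L = q :: L.filter (· ≠ q) := by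
  cases L with
  | nil => simp at hq
  | cons z L =>
    obtain rfl : z = q := by
      by_contra hzq
      exact h z (listedBefore_cons.2
        (Or.inl ⟨rfl, (List.mem_cons.1 hq).resolve_left (Ne.symm hzq)⟩))
    rw [List.filter_cons_of_neg (by simp), List.filter_eq_self.2]
    exact fun x hx => by simpa using ne_of_mem_of_not_mem hx (List.nodup_cons.1 hL).1

namespace ColoredExponents

variable {n m : ℕ} {P : ColoredExponents n m} {D E : Marking n} {a q r t x y : Fin n}
  {B H : Finset (Fin n)}

/-! ### Splitting -/

theorem mem_hues_splitInto : H ∈ (P.splitInto D a B (B.erase a)).hues ↔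
    H = {a} ∨ H = B.erase a ∨ H ≠ B ∧ H ∈ D.hues := by
  simp [splitInto]

theorem isFirstOfHue_of_splitQ (hq : P.splitQ D (P.color a) B (B.erase a) = some q) :
    P.IsFirstOfHue D (P.color a) B q := by
  unfold splitQ at hq
  split_ifs at hq
  exact find?_chainOrder_eq_some_iff.1 hq

/-- The data for splitting in a mismatched decoration: a hue `B` with minimum `a` that has further
elements, the smallest of which is `r`. -/
structure SplitData (P : ColoredExponents n m) (D : Marking n) (a : Fin n) (B : Finset (Fin n))
    (r : Fin n) : Prop where
  isDecoration : P.IsDecoration D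
  isMismatched : P.IsMismatched D
  mem_hues : B ∈ D.hues
  min_eq : B.min = (a : WithTop (Fin n))
  min_erase : (B.erase a).min = (r : WithTop (Fin n))

/-- The numbers of hue `B` that are not underlined, in the order of the permission list for the
color `c`. -/
def hueList (P : ColoredExponents n m) (D : Marking n) (c : Fin m) (B : Finset (Fin n)) :
    List (Fin n) :=
  (P.permissionOrder D c).filter fun x => D.hue x = B ∧ x ∉ D.under

/-- The numbers that are not underlined and get hue `B \ {a}` when `B` is split into `{a}` and
`B \ {a}`. The number `q` of the splitting procedure need not be singled out: it is the first
element of this list if it exists. -/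
def splitTaken (P : ColoredExponents n m) (D : Marking n) (a : Fin n) (B : Finset (Fin n)) :
    List (Fin n) :=
  (P.hueList D (P.color a) B).take (P.kSum (B.erase a) + 1 - (B.erase a).card)

theorem singleton_ne_erase_self : {a} ≠ B.erase a :=
  fun h => Finset.notMem_erase a B (h ▸ Finset.mem_singleton_self a)

theorem nodup_hueList {c : Fin m} : (P.hueList D c B).Nodup := nodup_permissionOrder.filter _

theorem IsDecoration.mem_hueList (hD : P.IsDecoration D) (hM : P.IsMismatched D) (ha : a ∈ B) :
    x ∈ P.hueList D (P.color a) B ↔ D.hue x = B ∧ x ∉ D.under := by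
  rw [hueList, List.mem_filter, decide_eq_true_eq, and_iff_right_iff_imp]
  exact fun h => hD.mem_permissionOrder_of_hue hM h.1 ha h.2

theorem IsDecoration.length_hueList (hD : P.IsDecoration D) (hM : P.IsMismatched D)
    (hB : B ∈ D.hues) (ha : a ∈ B) :
    (P.hueList D (P.color a) B).length + B.card = P.kSum B + 1 := by
  rw [← hD.card_hue_notMem_under hM hB, ← List.toFinset_card_of_nodup nodup_hueList]
  congr 2
  ext x
  simp [hD.mem_hueList hM ha]

namespace SplitData

theorem mem (h : P.SplitData D a B r) : a ∈ B := Finset.mem_of_min h.min_eq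

theorem min_mem (h : P.SplitData D a B r) : r ∈ B.erase a := Finset.mem_of_min h.min_erase

theorem le (h : P.SplitData D a B r) (hx : x ∈ B) : a ≤ x := Finset.min_le_of_eq hx h.min_eq

theorem lt_of_mem_erase (h : P.SplitData D a B r) (hx : x ∈ B.erase a) : a < x :=
  (h.le (Finset.mem_of_mem_erase hx)).lt_of_ne (Finset.ne_of_mem_erase hx).symm

theorem min_le (h : P.SplitData D a B r) (hx : x ∈ B.erase a) : r ≤ x :=
  Finset.min_le_of_eq hx h.min_erase

theorem ne_singleton (h : P.SplitData D a B r) : B ≠ {a} := by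
  rintro rfl
  simpa using h.min_mem

theorem ne_erase (h : P.SplitData D a B r) : B ≠ B.erase a := (Finset.erase_ne_self.2 h.mem).symm

theorem singleton_notMem_hues (h : P.SplitData D a B r) : {a} ∉ D.hues := fun ha =>
  h.ne_singleton (h.isDecoration.eq_of_mem h.mem_hues ha h.mem (Finset.mem_singleton_self a))

theorem erase_notMem_hues (h : P.SplitData D a B r) : B.erase a ∉ D.hues := fun he => h.ne_erase
  (h.isDecoration.eq_of_mem h.mem_hues he (Finset.mem_of_mem_erase h.min_mem) h.min_mem)

theorem hue_ne_singleton (h : P.SplitData D a B r) (x : Fin n) : D.hue x ≠ {a} := by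
  intro hx
  exact h.ne_singleton ((h.isDecoration.hue_eq_of_mem h.mem_hues h.mem
    (hx ▸ Finset.mem_singleton_self a)).symm.trans hx)

theorem hue_ne_erase (h : P.SplitData D a B r) (x : Fin n) : D.hue x ≠ B.erase a := by
  intro hx
  exact h.ne_erase ((h.isDecoration.hue_eq_of_mem h.mem_hues (Finset.mem_of_mem_erase h.min_mem)
    (hx ▸ h.min_mem)).symm.trans hx)

theorem mem_erase_iff (h : P.SplitData D a B r) :
    x ∈ B.erase a ↔ D.hue x = B ∧ x ∈ D.under := by
  rw [← h.isDecoration.filter_hue_mem_under h.isMismatched h.mem_hues h.min_eq]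
  simp

theorem mem_hueList (h : P.SplitData D a B r) :
    x ∈ P.hueList D (P.color a) B ↔ D.hue x = B ∧ x ∉ D.under :=
  h.isDecoration.mem_hueList h.isMismatched h.mem

theorem hue_and_notMem_under (h : P.SplitData D a B r) (hx : x ∈ P.splitTaken D a B) :
    D.hue x = B ∧ x ∉ D.under :=
  h.mem_hueList.1 (List.mem_of_mem_take hx)

theorem card_erase_le_kSum (h : P.SplitData D a B r) : (B.erase a).card ≤ P.kSum (B.erase a) :=
  h.isDecoration.card_le_kSum (Finset.erase_subset a B) h.mem_hues

theorem notMem_under_of_splitQ (h : P.SplitData D a B r)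
    (hq : P.splitQ D (P.color a) B (B.erase a) = some q) : q ∉ D.under :=
  ((h.isDecoration.mem_chainOrder_iff_of_hue h.isMismatched (isFirstOfHue_of_splitQ hq).2.1
    h.mem).1 (isFirstOfHue_of_splitQ hq).1).2

theorem splitQ_ne_of_mem_erase (h : P.SplitData D a B r) (hx : x ∈ B.erase a) :
    P.splitQ D (P.color a) B (B.erase a) ≠ some x :=
  fun hq => h.notMem_under_of_splitQ hq (h.mem_erase_iff.1 hx).2

theorem splitHueAux_eq_iff (h : P.SplitData D a B r) : P.splitHueAux D a B (B.erase a) x = B ↔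
    (D.hue x = B ∧ x ∉ D.under) ∧ P.splitQ D (P.color a) B (B.erase a) ≠ some x := by
  unfold splitHueAux
  have hmem := h.mem_erase_iff (x := x)
  split_ifs with hr hx hq
  · have := Finset.mem_of_min hr
    simp [h.ne_singleton.symm, hmem.1 this]
  · simp [h.ne_erase.symm, hmem.1 hx]
  · simp [h.ne_erase.symm, hq]
  · tauto

theorem splitHueAux_eq_erase_iff (h : P.SplitData D a B r) :
    P.splitHueAux D a B (B.erase a) x = B.erase a ↔
      x ∈ (B.erase a).erase r ∨ P.splitQ D (P.color a) B (B.erase a) = some x := by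
  unfold splitHueAux
  simp only [h.min_erase, WithTop.coe_inj, Finset.mem_erase (a := x) (b := r)]
  split_ifs with hr hx hq
  · subst hr
    simp [singleton_ne_erase_self, h.splitQ_ne_of_mem_erase h.min_mem]
  · simp [hx, Ne.symm hr]
  · simp [hq]
  · simp [h.hue_ne_erase, hx, hq]

theorem card_splitHueAux_eq_erase (h : P.SplitData D a B r) :
    (Finset.univ.filter fun x => P.splitHueAux D a B (B.erase a) x = B.erase a).card + 1 =
      (B.erase a).card + (P.splitQ D (P.color a) B (B.erase a)).toFinset.card := by
  have hfilter : (Finset.univ.filter fun x => P.splitHueAux D a B (B.erase a) x = B.erase a) =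
      (B.erase a).erase r ∪ (P.splitQ D (P.color a) B (B.erase a)).toFinset := by
    ext x
    simp [h.splitHueAux_eq_erase_iff]
  rw [hfilter, Finset.card_union_of_disjoint, ← Finset.card_erase_add_one h.min_mem]
  · omega
  · refine Finset.disjoint_left.2 fun x hx hq => h.splitQ_ne_of_mem_erase
      (Finset.mem_of_mem_erase hx) ?_
    simpa using hq

theorem permissionList_splitHueAux_eq_filter (h : P.SplitData D a B r) :
    P.permissionList D (P.color a)
        (Finset.univ.filter fun x => P.splitHueAux D a B (B.erase a) x = B) =
      (P.hueList D (P.color a) B).filter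
        fun x => P.splitQ D (P.color a) B (B.erase a) ≠ some x := by
  rw [permissionList_eq_filter, hueList, List.filter_filter]
  refine List.filter_congr fun x _ => ?_
  simp only [Finset.mem_filter, Finset.mem_univ, true_and, h.splitHueAux_eq_iff,
    ← Bool.decide_and, and_comm]

/-- If `q` exists, it is the first number of hue `B` in the permission list, and at least one number
that is not underlined gets hue `B \ {a}`. -/
theorem mem_splitTaken_iff (h : P.SplitData D a B r) : x ∈ P.splitTaken D a B ↔
    P.splitQ D (P.color a) B (B.erase a) = some x ∨ x ∈ P.splitInitial D a B (B.erase a) := by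
  have hcard := h.card_splitHueAux_eq_erase
  have hle := h.card_erase_le_kSum
  rw [splitInitial, h.permissionList_splitHueAux_eq_filter, splitTaken]
  cases hq : P.splitQ D (P.color a) B (B.erase a) with
  | none =>
    rw [hq, Option.toFinset_none, Finset.card_empty] at hcard
    rw [List.filter_eq_self.2 (by simp)]
    simp only [reduceCtorEq, false_or]
    congr! 2
    omega
  | some q =>
    rw [hq, Option.toFinset_some, Finset.card_singleton] at hcard
    have hfirst := isFirstOfHue_of_splitQ hq
    have hL : P.hueList D (P.color a) B =
        q :: (P.hueList D (P.color a) B).filter (· ≠ q) := by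
      refine eq_cons_filter_of_forall_not_listedBefore nodup_hueList
        (h.mem_hueList.2 ⟨hfirst.2.1, h.notMem_under_of_splitQ hq⟩) fun x hx => ?_
      rw [hueList, listedBefore_filter, listedBefore_permissionOrder_iff_of_mem hfirst.1,
        decide_eq_true_eq] at hx
      exact hfirst.2.2 x hx.1 hx.2.1.1
    rw [hL, show P.kSum (B.erase a) + 1 - (B.erase a).card =
      P.kSum (B.erase a) - (B.erase a).card + 1 by omega, List.take_succ_cons, List.mem_cons,
      show (B.erase a).card = (Finset.univ.filter fun x =>
        P.splitHueAux D a B (B.erase a) x = B.erase a).card by omega]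
    simp [eq_comm, List.filter_filter]

theorem hue_splitInto (h : P.SplitData D a B r) :
    (P.splitInto D a B (B.erase a)).hue x =
      if x = r then {a}
      else if x ∈ B.erase a ∨ x ∈ P.splitTaken D a B then B.erase a
      else if D.hue x = B then {a}
      else D.hue x := by
  have haux : ∀ {K}, P.splitHueAux D a B (B.erase a) x = K → K ≠ B →
      (P.splitInto D a B (B.erase a)).hue x = K := by
    rintro K rfl hK
    exact if_neg hK
  by_cases hxr : x = r
  · rw [if_pos hxr]
    exact haux (if_pos (hxr ▸ h.min_erase)) h.ne_singleton.symm
  by_cases hx : x ∈ B.erase a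
  · rw [if_neg hxr, if_pos (Or.inl hx)]
    exact haux (h.splitHueAux_eq_erase_iff.2 (Or.inl (Finset.mem_erase.2 ⟨hxr, hx⟩)))
      h.ne_erase.symm
  by_cases hq : P.splitQ D (P.color a) B (B.erase a) = some x
  · rw [if_neg hxr, if_pos (Or.inr (h.mem_splitTaken_iff.2 (Or.inl hq)))]
    exact haux (h.splitHueAux_eq_erase_iff.2 (Or.inr hq)) h.ne_erase.symm
  have hunchanged : P.splitHueAux D a B (B.erase a) x = D.hue x := by
    have hmin : (B.erase a).min ≠ x := fun hmin => hx (Finset.mem_of_min hmin)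
    simp only [splitHueAux, hmin, hx, hq, if_false]
  by_cases hxB : D.hue x = B
  · simp [splitInto, hunchanged, hxB, hxr, hx, h.mem_splitTaken_iff, hq]
  · have htaken : x ∉ P.splitTaken D a B := fun ht => hxB (h.hue_and_notMem_under ht).1
    rw [haux hunchanged hxB]
    simp [hxr, hx, htaken, hxB]

theorem hue_eq_of_mem_or_mem (h : P.SplitData D a B r)
    (hx : x ∈ B.erase a ∨ x ∈ P.splitTaken D a B) : D.hue x = B :=
  hx.elim (fun hx => (h.mem_erase_iff.1 hx).1) fun hx => (h.hue_and_notMem_under hx).1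

theorem notMem_splitTaken (h : P.SplitData D a B r) (hx : x ∈ B.erase a) :
    x ∉ P.splitTaken D a B :=
  fun ht => (h.hue_and_notMem_under ht).2 (h.mem_erase_iff.1 hx).2

theorem hue_splitInto_eq_erase_iff (h : P.SplitData D a B r) :
    (P.splitInto D a B (B.erase a)).hue x = B.erase a ↔
      x ∈ (B.erase a).erase r ∨ x ∈ P.splitTaken D a B := by
  rw [h.hue_splitInto, Finset.mem_erase (a := x) (b := r)]
  by_cases hxr : x = r
  · subst hxr
    simp [singleton_ne_erase_self, h.notMem_splitTaken h.min_mem]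
  · split_ifs with hx hB
    · simpa [hxr] using hx
    · simp [singleton_ne_erase_self, hxr, not_or.1 hx]
    · simp [h.hue_ne_erase, hxr, not_or.1 hx]

theorem hue_splitInto_eq_iff (h : P.SplitData D a B r) (ha : H ≠ {a}) (herase : H ≠ B.erase a)
    (hB : H ≠ B) : (P.splitInto D a B (B.erase a)).hue x = H ↔ D.hue x = H := by
  have hne : ∀ {K : Finset (Fin n)}, K ≠ H → D.hue x = B → (K = H ↔ D.hue x = H) :=
    fun hK hxB => iff_of_false hK fun hxH => hB (hxH.symm.trans hxB)
  rw [h.hue_splitInto]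
  split_ifs with hxr hx hxB
  · exact hne ha.symm (hxr ▸ (h.mem_erase_iff.1 h.min_mem).1)
  · exact hne herase.symm (h.hue_eq_of_mem_or_mem hx)
  · exact hne ha.symm hxB
  · rfl

theorem hue_splitInto_eq_or_eq_iff (h : P.SplitData D a B r) :
    ((P.splitInto D a B (B.erase a)).hue x = {a} ∨
      (P.splitInto D a B (B.erase a)).hue x = B.erase a) ↔ D.hue x = B := by
  rw [h.hue_splitInto]
  split_ifs with hxr hx hxB
  · simp [hxr, (h.mem_erase_iff.1 h.min_mem).1]
  · simp [h.hue_eq_of_mem_or_mem hx]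
  · simp [hxB]
  · simp [hxB, h.hue_ne_singleton, h.hue_ne_erase]

theorem mem_under_splitInto (h : P.SplitData D a B r) :
    x ∈ (P.splitInto D a B (B.erase a)).under ↔ x ∈ D.under ∧ x ≠ r := by
  simp [splitInto, h.min_erase, eq_comm]

theorem length_splitTaken (h : P.SplitData D a B r) :
    (P.splitTaken D a B).length + (B.erase a).card = P.kSum (B.erase a) + 1 := by
  have hlength := h.isDecoration.length_hueList h.isMismatched h.mem_hues h.mem
  have hcard := Finset.card_erase_add_one h.mem
  have hsum : P.kSum (B.erase a) + P.k a = P.kSum B := Finset.sum_erase_add _ _ h.mem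
  have hle := h.card_erase_le_kSum
  have ha := mem_boxed.1 (h.isDecoration.boxed_of_mem h.mem_hues h.mem)
  rw [splitTaken, List.length_take]
  omega

theorem card_hue_splitInto_eq_erase (h : P.SplitData D a B r) :
    (Finset.univ.filter fun x => (P.splitInto D a B (B.erase a)).hue x = B.erase a).card =
      P.kSum (B.erase a) := by
  have hfilter : (Finset.univ.filter fun x =>
      (P.splitInto D a B (B.erase a)).hue x = B.erase a) =
      (B.erase a).erase r ∪ (P.splitTaken D a B).toFinset := by
    ext x
    simp [h.hue_splitInto_eq_erase_iff]
  have hlength := h.length_splitTaken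
  have hcard := Finset.card_erase_add_one h.min_mem
  rw [hfilter, Finset.card_union_of_disjoint, List.toFinset_card_of_nodup]
  · omega
  · exact nodup_hueList.sublist (List.take_sublist _ _)
  · exact Finset.disjoint_left.2 fun x hx ht =>
      h.notMem_splitTaken (Finset.mem_of_mem_erase hx) (List.mem_toFinset.1 ht)

theorem hue_card_splitInto (h : P.SplitData D a B r)
    (hH : H ∈ (P.splitInto D a B (B.erase a)).hues) :
    (Finset.univ.filter fun x => (P.splitInto D a B (B.erase a)).hue x = H).card = P.kSum H := by
  by_cases herase : H = B.erase a
  · rw [herase, h.card_hue_splitInto_eq_erase]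
  rcases mem_hues_splitInto.1 hH with rfl | hH | ⟨hHB, hH⟩
  · have hcard := h.isDecoration.hue_card B h.mem_hues
    simp only [← h.hue_splitInto_eq_or_eq_iff] at hcard
    rw [Finset.filter_or, Finset.card_union_of_disjoint, h.card_hue_splitInto_eq_erase] at hcard
    · have hsum : P.kSum (B.erase a) + P.k a = P.kSum B := Finset.sum_erase_add _ _ h.mem
      rw [kSum, Finset.sum_singleton]
      omega
    · exact Finset.disjoint_filter.2 fun x _ hx hx' => herase (hx.symm.trans hx')
  · exact absurd hH herase
  · have ha := ne_of_mem_of_not_mem hH h.singleton_notMem_hues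
    simp only [h.hue_splitInto_eq_iff ha herase hHB, h.isDecoration.hue_card H hH]

theorem hue_splitInto_subset (h : P.SplitData D a B r) :
    (P.splitInto D a B (B.erase a)).hue x ⊆ D.hue x := by
  by_cases hx : D.hue x = B
  · rcases h.hue_splitInto_eq_or_eq_iff.2 hx with h' | h' <;> rw [h', hx]
    exacts [Finset.singleton_subset_iff.2 h.mem, Finset.erase_subset a B]
  · have hxr : x ≠ r := fun hxr => hx (hxr ▸ (h.mem_erase_iff.1 h.min_mem).1)
    rw [h.hue_splitInto, if_neg hxr, if_neg (mt h.hue_eq_of_mem_or_mem hx), if_neg hx]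

theorem isMismatched_splitInto (h : P.SplitData D a B r) :
    P.IsMismatched (P.splitInto D a B (B.erase a)) := by
  rintro i hi ⟨b, hb, hcolor⟩
  exact h.isMismatched i hi ⟨b, h.hue_splitInto_subset hb, hcolor⟩

theorem hues_disjoint_splitInto (h : P.SplitData D a B r) :
    ∀ H ∈ (P.splitInto D a B (B.erase a)).hues, ∀ H' ∈ (P.splitInto D a B (B.erase a)).hues,
      H ≠ H' → Disjoint H H' := by
  have hdisj : ∀ {H}, H ≠ B ∧ H ∈ D.hues → Disjoint B H :=
    fun hH => h.isDecoration.hues_disjoint B h.mem_hues _ hH.2 hH.1.symm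
  have hsingle : ∀ {H}, H ≠ B ∧ H ∈ D.hues → Disjoint {a} H :=
    fun hH => (hdisj hH).mono_left (Finset.singleton_subset_iff.2 h.mem)
  have herase : ∀ {H}, H ≠ B ∧ H ∈ D.hues → Disjoint (B.erase a) H :=
    fun hH => (hdisj hH).mono_left (Finset.erase_subset a B)
  have hpieces : Disjoint {a} (B.erase a) :=
    Finset.disjoint_singleton_left.2 (Finset.notMem_erase a B)
  intro H hH H' hH' hne
  rcases mem_hues_splitInto.1 hH with rfl | rfl | hH <;>
    rcases mem_hues_splitInto.1 hH' with rfl | rfl | hH'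
  exacts [absurd rfl hne, hpieces, hsingle hH', hpieces.symm, absurd rfl hne, herase hH',
    (hsingle hH).symm, (herase hH).symm, h.isDecoration.hues_disjoint H hH.2 H' hH'.2 hne]

theorem hues_union_splitInto (h : P.SplitData D a B r) :
    (P.splitInto D a B (B.erase a)).hues.biUnion id = P.boxed := by
  ext i
  rw [h.isDecoration.mem_boxed_iff]
  simp only [Finset.mem_biUnion, mem_hues_splitInto, id]
  constructor
  · rintro ⟨H, rfl | rfl | hH, hi⟩
    exacts [⟨B, h.mem_hues, Finset.mem_singleton.1 hi ▸ h.mem⟩,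
      ⟨B, h.mem_hues, Finset.mem_of_mem_erase hi⟩, ⟨H, hH.2, hi⟩]
  · rintro ⟨H, hH, hi⟩
    rcases ne_or_eq H B with hHB | rfl
    · exact ⟨H, Or.inr (Or.inr ⟨hHB, hH⟩), hi⟩
    · rcases eq_or_ne i a with rfl | hia
      exacts [⟨{i}, Or.inl rfl, Finset.mem_singleton_self i⟩,
        ⟨H.erase a, Or.inr (Or.inl rfl), Finset.mem_erase.2 ⟨hia, hi⟩⟩]

theorem subset_of_mem_hues_splitInto (h : P.SplitData D a B r)
    (hH : H ∈ (P.splitInto D a B (B.erase a)).hues) : ∃ K ∈ D.hues, H ⊆ K := by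
  rcases mem_hues_splitInto.1 hH with rfl | rfl | hH
  exacts [⟨B, h.mem_hues, Finset.singleton_subset_iff.2 h.mem⟩,
    ⟨B, h.mem_hues, Finset.erase_subset a B⟩, ⟨H, hH.2, subset_rfl⟩]

theorem mem_erase_and_exists_lt_iff (h : P.SplitData D a B r) :
    (x ∈ B.erase a ∧ ∃ j ∈ B.erase a, j < x) ↔ x ∈ (B.erase a).erase r := by
  rw [Finset.mem_erase (a := x) (b := r), and_comm]
  refine and_congr_left fun hx => ⟨?_, fun hxr => ⟨r, h.min_mem, (h.min_le hx).lt_of_ne hxr.symm⟩⟩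
  rintro ⟨j, hj, hjx⟩ rfl
  exact (h.min_le hj).not_gt hjx

theorem hue_block_splitInto (h : P.SplitData D a B r)
    (hH : H ∈ (P.splitInto D a B (B.erase a)).hues) (hx : x ∈ H) (hj : ∃ j ∈ H, j < x) :
    (P.splitInto D a B (B.erase a)).hue x = H := by
  rcases mem_hues_splitInto.1 hH with rfl | rfl | ⟨hHB, hH'⟩
  · obtain ⟨j, hj, hjx⟩ := hj
    exact absurd ((Finset.mem_singleton.1 hj).trans (Finset.mem_singleton.1 hx).symm) hjx.ne
  · exact h.hue_splitInto_eq_erase_iff.2 (Or.inl (h.mem_erase_and_exists_lt_iff.1 ⟨hx, hj⟩))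
  · have hhue := h.isDecoration.hue_block H hH' x hx hj
    rwa [h.hue_splitInto_eq_iff (hhue ▸ h.hue_ne_singleton x) (hhue ▸ h.hue_ne_erase x) hHB]

theorem mem_under_splitInto_iff_exists (h : P.SplitData D a B r) :
    x ∈ (P.splitInto D a B (B.erase a)).under ↔
      ∃ H ∈ (P.splitInto D a B (B.erase a)).hues, x ∈ H ∧ ∃ j ∈ H, j < x := by
  rw [h.mem_under_splitInto, h.isDecoration.mem_under_iff h.isMismatched]
  constructor
  · rintro ⟨⟨H, hH, hxH, hj⟩, hxr⟩
    rcases ne_or_eq H B with hHB | rfl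
    · exact ⟨H, mem_hues_splitInto.2 (Or.inr (Or.inr ⟨hHB, hH⟩)), hxH, hj⟩
    · refine ⟨H.erase a, mem_hues_splitInto.2 (Or.inr (Or.inl rfl)),
        h.mem_erase_and_exists_lt_iff.2 (Finset.mem_erase.2 ⟨hxr, Finset.mem_erase.2 ⟨?_, hxH⟩⟩)⟩
      rintro rfl
      obtain ⟨j, hj, hjx⟩ := hj
      exact (h.le hj).not_gt hjx
  · rintro ⟨H, hH, hxH, j, hj, hjx⟩
    obtain ⟨K, hK, hHK⟩ := h.subset_of_mem_hues_splitInto hH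
    refine ⟨⟨K, hK, hHK hxH, j, hHK hj, hjx⟩, ?_⟩
    rintro rfl
    have hhue := h.hue_block_splitInto hH hxH ⟨j, hj, hjx⟩
    rw [h.hue_splitInto, if_pos rfl] at hhue
    rw [← hhue, Finset.mem_singleton] at hxH hj
    exact hjx.ne (hj.trans hxH.symm)

theorem isDecoration_splitInto (h : P.SplitData D a B r) :
    P.IsDecoration (P.splitInto D a B (B.erase a)) where
  hues_nonempty H hH := by
    rcases mem_hues_splitInto.1 hH with rfl | rfl | hH
    exacts [Finset.singleton_nonempty a, ⟨r, h.min_mem⟩, h.isDecoration.hues_nonempty H hH.2]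
  hues_disjoint := h.hues_disjoint_splitInto
  hues_union := h.hues_union_splitInto
  hues_monochromatic H hH i hi j hj := by
    obtain ⟨K, hK, hHK⟩ := h.subset_of_mem_hues_splitInto hH
    exact h.isDecoration.hues_monochromatic K hK i (hHK hi) j (hHK hj)
  hue_crossed i hi := by
    rw [← Finset.subset_empty, ← h.isDecoration.hue_crossed i hi]
    exact h.hue_splitInto_subset
  hue_mem i hi := by
    rw [mem_hues_splitInto, h.hue_splitInto]
    split_ifs with _ _ hB
    exacts [Or.inl rfl, Or.inr (Or.inl rfl), Or.inl rfl,
      Or.inr (Or.inr ⟨hB, h.isDecoration.hue_mem i hi⟩)]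
  hue_block _ hH _ := h.hue_block_splitInto hH
  hue_card _ := h.hue_card_splitInto
  under_boxed _ _ := h.mem_under_splitInto_iff_exists
  under_unboxed i hi hu := absurd
    (h.isDecoration.under_unboxed i hi (h.mem_under_splitInto.1 hu).1) (h.isMismatched i hi)

theorem mergeWith_splitInto (h : P.SplitData D a B r) :
    mergeWith (P.splitInto D a B (B.erase a)) a (B.erase a) = D := by
  refine Marking.ext (Finset.ext fun H => ?_) (funext fun x => ?_) (Finset.ext fun x => ?_)
  · rw [mem_hues_mergeWith, mem_hues_splitInto, Finset.insert_erase h.mem]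
    constructor
    · rintro (rfl | ⟨h' | h' | h', ha, he⟩)
      exacts [h.mem_hues, absurd h' ha, absurd h' he, h'.2]
    · intro hH
      by_cases hHB : H = B
      · exact Or.inl hHB
      · exact Or.inr ⟨Or.inr (Or.inr ⟨hHB, hH⟩), ne_of_mem_of_not_mem hH h.singleton_notMem_hues,
          ne_of_mem_of_not_mem hH h.erase_notMem_hues⟩
  · rw [hue_mergeWith]
    simp only [h.hue_splitInto_eq_or_eq_iff, Finset.insert_erase h.mem]
    split_ifs with hxB
    · rw [hxB]
    · rw [(h.hue_splitInto_eq_iff (h.hue_ne_singleton x) (h.hue_ne_erase x) hxB).2 rfl]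
  · have hmin := h.min_mem
    have hmem := h.mem_erase_iff (x := r)
    simp only [mergeWith, Finset.mem_union, h.mem_under_splitInto, Finset.mem_filter, h.min_erase,
      WithTop.coe_inj]
    grind

theorem wantsToMerge (h : P.SplitData D a B r) :
    P.WantsToMerge (P.splitInto D a B (B.erase a)) a (B.erase a) r :=
  ⟨mem_hues_splitInto.2 (Or.inl rfl), mem_hues_splitInto.2 (Or.inr (Or.inl rfl)), h.min_erase,
    h.isDecoration.hues_monochromatic B h.mem_hues r (Finset.mem_of_mem_erase h.min_mem) a h.mem,
    h.lt_of_mem_erase h.min_mem, h.hue_splitInto.trans (if_pos rfl)⟩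

theorem blockComesFirst (h : P.SplitData D a B r) :
    P.BlockComesFirst (P.splitInto D a B (B.erase a)) a (B.erase a) r := by
  intro x y hx hxr hy hyu
  have hxB := h.hue_splitInto_eq_or_eq_iff.1 (Or.inl hx)
  have hx' : x ∉ B.erase a ∧ x ∉ P.splitTaken D a B := by
    rw [← not_or]
    intro hx'
    rw [h.hue_splitInto, if_neg hxr, if_pos hx'] at hx
    exact singleton_ne_erase_self hx.symm
  have hy' : y ∈ P.splitTaken D a B := by
    refine (h.hue_splitInto_eq_erase_iff.1 hy).resolve_left fun hy' => hyu ?_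
    rw [Finset.mem_erase, h.mem_erase_iff] at hy'
    exact h.mem_under_splitInto.2 ⟨hy'.2.2, hy'.1⟩
  have hyr : y ≠ r := by
    rintro rfl
    exact h.notMem_splitTaken h.min_mem hy'
  have hlisted := listedBefore_of_mem_take hy'
    (h.mem_hueList.2 ⟨hxB, fun hxu => hx'.1 (h.mem_erase_iff.2 ⟨hxB, hxu⟩)⟩) hx'.2
  rw [hueList, listedBefore_filter, ← h.mergeWith_splitInto,
    h.wantsToMerge.listedBefore_permissionOrder_mergeWith h.isDecoration_splitInto
      h.isMismatched_splitInto hyr hxr] at hlisted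
  exact hlisted.1

theorem hasPermission (h : P.SplitData D a B r) :
    P.HasPermission (P.splitInto D a B (B.erase a)) a (B.erase a) :=
  (h.isDecoration_splitInto.hasPermission_iff h.isMismatched_splitInto).2
    ⟨r, h.wantsToMerge, h.blockComesFirst⟩

end SplitData

namespace WantsToMerge

theorem splitData_mergeWith (hw : P.WantsToMerge E t B r) (hE : P.IsDecoration E)
    (hM : P.IsMismatched E) : P.SplitData (mergeWith E t B) t (insert t B) r where
  isDecoration := hw.isDecoration_mergeWith hE hM
  isMismatched := hw.isMismatched_mergeWith hE hM
  mem_hues := mem_hues_mergeWith.2 (Or.inl rfl)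
  min_eq := hw.min_insert
  min_erase := by rw [Finset.erase_insert hw.notMem, hw.min_eq]

theorem mem_hueList_mergeWith (hw : P.WantsToMerge E t B r) (hE : P.IsDecoration E)
    (hM : P.IsMismatched E) : x ∈ P.hueList (mergeWith E t B) (P.color t) (insert t B) ↔
      E.hue x = {t} ∧ x ≠ r ∨ E.hue x = B ∧ x ∉ E.under := by
  rw [(hw.splitData_mergeWith hE hM).mem_hueList, hw.hue_mergeWith_eq_insert_iff hE,
    hw.mem_under_mergeWith, not_or]
  have hunder : E.hue x = {t} → x ∉ E.under := hE.notMem_under_of_hue_eq_singleton hM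
  have hne : E.hue x = B → x ≠ r := fun hx => hw.ne_min_of_hue_ne (hx ▸ hw.ne_singleton)
  tauto

/-- Permission to merge says that the numbers of hue `B` form an initial piece of the list. -/
theorem splitTaken_mergeWith (hw : P.WantsToMerge E t B r) (hE : P.IsDecoration E)
    (hM : P.IsMismatched E) (hB : P.BlockComesFirst E t B r) :
    P.splitTaken (mergeWith E t B) t (insert t B) =
      (P.hueList (mergeWith E t B) (P.color t) (insert t B)).filter fun x => E.hue x = B := by
  rw [splitTaken, Finset.erase_insert hw.notMem, ← take_countP_eq_filter]
  · congr 1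
    rw [← hE.card_hue_notMem_under hM hw.mem_hues, Nat.add_sub_cancel,
      List.countP_eq_length_filter, ← List.toFinset_card_of_nodup (nodup_hueList.filter _)]
    congr 1
    ext x
    have hne : E.hue x = B → E.hue x ≠ {t} := fun hx => hx ▸ hw.ne_singleton
    simp only [Finset.mem_filter, Finset.mem_univ, true_and, List.mem_toFinset, List.mem_filter,
      hw.mem_hueList_mergeWith hE hM, decide_eq_true_eq]
    tauto
  · rw [List.pairwise_iff_forall_sublist]
    intro x y (hxy : ListedBefore _ x y) hy
    rw [decide_eq_true_eq] at hy ⊢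
    by_contra hx
    have hxr := ((hw.mem_hueList_mergeWith hE hM).1 hxy.mem_left).resolve_right fun h => hx h.1
    have hyu := (((hw.mem_hueList_mergeWith hE hM).1 hxy.mem_right).resolve_left
      fun h => hw.ne_singleton (hy.symm.trans h.1)).2
    have hyr := hw.ne_min_of_hue_ne (hy ▸ hw.ne_singleton)
    rw [hueList, listedBefore_filter, hw.listedBefore_permissionOrder_mergeWith hE hM hxr.2 hyr]
      at hxy
    exact hxy.1.asymm nodup_permissionOrder (hB x y hxr.1 hxr.2 hy hyu)

theorem mem_splitTaken_mergeWith (hw : P.WantsToMerge E t B r) (hE : P.IsDecoration E)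
    (hM : P.IsMismatched E) (hB : P.BlockComesFirst E t B r) :
    x ∈ P.splitTaken (mergeWith E t B) t (insert t B) ↔ E.hue x = B ∧ x ∉ E.under := by
  have hne : E.hue x = B → E.hue x ≠ {t} := fun hx => hx ▸ hw.ne_singleton
  rw [hw.splitTaken_mergeWith hE hM hB, List.mem_filter, hw.mem_hueList_mergeWith hE hM,
    decide_eq_true_eq]
  tauto

theorem hue_splitInto_mergeWith (hw : P.WantsToMerge E t B r) (hE : P.IsDecoration E)
    (hM : P.IsMismatched E) (hB : P.BlockComesFirst E t B r) :
    (P.splitInto (mergeWith E t B) t (insert t B) ((insert t B).erase t)).hue x = E.hue x := by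
  rw [(hw.splitData_mergeWith hE hM).hue_splitInto]
  simp only [hw.mem_splitTaken_mergeWith hE hM hB, Finset.erase_insert hw.notMem]
  split_ifs with hxr hx hxt
  · rw [hxr, hw.hue_min]
  · refine (hx.elim (fun hx => ?_) And.left).symm
    exact hE.hue_block B hw.mem_hues x hx ⟨r, hw.min_mem, hw.min_lt hx hxr⟩
  · refine (((hw.hue_mergeWith_eq_insert_iff hE).1 hxt).resolve_right fun hxB => hx ?_).symm
    by_cases hxu : x ∈ E.under
    · exact Or.inl (Finset.mem_of_mem_erase ((Finset.ext_iff.1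
        (hE.filter_hue_mem_under hM hw.mem_hues hw.min_eq) x).1 (by simp [hxB, hxu])))
    · exact Or.inr ⟨hxB, hxu⟩
  · rw [hue_mergeWith, if_neg (mt (hw.hue_mergeWith_eq_insert_iff hE).2 hxt)]

theorem splitInto_mergeWith (hw : P.WantsToMerge E t B r) (hE : P.IsDecoration E)
    (hM : P.IsMismatched E) (hB : P.BlockComesFirst E t B r) :
    P.splitInto (mergeWith E t B) t (insert t B) ((insert t B).erase t) = E := by
  refine Marking.ext (Finset.ext fun H => ?_) (funext fun x => ?_) (Finset.ext fun x => ?_)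
  · rw [mem_hues_splitInto, mem_hues_mergeWith, Finset.erase_insert hw.notMem]
    have hne := hw.insert_notMem_hues hE
    have ht := hw.singleton_mem_hues
    have hBmem := hw.mem_hues
    grind
  · exact hw.hue_splitInto_mergeWith hE hM hB
  · rw [(hw.splitData_mergeWith hE hM).mem_under_splitInto, hw.mem_under_mergeWith]
    have hr := hE.min_notMem_under hw.mem_hues hw.min_eq
    grind

end WantsToMerge

end ColoredExponents

/-! ### Sign-reversing involutions -/

theorem IsSignReversingInvolution.sum_eq {α : Type*} [DecidableEq α] {X : Finset α} {ε : α → ℤ}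
    {φ : α → α} (h : IsSignReversingInvolution X ε φ) :
    ∑ x ∈ X, ε x = ∑ x ∈ X with φ x = x, ε x := by
  obtain ⟨hmem, hinv, hsign⟩ := h
  rw [← Finset.sum_filter_add_sum_filter_not X (fun x => φ x = x), add_eq_left]
  refine Finset.sum_involution (fun x _ => φ x) (fun x hx => ?_) (fun x hx _ => ?_)
    (fun x hx => ?_) (fun x hx => ?_) <;> obtain ⟨hX, hne⟩ := Finset.mem_filter.1 hx
  · rw [hsign x hX hne, add_neg_cancel]
  · exact hne
  · refine Finset.mem_filter.2 ⟨hmem x hX, ?_⟩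
    rw [hinv x hX]
    exact Ne.symm hne
  · exact hinv x hX

theorem neg_one_pow_card_erase {α : Type*} [DecidableEq α] {s : Finset α} {x : α} (hx : x ∈ s) :
    (-1 : ℤ) ^ (s.erase x).card = -(-1) ^ s.card := by
  rw [← Finset.card_erase_add_one hx, pow_succ, mul_neg_one, neg_neg]

theorem neg_one_pow_card_insert {α : Type*} [DecidableEq α] {s : Finset α} {x : α} (hx : x ∉ s) :
    (-1 : ℤ) ^ (insert x s).card = -(-1) ^ s.card := by
  rw [Finset.card_insert_of_notMem hx, pow_succ, mul_neg_one]

theorem neg_one_pow_card_symmDiff_singleton {α : Type*} [DecidableEq α] (s : Finset α) (x : α) :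
    (-1 : ℤ) ^ (symmDiff s {x}).card = -(-1) ^ s.card := by
  by_cases hx : x ∈ s
  · have herase : symmDiff s {x} = s.erase x := by grind [Finset.mem_symmDiff]
    rw [herase, neg_one_pow_card_erase hx]
  · have hinsert : symmDiff s {x} = insert x s := by grind [Finset.mem_symmDiff]
    rw [hinsert, neg_one_pow_card_insert hx]

theorem min_lt_min_of_forall_lt {α : Type*} [LinearOrder α] {s s' : Finset α} {a : α}
    (ha : a ∈ s) (h : ∀ b ∈ s', a < b) : s.min < s'.min := by
  refine (Finset.min_le ha).trans_lt ?_
  rcases s'.eq_empty_or_nonempty with rfl | hs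
  · exact WithTop.coe_lt_top a
  · rw [← Finset.coe_min' hs, WithTop.coe_lt_coe]
    exact h _ (Finset.min'_mem s' hs)

namespace ColoredExponents

variable {n m : ℕ} {P : ColoredExponents n m} {D E : Marking n} {a t r : Fin n}
  {B : Finset (Fin n)}

/-! ### The first involution -/

theorem mem_decorations : D ∈ P.decorations ↔ P.IsDecoration D := by simp [decorations]

theorem mem_matchedUnboxed {i : Fin n} :
    i ∈ P.matchedUnboxed D ↔ i ∉ P.boxed ∧ P.HueMatches D i := by simp [matchedUnboxed]

theorem matchedUnboxed_eq_empty_iff : P.matchedUnboxed D = ∅ ↔ P.IsMismatched D := by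
  simp only [Finset.eq_empty_iff_forall_notMem, mem_matchedUnboxed, not_and, IsMismatched]

theorem IsDecoration.toggle_under (hD : P.IsDecoration D) {x : Fin n}
    (hx : x ∈ P.matchedUnboxed D) :
    P.IsDecoration { D with under := symmDiff D.under {x} } := by
  obtain ⟨hxbox, hxmatch⟩ := mem_matchedUnboxed.1 hx
  refine ⟨hD.hues_nonempty, hD.hues_disjoint, hD.hues_union, hD.hues_monochromatic,
    hD.hue_crossed, hD.hue_mem, hD.hue_block, hD.hue_card, fun i hi => ?_, fun i hi hiu => ?_⟩
  · have hix : i ≠ x := ne_of_mem_of_not_mem hi hxbox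
    rw [← hD.under_boxed i hi]
    simp [Finset.mem_symmDiff, hix]
  · by_cases hix : i = x
    · exact hix ▸ hxmatch
    · exact hD.under_unboxed i hi (by simpa [Finset.mem_symmDiff, hix] using hiu)

theorem IsDecoration.phiUnder (hD : P.IsDecoration D) : P.IsDecoration (P.phiUnder D) := by
  rw [ColoredExponents.phiUnder]
  split_ifs with h
  · exact hD.toggle_under (Finset.min'_mem _ h)
  · exact hD

theorem phiUnder_phiUnder (D : Marking n) : P.phiUnder (P.phiUnder D) = D := by
  by_cases h : (P.matchedUnboxed D).Nonempty
  · have htoggle : P.phiUnder D =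
        { D with under := symmDiff D.under {(P.matchedUnboxed D).min' h} } := dif_pos h
    have hmatched : P.matchedUnboxed (P.phiUnder D) = P.matchedUnboxed D := by
      rw [htoggle]
      rfl
    rw [ColoredExponents.phiUnder, dif_pos (hmatched ▸ h)]
    simp only [hmatched]
    simp [htoggle]
  · have hself : P.phiUnder D = D := dif_neg h
    rw [hself, hself]

theorem sign_phiUnder (h : P.phiUnder D ≠ D) : (P.phiUnder D).sign = -D.sign := by
  rw [phiUnder] at h ⊢
  split_ifs at h ⊢
  · exact neg_one_pow_card_symmDiff_singleton _ _
  · exact absurd rfl h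

theorem phiUnder_eq_self_iff : P.phiUnder D = D ↔ P.IsMismatched D := by
  rw [← matchedUnboxed_eq_empty_iff, ← Finset.not_nonempty_iff_eq_empty]
  refine ⟨fun hself h => ?_, fun h => dif_neg h⟩
  rw [phiUnder, dif_pos h] at hself
  simpa using congrArg Marking.under hself

theorem isSignReversingInvolution_phiUnder :
    IsSignReversingInvolution P.decorations Marking.sign P.phiUnder :=
  ⟨fun _ hD => mem_decorations.2 (mem_decorations.1 hD).phiUnder,
    fun D _ => phiUnder_phiUnder D, fun _ _ => sign_phiUnder⟩

theorem sum_decorations_eq :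
    ∑ D ∈ P.decorations, D.sign = ∑ D ∈ P.mismatchedDecorations, D.sign := by
  rw [isSignReversingInvolution_phiUnder.sum_eq]
  refine Finset.sum_congr (Finset.ext fun D => ?_) fun _ _ => rfl
  rw [Finset.mem_filter, mem_mismatchedDecorations, mem_decorations, phiUnder_eq_self_iff]

/-! ### The second involution -/

theorem mem_splitCandidates_iff {i : Fin n} :
    i ∈ splitCandidates D ↔ ∃ B ∈ D.hues, 1 < B.card ∧ B.min = (i : WithTop (Fin n)) := by
  simp [splitCandidates]

theorem HasPermission.singleton_mem_hues (h : P.HasPermission D t B) : {t} ∈ D.hues := by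
  obtain ⟨r, hw, _⟩ := h
  exact hw.singleton_mem_hues

theorem HasPermission.mem_hues (h : P.HasPermission D t B) : B ∈ D.hues := by
  obtain ⟨r, hw, _⟩ := h
  exact hw.mem_hues

theorem mem_mergeCandidates_iff {i : Fin n} :
    i ∈ P.mergeCandidates D ↔ ∃ B, P.HasPermission D i B := by
  rw [mergeCandidates, Finset.mem_filter_univ]
  exact ⟨fun ⟨B, _, h⟩ => ⟨B, h⟩, fun ⟨B, h⟩ => ⟨B, h.mem_hues, h⟩⟩

theorem HasPermission.mem_mergeCandidates (h : P.HasPermission D t B) :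
    t ∈ P.mergeCandidates D := mem_mergeCandidates_iff.2 ⟨B, h⟩

theorem SplitData.one_lt_card (h : P.SplitData D a B r) : 1 < B.card :=
  Finset.one_lt_card.2 ⟨a, h.mem, r, Finset.mem_of_mem_erase h.min_mem,
    (h.lt_of_mem_erase h.min_mem).ne⟩

theorem SplitData.mem_splitCandidates (h : P.SplitData D a B r) : a ∈ splitCandidates D :=
  mem_splitCandidates_iff.2 ⟨B, h.mem_hues, h.one_lt_card, h.min_eq⟩

theorem IsDecoration.exists_splitData (hD : P.IsDecoration D) (hM : P.IsMismatched D)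
    (ha : a ∈ splitCandidates D) : ∃ B r, P.SplitData D a B r := by
  obtain ⟨B, hB, hcard, hmin⟩ := mem_splitCandidates_iff.1 ha
  obtain ⟨r, hr⟩ := Finset.min_of_nonempty
    ((Finset.erase_nonempty (Finset.mem_of_min hmin)).2 (Finset.one_lt_card_iff_nontrivial.1 hcard))
  exact ⟨B, r, hD, hM, hB, hmin, hr⟩

theorem IsDecoration.notMem_mergeCandidates (hD : P.IsDecoration D) (ha : a ∈ splitCandidates D) :
    a ∉ P.mergeCandidates D := by
  intro h
  obtain ⟨B, hB, hcard, hmin⟩ := mem_splitCandidates_iff.1 ha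
  obtain ⟨H, hH⟩ := mem_mergeCandidates_iff.1 h
  rw [hD.eq_of_mem hB hH.singleton_mem_hues (Finset.mem_of_min hmin) (Finset.mem_singleton_self a),
    Finset.card_singleton] at hcard
  exact lt_irrefl _ hcard

theorem SplitData.splitBlock_eq (h : P.SplitData D a B r) : splitBlock D a = B := by
  have hfilter : (D.hues.filter fun B => 1 < B.card ∧ B.min = (a : WithTop (Fin n))) = {B} := by
    refine Finset.eq_singleton_iff_unique_mem.2
      ⟨Finset.mem_filter.2 ⟨h.mem_hues, h.one_lt_card, h.min_eq⟩, fun H hH => ?_⟩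
    obtain ⟨hH, _, hmin⟩ := Finset.mem_filter.1 hH
    exact h.isDecoration.eq_of_mem hH h.mem_hues (Finset.mem_of_min hmin) h.mem
  rw [splitBlock, hfilter, Finset.sup_singleton, id]

theorem HasPermission.mergeBlock_eq (hD : P.IsDecoration D) (h : P.HasPermission D t B) :
    P.mergeBlock D t = B := by
  have hfilter : (D.hues.filter fun B => P.HasPermission D t B) = {B} :=
    Finset.eq_singleton_iff_unique_mem.2 ⟨Finset.mem_filter.2 ⟨h.mem_hues, h⟩,
      fun _ hH => hD.hasPermission_unique (Finset.mem_filter.1 hH).2 h⟩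
  rw [mergeBlock, hfilter, Finset.sup_singleton, id]

theorem SplitData.phiHue_eq (h : P.SplitData D a B r)
    (hsplit : ∀ b ∈ splitCandidates D, a ≤ b) (hmerge : ∀ b ∈ P.mergeCandidates D, a < b) :
    P.phiHue D = P.splitInto D a B (B.erase a) := by
  have ha := h.mem_splitCandidates
  have hmin : (splitCandidates D).min' ⟨a, ha⟩ = a :=
    le_antisymm (Finset.min'_le _ a ha) (hsplit _ (Finset.min'_mem _ _))
  rw [phiHue, dif_pos ⟨⟨a, ha⟩, min_lt_min_of_forall_lt ha hmerge⟩, hmin, splitAt, h.splitBlock_eq]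

theorem HasPermission.phiHue_eq (hD : P.IsDecoration D) (h : P.HasPermission D t B)
    (hmerge : ∀ b ∈ P.mergeCandidates D, t ≤ b) (hsplit : ∀ b ∈ splitCandidates D, t < b) :
    P.phiHue D = mergeWith D t B := by
  have ht := h.mem_mergeCandidates
  have hmin : (P.mergeCandidates D).min' ⟨t, ht⟩ = t :=
    le_antisymm (Finset.min'_le _ t ht) (hmerge _ (Finset.min'_mem _ _))
  have hlt := min_lt_min_of_forall_lt ht hsplit
  rw [phiHue, dif_neg fun h => h.2.asymm hlt, dif_pos ⟨⟨t, ht⟩, hlt⟩, hmin, h.mergeBlock_eq hD]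

theorem phiHue_eq_self (hsplit : splitCandidates D = ∅) (hmerge : P.mergeCandidates D = ∅) :
    P.phiHue D = D := by
  rw [phiHue, dif_neg fun h => by simp [hsplit] at h, dif_neg fun h => by simp [hmerge] at h]

theorem IsDecoration.splitData_or_hasPermission_or_empty (hD : P.IsDecoration D)
    (hM : P.IsMismatched D) :
    (∃ a B r, P.SplitData D a B r ∧ (∀ b ∈ splitCandidates D, a ≤ b) ∧
      ∀ b ∈ P.mergeCandidates D, a < b) ∨
    (∃ t B, P.HasPermission D t B ∧ (∀ b ∈ P.mergeCandidates D, t ≤ b) ∧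
      ∀ b ∈ splitCandidates D, t < b) ∨
    splitCandidates D = ∅ ∧ P.mergeCandidates D = ∅ := by
  rcases (splitCandidates D ∪ P.mergeCandidates D).eq_empty_or_nonempty with hempty | hne
  · exact Or.inr (Or.inr (Finset.union_eq_empty.1 hempty))
  obtain ⟨i, hi, hmin⟩ := Finset.exists_minimal hne
  have hle : ∀ b, b ∈ splitCandidates D ∨ b ∈ P.mergeCandidates D → i ≤ b := fun b hb =>
    (le_total i b).elim id (hmin (Finset.mem_union.2 hb))
  rcases Finset.mem_union.1 hi with hi | hi
  · obtain ⟨B, r, h⟩ := hD.exists_splitData hM hi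
    refine Or.inl ⟨i, B, r, h, fun b hb => hle b (Or.inl hb), fun b hb =>
      (hle b (Or.inr hb)).lt_of_ne ?_⟩
    rintro rfl
    exact hD.notMem_mergeCandidates hi hb
  · obtain ⟨B, h⟩ := mem_mergeCandidates_iff.1 hi
    refine Or.inr (Or.inl ⟨i, B, h, fun b hb => hle b (Or.inr hb), fun b hb =>
      (hle b (Or.inl hb)).lt_of_ne ?_⟩)
    rintro rfl
    exact hD.notMem_mergeCandidates hb hi

theorem SplitData.sign_splitInto (h : P.SplitData D a B r) :
    (P.splitInto D a B (B.erase a)).sign = -D.sign := by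
  have hunder : (P.splitInto D a B (B.erase a)).under = D.under.erase r := by
    ext x
    rw [h.mem_under_splitInto, Finset.mem_erase, and_comm]
  rw [Marking.sign, Marking.sign, hunder, neg_one_pow_card_erase (h.mem_erase_iff.1 h.min_mem).2]

theorem WantsToMerge.sign_mergeWith (hw : P.WantsToMerge D t B r) (hD : P.IsDecoration D) :
    (mergeWith D t B).sign = -D.sign := by
  have hunder : (mergeWith D t B).under = insert r D.under := by
    ext x
    rw [hw.mem_under_mergeWith, Finset.mem_insert, or_comm]
  rw [Marking.sign, Marking.sign, hunder,
    neg_one_pow_card_insert (hD.min_notMem_under hw.mem_hues hw.min_eq)]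

theorem HasPermission.phiHue_mergeWith (h : P.HasPermission D t B) (hD : P.IsDecoration D)
    (hM : P.IsMismatched D) (hmerge : ∀ b ∈ P.mergeCandidates D, t ≤ b)
    (hsplit : ∀ b ∈ splitCandidates D, t < b) : P.phiHue (mergeWith D t B) = D := by
  obtain ⟨r, hw, hB⟩ := (hD.hasPermission_iff hM).1 h
  have hS := hw.splitData_mergeWith hD hM
  rw [hS.phiHue_eq, hw.splitInto_mergeWith hD hM hB]
  · intro b hb
    obtain ⟨H, hH, hcard, hmin⟩ := mem_splitCandidates_iff.1 hb
    rcases mem_hues_mergeWith.1 hH with rfl | hH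
    · exact (WithTop.coe_injective (hw.min_insert.symm.trans hmin)).le
    · exact (hsplit b (mem_splitCandidates_iff.2 ⟨H, hH.1, hcard, hmin⟩)).le
  · intro b hb
    by_contra! hbt
    rcases hbt.lt_or_eq with hbt | rfl
    · obtain ⟨H, hH⟩ := mem_mergeCandidates_iff.1 hb
      obtain ⟨H', hH'⟩ := hw.exists_hasPermission_of_mergeWith hD hM hB hbt hH
      exact (hmerge b hH'.mem_mergeCandidates).not_gt hbt
    · exact hS.isDecoration.notMem_mergeCandidates hS.mem_splitCandidates hb

theorem SplitData.phiHue_splitInto (h : P.SplitData D a B r)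
    (hsplit : ∀ b ∈ splitCandidates D, a ≤ b) (hmerge : ∀ b ∈ P.mergeCandidates D, a < b) :
    P.phiHue (P.splitInto D a B (B.erase a)) = D := by
  rw [h.hasPermission.phiHue_eq h.isDecoration_splitInto, h.mergeWith_splitInto]
  · intro b hb
    by_contra! hba
    obtain ⟨H, hH⟩ := mem_mergeCandidates_iff.1 hb
    obtain ⟨H', hH'⟩ := h.wantsToMerge.exists_hasPermission_mergeWith h.isDecoration_splitInto
      h.isMismatched_splitInto h.blockComesFirst hba hH
    rw [h.mergeWith_splitInto] at hH'
    exact (hmerge b hH'.mem_mergeCandidates).not_gt hba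
  · intro b hb
    obtain ⟨H, hH, hcard, hmin⟩ := mem_splitCandidates_iff.1 hb
    rcases mem_hues_splitInto.1 hH with rfl | rfl | ⟨hHB, hH⟩
    · simp at hcard
    · exact h.lt_of_mem_erase (Finset.mem_of_min hmin)
    · refine (hsplit b (mem_splitCandidates_iff.2 ⟨H, hH, hcard, hmin⟩)).lt_of_ne ?_
      rintro rfl
      exact hHB (h.isDecoration.eq_of_mem hH h.mem_hues (Finset.mem_of_min hmin) h.mem)

theorem isSignReversingInvolution_phiHue :
    IsSignReversingInvolution P.mismatchedDecorations Marking.sign P.phiHue := by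
  suffices h : ∀ D ∈ P.mismatchedDecorations, P.phiHue D ∈ P.mismatchedDecorations ∧
      P.phiHue (P.phiHue D) = D ∧ (P.phiHue D ≠ D → (P.phiHue D).sign = -D.sign) from
    ⟨fun D hD => (h D hD).1, fun D hD => (h D hD).2.1, fun D hD => (h D hD).2.2⟩
  intro D hDM
  obtain ⟨hD, hM⟩ := mem_mismatchedDecorations.1 hDM
  rcases hD.splitData_or_hasPermission_or_empty hM with
    ⟨a, B, r, h, hsplit, hmerge⟩ | ⟨t, B, h, hmerge, hsplit⟩ | ⟨hsplit, hmerge⟩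
  · rw [h.phiHue_eq hsplit hmerge]
    exact ⟨mem_mismatchedDecorations.2 ⟨h.isDecoration_splitInto, h.isMismatched_splitInto⟩,
      h.phiHue_splitInto hsplit hmerge, fun _ => h.sign_splitInto⟩
  · rw [h.phiHue_eq hD hmerge hsplit]
    obtain ⟨r, hw, _⟩ := id h
    exact ⟨mem_mismatchedDecorations.2 ⟨hw.isDecoration_mergeWith hD hM,
      hw.isMismatched_mergeWith hD hM⟩, h.phiHue_mergeWith hD hM hmerge hsplit,
      fun _ => hw.sign_mergeWith hD⟩
  · rw [phiHue_eq_self hsplit hmerge]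
    exact ⟨hDM, phiHue_eq_self hsplit hmerge, absurd rfl⟩

theorem neg_sign_ne_sign (D : Marking n) : -D.sign ≠ D.sign :=
  neg_ne_self.2 (pow_ne_zero _ (by norm_num))

theorem IsDecoration.phiHue_eq_self_iff (hD : P.IsDecoration D) (hM : P.IsMismatched D) :
    P.phiHue D = D ↔ splitCandidates D = ∅ ∧ P.mergeCandidates D = ∅ := by
  refine ⟨fun hself => ?_, fun h => phiHue_eq_self h.1 h.2⟩
  rcases hD.splitData_or_hasPermission_or_empty hM with
    ⟨a, B, r, h, hsplit, hmerge⟩ | ⟨t, B, h, hmerge, hsplit⟩ | h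
  · have hsign := h.sign_splitInto
    rw [← h.phiHue_eq hsplit hmerge, hself] at hsign
    exact absurd hsign.symm (neg_sign_ne_sign D)
  · obtain ⟨r, hw, _⟩ := id h
    have hsign := hw.sign_mergeWith hD
    rw [← h.phiHue_eq hD hmerge hsplit, hself] at hsign
    exact absurd hsign.symm (neg_sign_ne_sign D)
  · exact h

theorem IsDecoration.splitCandidates_eq_empty_iff (hD : P.IsDecoration D) :
    splitCandidates D = ∅ ↔ ∀ B ∈ D.hues, B.card = 1 := by
  rw [Finset.eq_empty_iff_forall_notMem]
  refine ⟨fun h B hB => ?_, fun h a ha => ?_⟩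
  · have hne := hD.hues_nonempty B hB
    refine le_antisymm (not_lt.1 fun hcard => ?_) (Finset.card_pos.2 hne)
    exact h (B.min' hne) (mem_splitCandidates_iff.2 ⟨B, hB, hcard, (Finset.coe_min' hne).symm⟩)
  · obtain ⟨B, hB, hcard, _⟩ := mem_splitCandidates_iff.1 ha
    exact hcard.ne' (h B hB)

theorem mergeCandidates_eq_empty_iff :
    P.mergeCandidates D = ∅ ↔ ∀ t B, ¬ P.HasPermission D t B := by
  simp only [Finset.eq_empty_iff_forall_notMem, mem_mergeCandidates_iff, not_exists]

theorem phiHue_eq_self_iff_isFixedPoint (hD : D ∈ P.mismatchedDecorations) :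
    P.phiHue D = D ↔ P.IsFixedPoint D := by
  obtain ⟨hdec, hM⟩ := mem_mismatchedDecorations.1 hD
  rw [hdec.phiHue_eq_self_iff hM, hdec.splitCandidates_eq_empty_iff, mergeCandidates_eq_empty_iff,
    IsFixedPoint, and_iff_right hD]

theorem IsFixedPoint.under_eq_empty (h : P.IsFixedPoint D) : D.under = ∅ := by
  obtain ⟨hDM, hcard, _⟩ := h
  obtain ⟨hD, hM⟩ := mem_mismatchedDecorations.1 hDM
  refine Finset.eq_empty_iff_forall_notMem.2 fun x hx => ?_
  obtain ⟨B, hB, hxB, j, hj, hjx⟩ := (hD.mem_under_iff hM).1 hx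
  exact hjx.ne (Finset.card_le_one.1 (hcard B hB).le j hj x hxB)

theorem IsFixedPoint.sign_eq_one (h : P.IsFixedPoint D) : D.sign = 1 := by
  rw [Marking.sign, h.under_eq_empty, Finset.card_empty, pow_zero]

theorem mem_fixedPointDecorations : D ∈ P.fixedPointDecorations ↔ P.IsFixedPoint D := by
  simp [fixedPointDecorations]

theorem fixedPointDecorations_eq_filter :
    P.fixedPointDecorations = P.mismatchedDecorations.filter fun D => P.phiHue D = D := by
  ext D
  rw [mem_fixedPointDecorations, Finset.mem_filter]
  exact ⟨fun h => ⟨h.1, (phiHue_eq_self_iff_isFixedPoint h.1).2 h⟩,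
    fun h => (phiHue_eq_self_iff_isFixedPoint h.1).1 h.2⟩

theorem sum_mismatchedDecorations_eq :
    ∑ D ∈ P.mismatchedDecorations, D.sign = (P.fixedPointDecorations.card : ℤ) := by
  rw [isSignReversingInvolution_phiHue.sum_eq, ← fixedPointDecorations_eq_filter,
    Finset.sum_congr rfl fun D hD => ?_, Finset.sum_const, nsmul_one]
  exact (mem_fixedPointDecorations.1 hD).sign_eq_one

end ColoredExponents

/-! ### Partitions -/

open Finset in
/-- Expand `(∑ b, X b) ^ card ι` over all functions, and compare coefficients of
`∏ b, X b ^ c b`. -/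
theorem card_filter_card_fiber_eq {ι σ : Type*} [Fintype ι] [Fintype σ] [DecidableEq ι]
    [DecidableEq σ] {c : σ → ℕ} (h : Fintype.card ι = ∑ b, c b) :
    #{f : ι → σ | ∀ b, #{i | f i = b} = c b} = Nat.multinomial univ c := by
  have hmonomial (f : ι → σ) : ∏ i, (MvPolynomial.X (f i) : MvPolynomial σ ℕ) =
      ∏ b, MvPolynomial.X b ^ #{i | f i = b} := by
    simp only [← prod_const, prod_fiberwise']
  have hexpand : (∑ b, MvPolynomial.X b : MvPolynomial σ ℕ) ^ Fintype.card ι =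
      ∑ f : ι → σ, ∏ b, MvPolynomial.X b ^ #{i | f i = b} := by
    rw [← card_univ, ← prod_const, Fintype.prod_sum]
    exact sum_congr rfl fun f _ => hmonomial f
  have hcoeff := congrArg (MvPolynomial.coeff (Finsupp.equivFunOnFinite.symm c)) hexpand
  rw [MvPolynomial.coeff_sum_X_pow_of_fintype, if_pos (by simp [Finsupp.sum_fintype, h]),
    Finsupp.multinomial_eq_of_support_subset (subset_univ _), MvPolynomial.coeff_sum,
    Finsupp.coe_equivFunOnFinite_symm, Nat.cast_id] at hcoeff
  rw [card_filter, hcoeff]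
  refine sum_congr rfl fun f _ => ?_
  rw [MvPolynomial.coeff_prod_X_pow]
  simp [Finsupp.ext_iff, eq_comm]

section NonMinima

variable {α : Type*} {s : Finset α}

theorem eq_of_forall_part_eq [DecidableEq α] {Q Q' : Finpartition s}
    (h : ∀ x ∈ s, Q.part x = Q'.part x) : Q = Q' := by
  have hparts (Q : Finpartition s) : Q.parts = s.image Q.part := by
    ext A
    rw [Finset.mem_image]
    refine ⟨fun hA => Q.part_surjOn hA, ?_⟩
    rintro ⟨x, hx, rfl⟩
    exact Q.part_mem.2 hx
  apply Finpartition.ext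
  rw [hparts, hparts, Finset.image_congr h]

variable [LinearOrder α] {Q : Finpartition s} {A : Finset α} {x y r r' : α}

/-- The elements of `s` that are not the minimum of their part. -/
def nonMinima (Q : Finpartition s) : Finset α := s.filter fun x => ∃ y ∈ Q.part x, y < x

theorem mem_nonMinima : x ∈ nonMinima Q ↔ ∃ y ∈ Q.part x, y < x := by
  rw [nonMinima, Finset.mem_filter, and_iff_right_iff_imp]
  rintro ⟨y, hy, -⟩
  exact Q.part_nonempty.1 ⟨y, hy⟩

theorem eq_of_mem_part_of_notMem_nonMinima (hr : r ∈ Q.part x) (hr' : r' ∈ Q.part x)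
    (hmin : r ∉ nonMinima Q) (hmin' : r' ∉ nonMinima Q) : r = r' := by
  have hx : Q.part x ∈ Q.parts := Q.part_mem.2 (Q.part_nonempty.1 ⟨r, hr⟩)
  rw [mem_nonMinima, Q.part_eq_of_mem hx hr] at hmin
  rw [mem_nonMinima, Q.part_eq_of_mem hx hr'] at hmin'
  push Not at hmin hmin'
  exact le_antisymm (hmin r' hr') (hmin' r hr)

theorem card_filter_nonMinima (hA : A ∈ Q.parts) :
    ((nonMinima Q).filter (· ∈ A)).card = A.card - 1 := by
  have hne := Q.nonempty_of_mem_parts hA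
  rw [← Finset.card_erase_of_mem (A.min'_mem hne)]
  congr 1
  ext x
  rw [Finset.mem_filter, mem_nonMinima, Finset.mem_erase, and_congr_left_iff]
  intro hx
  rw [Q.part_eq_of_mem hA hx]
  constructor
  · rintro ⟨y, hy, hyx⟩
    exact ((A.min'_le y hy).trans_lt hyx).ne'
  · exact fun hxmin => ⟨A.min' hne, A.min'_mem hne, (A.min'_le x hx).lt_of_ne hxmin.symm⟩

theorem card_nonMinima (Q : Finpartition s) :
    (nonMinima Q).card = ∑ A ∈ Q.parts, (A.card - 1) := by
  have hparts : ∀ x ∈ nonMinima Q, Q.part x ∈ Q.parts := fun x hx =>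
    Q.part_mem.2 (Finset.filter_subset _ _ hx)
  rw [Finset.card_eq_sum_card_fiberwise hparts]
  refine Finset.sum_congr rfl fun A hA => ?_
  simp only [Q.part_eq_iff_mem hA, card_filter_nonMinima hA]

theorem card_nonMinima_add_card_parts (Q : Finpartition s) :
    (nonMinima Q).card + Q.parts.card = s.card := by
  rw [card_nonMinima, Finset.card_eq_sum_ones, ← Finset.sum_add_distrib, ← Q.sum_card_parts]
  exact Finset.sum_congr rfl fun A hA =>
    Nat.sub_add_cancel (Finset.card_pos.2 (Q.nonempty_of_mem_parts hA))

end NonMinima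

namespace ColoredExponents

variable {n m : ℕ} {P : ColoredExponents n m} {D : Marking n} {x y : Fin n}
  {A A' B : Finset (Fin n)} {Q : Finpartition (Finset.univ : Finset (Fin n))}

theorem boxed_of_lt (hyx : y < x) (hc : P.color y = P.color x) (hx : x ∈ P.boxed) :
    y ∈ P.boxed :=
  mem_boxed.2 (P.k_sorted y x hyx hc (mem_boxed.1 hx)).1

theorem lt_of_notMem_boxed (hc : P.color y = P.color x) (hy : y ∈ P.boxed) (hx : x ∉ P.boxed) :
    y < x := by
  by_contra h
  rcases (not_lt.1 h).eq_or_lt with rfl | hxy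
  · exact hx hy
  · exact hx (boxed_of_lt hxy hc.symm hy)

theorem kSum_inter_boxed (A : Finset (Fin n)) : P.kSum (A ∩ P.boxed) = P.kSum A :=
  Finset.sum_subset Finset.inter_subset_left fun _ hx hx' =>
    Nat.eq_zero_of_not_pos fun h => hx' (Finset.mem_inter.2 ⟨hx, mem_boxed.2 h⟩)

theorem inter_boxed_nonempty (h : 0 < P.kSum A) : (A ∩ P.boxed).Nonempty :=
  Finset.nonempty_of_sum_ne_zero (f := P.k) (by rw [← kSum, kSum_inter_boxed]; exact h.ne')

theorem injOn_color_crossed : Set.InjOn P.color P.crossed := by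
  intro i hi j hj hij
  simp only [crossed, Finset.coe_filter, Finset.mem_univ, true_and, Set.mem_ofPred_eq] at hi hj
  exact le_antisymm (hi.2 j hij.symm) (hj.2 i hij)

theorem image_color_crossed :
    P.crossed.image P.color = Finset.univ.filter fun c : Fin m => (c : ℕ) < 3 := by
  ext c
  simp only [crossed, Finset.mem_image, Finset.mem_filter, Finset.mem_univ, true_and]
  constructor
  · rintro ⟨i, ⟨hi, -⟩, rfl⟩
    exact hi
  · intro hc
    obtain ⟨i, hi⟩ := P.color_surjective c
    have hne : (Finset.univ.filter fun j => P.color j = c).Nonempty := ⟨i, by simp [hi]⟩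
    have hmin := (Finset.mem_filter.1 (Finset.min'_mem _ hne)).2
    exact ⟨_, ⟨by rwa [hmin], fun j hj => Finset.min'_le _ j (by simp [hj, hmin])⟩, hmin⟩

theorem card_crossed (P : ColoredExponents n m) : P.crossed.card = 3 := by
  rw [← Finset.card_image_of_injOn injOn_color_crossed, image_color_crossed,
    Fin.card_filter_val_lt, min_eq_right P.three_le]

/-- The partitions whose term in the alternating sum does not vanish by convention: the parts are
monochromatic, and none of the numbers `k_A - |A| + 1` is negative. -/
structure Admissible (P : ColoredExponents n m)
    (Q : Finpartition (Finset.univ : Finset (Fin n))) : Prop where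
  monochromatic : ∀ A ∈ Q.parts, P.Monochromatic A
  card_le : ∀ A ∈ Q.parts, A.card ≤ P.kSum A + 1

/-- The minima of the parts that are not crossed out. In a decoration with underlying partition `Q`
these are the numbers whose hue can be chosen. -/
def freeMinima (P : ColoredExponents n m) (Q : Finpartition (Finset.univ : Finset (Fin n))) :
    Finset (Fin n) :=
  Finset.univ.filter fun x => x ∉ P.crossed ∧ x ∉ nonMinima Q

theorem mem_freeMinima : x ∈ P.freeMinima Q ↔ x ∉ P.crossed ∧ x ∉ nonMinima Q := by
  simp [freeMinima]

/-- The assignments of a part to each free minimum that use every part `A` exactly `k_A - |A| + 1`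
times. They are counted by the multinomial coefficient of `Q`. -/
def partAssignments (P : ColoredExponents n m)
    (Q : Finpartition (Finset.univ : Finset (Fin n))) : Finset (P.freeMinima Q → Q.parts) :=
  Finset.univ.filter fun f =>
    ∀ A, (Finset.univ.filter fun x => f x = A).card = P.kSum A + 1 - (A : Finset (Fin n)).card

theorem mem_partAssignments {f : P.freeMinima Q → Q.parts} : f ∈ P.partAssignments Q ↔
    ∀ A, (Finset.univ.filter fun x => f x = A).card =
      P.kSum A + 1 - (A : Finset (Fin n)).card := by
  simp [partAssignments]

/-- The decoration obtained from a partition and an assignment of parts to the free minima. The hues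
are the boxed portions of the parts, and the non-minimal elements of a part are underlined and have
the hue that belongs to the part. -/
def toMarking (P : ColoredExponents n m) (Q : Finpartition (Finset.univ : Finset (Fin n)))
    (f : P.freeMinima Q → Q.parts) : Marking n where
  hues := (Q.parts.image (· ∩ P.boxed)).erase ∅
  hue x :=
    if h : x ∈ P.freeMinima Q then f ⟨x, h⟩ ∩ P.boxed
    else if x ∈ P.crossed then ∅ else Q.part x ∩ P.boxed
  under := nonMinima Q

theorem mem_part_self (x : Fin n) : x ∈ Q.part x := Q.mem_part_self.2 (Finset.mem_univ x)

theorem part_mem_parts (x : Fin n) : Q.part x ∈ Q.parts := Q.part_mem.2 (Finset.mem_univ x)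

theorem color_eq_of_mem_part (hQ : ∀ A ∈ Q.parts, P.Monochromatic A) (h : y ∈ Q.part x) :
    P.color y = P.color x :=
  hQ _ (part_mem_parts x) y h x (mem_part_self x)

theorem notMem_crossed_of_mem_nonMinima (hQ : ∀ A ∈ Q.parts, P.Monochromatic A)
    (hx : x ∈ nonMinima Q) : x ∉ P.crossed := by
  obtain ⟨y, hy, hyx⟩ := mem_nonMinima.1 hx
  intro hcrossed
  exact hyx.not_ge ((Finset.mem_filter.1 hcrossed).2.2 y (color_eq_of_mem_part hQ hy))

theorem Admissible.part_inter_boxed_nonempty (hQ : P.Admissible Q) (hx : x ∈ nonMinima Q) :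
    (Q.part x ∩ P.boxed).Nonempty := by
  obtain ⟨y, hy, hyx⟩ := mem_nonMinima.1 hx
  have hcard : 1 < (Q.part x).card :=
    Finset.one_lt_card.2 ⟨y, hy, x, mem_part_self x, hyx.ne⟩
  have hle := hQ.card_le _ (part_mem_parts x)
  exact inter_boxed_nonempty (by omega)

theorem assigned_inter_boxed_nonempty {f : P.freeMinima Q → Q.parts}
    (hf : f ∈ P.partAssignments Q) (x : P.freeMinima Q) :
    ((f x : Finset _) ∩ P.boxed).Nonempty := by
  have hfiber : 0 < (Finset.univ.filter fun y => f y = f x).card :=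
    Finset.card_pos.2 ⟨x, by simp⟩
  rw [mem_partAssignments.1 hf] at hfiber
  have hcard := Finset.card_pos.2 (Q.nonempty_of_mem_parts (f x).2)
  exact inter_boxed_nonempty (by omega)

theorem eq_of_inter_boxed_eq (hA : A ∈ Q.parts) (hA' : A' ∈ Q.parts)
    (hne : (A ∩ P.boxed).Nonempty) (h : A ∩ P.boxed = A' ∩ P.boxed) : A = A' := by
  obtain ⟨x, hx⟩ := hne
  exact Q.eq_of_mem_parts hA hA' (Finset.mem_inter.1 hx).1 (Finset.mem_inter.1 (h ▸ hx)).1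

theorem card_freeMinima_add (hQ : ∀ A ∈ Q.parts, P.Monochromatic A) :
    (P.freeMinima Q).card + 3 = Q.parts.card := by
  have hcompl : P.freeMinima Q = (P.crossed ∪ nonMinima Q)ᶜ := by
    ext x
    simp [mem_freeMinima]
  have hdisj : Disjoint P.crossed (nonMinima Q) :=
    Finset.disjoint_right.2 fun x => notMem_crossed_of_mem_nonMinima hQ
  have hcard := Finset.card_compl_add_card (P.crossed ∪ nonMinima Q)
  rw [← hcompl, Finset.card_union_of_disjoint hdisj, card_crossed] at hcard
  have hparts := card_nonMinima_add_card_parts Q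
  rw [Finset.card_univ] at hparts
  omega

theorem Admissible.sum_eq (hQ : P.Admissible Q) :
    ∑ A ∈ Q.parts, (P.kSum A + 1 - A.card) + 3 = Q.parts.card := by
  have hadd : ∑ A ∈ Q.parts, (P.kSum A + 1 - A.card) + ∑ A ∈ Q.parts, A.card =
      ∑ A ∈ Q.parts, P.kSum A + Q.parts.card := by
    rw [Finset.card_eq_sum_ones, ← Finset.sum_add_distrib, ← Finset.sum_add_distrib]
    exact Finset.sum_congr rfl fun A hA => Nat.sub_add_cancel (hQ.card_le A hA)
  have hk : ∑ A ∈ Q.parts, P.kSum A = ∑ i, P.k i :=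
    (Finset.sum_biUnion Q.disjoint).symm.trans (by rw [Q.biUnion_parts])
  rw [Q.sum_card_parts, Finset.card_univ, Fintype.card_fin, hk] at hadd
  have := P.sum_k
  omega

theorem card_partAssignments (hQ : P.Admissible Q) :
    (P.partAssignments Q).card = P.multinomialTerm Q := by
  have hsum : ∑ A : Q.parts, (P.kSum A + 1 - (A : Finset (Fin n)).card) =
      ∑ A ∈ Q.parts, (P.kSum A + 1 - A.card) :=
    Finset.sum_coe_sort Q.parts fun A => P.kSum A + 1 - A.card
  have hfree : Fintype.card (P.freeMinima Q) =
      ∑ A : Q.parts, (P.kSum A + 1 - (A : Finset (Fin n)).card) := by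
    have := hQ.sum_eq
    have := card_freeMinima_add hQ.monochromatic
    rw [Fintype.card_coe, hsum]
    omega
  rw [multinomialTerm, if_pos hQ.card_le, partAssignments, card_filter_card_fiber_eq hfree,
    Nat.multinomial, Nat.multinomial, hsum,
    Finset.prod_coe_sort Q.parts fun A => (P.kSum A + 1 - A.card).factorial]

variable {f : P.freeMinima Q → Q.parts}

theorem mem_hues_toMarking :
    B ∈ (P.toMarking Q f).hues ↔ B.Nonempty ∧ ∃ A ∈ Q.parts, A ∩ P.boxed = B := by
  simp only [toMarking, Finset.mem_erase, Finset.mem_image, Finset.nonempty_iff_ne_empty]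

theorem hue_toMarking_of_mem_freeMinima (hx : x ∈ P.freeMinima Q) :
    (P.toMarking Q f).hue x = (f ⟨x, hx⟩ : Finset (Fin n)) ∩ P.boxed :=
  dif_pos hx

theorem hue_toMarking_of_mem_crossed (hx : x ∈ P.crossed) : (P.toMarking Q f).hue x = ∅ :=
  (dif_neg fun h => (mem_freeMinima.1 h).1 hx).trans (if_pos hx)

theorem hue_toMarking_of_mem_nonMinima (hQ : ∀ A ∈ Q.parts, P.Monochromatic A)
    (hx : x ∈ nonMinima Q) : (P.toMarking Q f).hue x = Q.part x ∩ P.boxed :=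
  (dif_neg fun h => (mem_freeMinima.1 h).2 hx).trans
    (if_neg (notMem_crossed_of_mem_nonMinima hQ hx))

theorem mem_nonMinima_of_notMem_freeMinima (hx : x ∉ P.freeMinima Q) (hcrossed : x ∉ P.crossed) :
    x ∈ nonMinima Q := by
  rw [mem_freeMinima, not_and, not_not] at hx
  exact hx hcrossed

theorem hue_toMarking_eq_iff (hQ : ∀ A ∈ Q.parts, P.Monochromatic A) (hA : A ∈ Q.parts)
    (hne : (A ∩ P.boxed).Nonempty) : (P.toMarking Q f).hue x = A ∩ P.boxed ↔
      (∃ h : x ∈ P.freeMinima Q, f ⟨x, h⟩ = ⟨A, hA⟩) ∨ x ∈ nonMinima Q ∧ x ∈ A := by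
  have inter_eq_iff {A' : Finset (Fin n)} (hA' : A' ∈ Q.parts) :
      A' ∩ P.boxed = A ∩ P.boxed ↔ A' = A :=
    ⟨fun h => (eq_of_inter_boxed_eq hA hA' hne h.symm).symm, fun h => h ▸ rfl⟩
  by_cases hfree : x ∈ P.freeMinima Q
  · have hmin := (mem_freeMinima.1 hfree).2
    rw [hue_toMarking_of_mem_freeMinima hfree, inter_eq_iff (f ⟨x, hfree⟩).2]
    simp only [hfree, hmin, Subtype.ext_iff, exists_true_left, false_and, or_false]
  simp only [hfree, IsEmpty.exists_iff, false_or]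
  by_cases hcrossed : x ∈ P.crossed
  · have hmin : x ∉ nonMinima Q := fun h => notMem_crossed_of_mem_nonMinima hQ h hcrossed
    simp only [hue_toMarking_of_mem_crossed hcrossed, hne.ne_empty.symm, hmin, false_and]
  · have hmin := mem_nonMinima_of_notMem_freeMinima hfree hcrossed
    rw [hue_toMarking_of_mem_nonMinima hQ hmin, inter_eq_iff (part_mem_parts x),
      Q.part_eq_iff_mem hA, and_iff_right hmin]

theorem card_hue_toMarking_eq (hQ : ∀ A ∈ Q.parts, P.Monochromatic A) (hA : A ∈ Q.parts)
    (hne : (A ∩ P.boxed).Nonempty) :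
    (Finset.univ.filter fun x => (P.toMarking Q f).hue x = A ∩ P.boxed).card =
      (Finset.univ.filter fun x => f x = ⟨A, hA⟩).card + (A.card - 1) := by
  have hdisj : Disjoint
      ((Finset.univ.filter fun x => f x = ⟨A, hA⟩).map (Function.Embedding.subtype _))
      ((nonMinima Q).filter (· ∈ A)) := by
    rw [Finset.disjoint_left]
    intro x hx hx'
    obtain ⟨y, -, rfl⟩ := Finset.mem_map.1 hx
    exact (mem_freeMinima.1 y.2).2 (Finset.mem_filter.1 hx').1
  rw [← card_filter_nonMinima hA, ← Finset.card_map (Function.Embedding.subtype _),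
    ← Finset.card_union_of_disjoint hdisj]
  congr 1
  ext x
  simp [hue_toMarking_eq_iff hQ hA hne]

theorem Admissible.hue_toMarking_mem_hues (hQ : P.Admissible Q) (hf : f ∈ P.partAssignments Q)
    (hx : x ∉ P.crossed) : (P.toMarking Q f).hue x ∈ (P.toMarking Q f).hues := by
  rw [mem_hues_toMarking]
  by_cases hfree : x ∈ P.freeMinima Q
  · rw [hue_toMarking_of_mem_freeMinima hfree]
    exact ⟨assigned_inter_boxed_nonempty hf _, _, (f ⟨x, hfree⟩).2, rfl⟩
  · have hmin := mem_nonMinima_of_notMem_freeMinima hfree hx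
    rw [hue_toMarking_of_mem_nonMinima hQ.monochromatic hmin]
    exact ⟨hQ.part_inter_boxed_nonempty hmin, _, part_mem_parts x, rfl⟩

theorem biUnion_hues_toMarking : (P.toMarking Q f).hues.biUnion id = P.boxed := by
  ext x
  simp only [Finset.mem_biUnion, mem_hues_toMarking, id]
  constructor
  · rintro ⟨_, ⟨-, A, -, rfl⟩, hx⟩
    exact (Finset.mem_inter.1 hx).2
  · intro hx
    have hmem : x ∈ Q.part x ∩ P.boxed := Finset.mem_inter.2 ⟨mem_part_self x, hx⟩
    exact ⟨_, ⟨⟨x, hmem⟩, Q.part x, part_mem_parts x, rfl⟩, hmem⟩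

theorem mem_nonMinima_iff_of_mem_boxed (hQ : ∀ A ∈ Q.parts, P.Monochromatic A)
    (hx : x ∈ P.boxed) :
    x ∈ nonMinima Q ↔ ∃ B ∈ (P.toMarking Q f).hues, x ∈ B ∧ ∃ y ∈ B, y < x := by
  have hmem : x ∈ Q.part x ∩ P.boxed := Finset.mem_inter.2 ⟨mem_part_self x, hx⟩
  rw [mem_nonMinima]
  constructor
  · rintro ⟨y, hy, hyx⟩
    exact ⟨_, mem_hues_toMarking.2 ⟨⟨x, hmem⟩, _, part_mem_parts x, rfl⟩, hmem, y,
      Finset.mem_inter.2 ⟨hy, boxed_of_lt hyx (color_eq_of_mem_part hQ hy) hx⟩, hyx⟩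
  · rintro ⟨B, hB, hxB, y, hy, hyx⟩
    obtain ⟨-, A, hA, rfl⟩ := mem_hues_toMarking.1 hB
    rw [Q.part_eq_of_mem hA (Finset.mem_inter.1 hxB).1]
    exact ⟨y, (Finset.mem_inter.1 hy).1, hyx⟩

theorem hueMatches_toMarking (hQ : P.Admissible Q) (hx : x ∈ nonMinima Q) :
    P.HueMatches (P.toMarking Q f) x := by
  obtain ⟨b, hb⟩ := hQ.part_inter_boxed_nonempty hx
  exact ⟨b, by rwa [hue_toMarking_of_mem_nonMinima hQ.monochromatic hx],
    color_eq_of_mem_part hQ.monochromatic (Finset.mem_inter.1 hb).1⟩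

theorem isDecoration_toMarking (hQ : P.Admissible Q) (hf : f ∈ P.partAssignments Q) :
    P.IsDecoration (P.toMarking Q f) where
  hues_nonempty B hB := (mem_hues_toMarking.1 hB).1
  hues_disjoint B hB B' hB' hne := by
    obtain ⟨-, A, hA, rfl⟩ := mem_hues_toMarking.1 hB
    obtain ⟨-, A', hA', rfl⟩ := mem_hues_toMarking.1 hB'
    have hdisj : Disjoint A A' := Q.disjoint hA hA' fun h => hne (h ▸ rfl)
    exact hdisj.mono Finset.inter_subset_left Finset.inter_subset_left
  hues_union := biUnion_hues_toMarking
  hues_monochromatic B hB i hi j hj := by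
    obtain ⟨-, A, hA, rfl⟩ := mem_hues_toMarking.1 hB
    exact hQ.monochromatic A hA i (Finset.mem_inter.1 hi).1 j (Finset.mem_inter.1 hj).1
  hue_crossed i hi := hue_toMarking_of_mem_crossed hi
  hue_mem i hi := hQ.hue_toMarking_mem_hues hf hi
  hue_block B hB i hi hj := by
    obtain ⟨-, A, hA, rfl⟩ := mem_hues_toMarking.1 hB
    have hmin := (mem_nonMinima_iff_of_mem_boxed hQ.monochromatic (Finset.mem_inter.1 hi).2).2
      ⟨_, hB, hi, hj⟩
    rw [hue_toMarking_of_mem_nonMinima hQ.monochromatic hmin,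
      Q.part_eq_of_mem hA (Finset.mem_inter.1 hi).1]
  hue_card B hB := by
    obtain ⟨hne, A, hA, rfl⟩ := mem_hues_toMarking.1 hB
    rw [card_hue_toMarking_eq hQ.monochromatic hA hne, mem_partAssignments.1 hf,
      kSum_inter_boxed]
    have hle := hQ.card_le A hA
    have hpos := Finset.card_pos.2 (Q.nonempty_of_mem_parts hA)
    simp only
    omega
  under_boxed i hi := mem_nonMinima_iff_of_mem_boxed hQ.monochromatic hi
  under_unboxed i _ hunder := hueMatches_toMarking hQ hunder

/-- The minimum of the part that contains `x` in the partition underlying `D`. An underlined number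
belongs to the same part as the minimum of its hue; any other number is the minimum of its part. -/
def partMin (D : Marking n) (x : Fin n) : Fin n :=
  if x ∈ D.under then (D.hue x).min.untopD x else x

theorem partMin_of_notMem_under (hx : x ∉ D.under) : partMin D x = x := if_neg hx

namespace IsDecoration

theorem hueMatches_of_mem_under (hD : P.IsDecoration D) (hx : x ∈ D.under) :
    P.HueMatches D x := by
  by_cases hboxed : x ∈ P.boxed
  · obtain ⟨B, hB, hxB, hlt⟩ := (hD.under_boxed x hboxed).1 hx
    exact ⟨x, by rwa [hD.hue_block B hB x hxB hlt], rfl⟩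
  · exact hD.under_unboxed x hboxed hx

theorem hue_mem_of_mem_under (hD : P.IsDecoration D) (hx : x ∈ D.under) : D.hue x ∈ D.hues :=
  hD.hue_mem_of_hueMatches (hD.hueMatches_of_mem_under hx)

theorem min_hue_eq_partMin (hD : P.IsDecoration D) (hx : x ∈ D.under) :
    (D.hue x).min = partMin D x := by
  obtain ⟨r, hr⟩ := Finset.min_of_nonempty (hD.hues_nonempty _ (hD.hue_mem_of_mem_under hx))
  rw [partMin, if_pos hx, hr, WithTop.untopD_coe]

theorem partMin_mem_hue (hD : P.IsDecoration D) (hx : x ∈ D.under) : partMin D x ∈ D.hue x :=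
  Finset.mem_of_min (hD.min_hue_eq_partMin hx)

theorem color_partMin (hD : P.IsDecoration D) (x : Fin n) :
    P.color (partMin D x) = P.color x := by
  by_cases hx : x ∈ D.under
  · exact (hD.hueMatches_iff (hD.hue_mem_of_mem_under hx) (hD.partMin_mem_hue hx)).1
      (hD.hueMatches_of_mem_under hx)
  · rw [partMin_of_notMem_under hx]

theorem partMin_lt (hD : P.IsDecoration D) (hx : x ∈ D.under) : partMin D x < x := by
  by_cases hboxed : x ∈ P.boxed
  · obtain ⟨B, hB, hxB, y, hy, hyx⟩ := (hD.under_boxed x hboxed).1 hx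
    have hmin := hD.min_hue_eq_partMin hx
    rw [hD.hue_block B hB x hxB ⟨y, hy, hyx⟩] at hmin
    exact (Finset.min_le_of_eq hy hmin).trans_lt hyx
  · exact lt_of_notMem_boxed (hD.color_partMin x)
      (hD.boxed_of_mem (hD.hue_mem_of_mem_under hx) (hD.partMin_mem_hue hx)) hboxed

theorem partMin_le (hD : P.IsDecoration D) (x : Fin n) : partMin D x ≤ x := by
  by_cases hx : x ∈ D.under
  · exact (hD.partMin_lt hx).le
  · exact (partMin_of_notMem_under hx).le

theorem partMin_notMem_under (hD : P.IsDecoration D) (x : Fin n) : partMin D x ∉ D.under := by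
  by_cases hx : x ∈ D.under
  · exact hD.min_notMem_under (hD.hue_mem_of_mem_under hx) (hD.min_hue_eq_partMin hx)
  · rwa [partMin_of_notMem_under hx]

theorem min_eq_partMin (hD : P.IsDecoration D) (hB : B ∈ D.hues) (hx : x ∈ B) :
    B.min = partMin D x := by
  by_cases hunder : x ∈ D.under
  · rw [← hD.min_hue_eq_partMin hunder,
      hD.hue_block B hB x hx ((hD.mem_under_iff_of_mem hB hx).1 hunder)]
  · rw [partMin_of_notMem_under hunder]
    rw [hD.mem_under_iff_of_mem hB hx] at hunder
    push Not at hunder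
    exact le_antisymm (Finset.min_le hx)
      (Finset.le_min fun y hy => WithTop.coe_le_coe.2 (hunder y hy))

end IsDecoration

instance (D : Marking n) : DecidableRel (Setoid.ker (partMin D)) := fun x y =>
  inferInstanceAs (Decidable (partMin D x = partMin D y))

/-- The partition underlying a decoration. Its parts are obtained from the hues by adding to each
hue the underlined unboxed numbers of that hue; all other unboxed numbers are singletons. -/
def underlyingPartition (D : Marking n) : Finpartition (Finset.univ : Finset (Fin n)) :=
  Finpartition.ofSetoid (Setoid.ker (partMin D))

theorem mem_part_underlyingPartition :
    y ∈ (underlyingPartition D).part x ↔ partMin D x = partMin D y :=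
  Finpartition.mem_part_ofSetoid_iff_rel

namespace IsDecoration

theorem partMin_mem_part (hD : P.IsDecoration D) (x : Fin n) :
    partMin D x ∈ (underlyingPartition D).part x := by
  rw [mem_part_underlyingPartition, partMin_of_notMem_under (hD.partMin_notMem_under x)]

theorem nonMinima_underlyingPartition (hD : P.IsDecoration D) :
    nonMinima (underlyingPartition D) = D.under := by
  ext x
  rw [mem_nonMinima]
  constructor
  · rintro ⟨y, hy, hyx⟩
    by_contra hx
    rw [mem_part_underlyingPartition, partMin_of_notMem_under hx] at hy
    exact hyx.not_ge (hy.trans_le (hD.partMin_le y))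
  · exact fun hx => ⟨_, hD.partMin_mem_part x, hD.partMin_lt hx⟩

theorem monochromatic_underlyingPartition (hD : P.IsDecoration D)
    (hA : A ∈ (underlyingPartition D).parts) : P.Monochromatic A := by
  intro x hx y hy
  rw [← (underlyingPartition D).part_eq_of_mem hA hx, mem_part_underlyingPartition] at hy
  rw [← hD.color_partMin x, hy, hD.color_partMin]

theorem part_inter_boxed (hD : P.IsDecoration D) (hB : B ∈ D.hues) (hx : x ∈ B) :
    (underlyingPartition D).part x ∩ P.boxed = B := by
  ext y
  rw [Finset.mem_inter, mem_part_underlyingPartition, ← WithTop.coe_inj,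
    ← hD.min_eq_partMin hB hx]
  constructor
  · rintro ⟨hmin, hy⟩
    obtain ⟨B', hB', hyB'⟩ := hD.mem_boxed_iff.1 hy
    rw [← hD.min_eq_partMin hB' hyB', hD.min_eq_partMin hB hx] at hmin
    rwa [hD.eq_of_mem hB hB' (Finset.mem_of_min (hD.min_eq_partMin hB hx))
      (Finset.mem_of_min hmin.symm)]
  · exact fun hy => ⟨hD.min_eq_partMin hB hy, hD.boxed_of_mem hB hy⟩

theorem part_inter_boxed_eq_hue (hD : P.IsDecoration D) (hx : x ∈ D.under) :
    (underlyingPartition D).part x ∩ P.boxed = D.hue x := by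
  rw [← (underlyingPartition D).part_eq_of_mem (part_mem_parts x) (hD.partMin_mem_part x),
    hD.part_inter_boxed (hD.hue_mem_of_mem_under hx) (hD.partMin_mem_hue hx)]

theorem mem_hues_iff (hD : P.IsDecoration D) :
    B ∈ D.hues ↔ B.Nonempty ∧ ∃ A ∈ (underlyingPartition D).parts, A ∩ P.boxed = B := by
  constructor
  · intro hB
    obtain ⟨x, hx⟩ := hD.hues_nonempty B hB
    exact ⟨⟨x, hx⟩, _, part_mem_parts x, hD.part_inter_boxed hB hx⟩
  · rintro ⟨⟨x, hx⟩, A, hA, rfl⟩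
    obtain ⟨B, hB, hxB⟩ := hD.mem_boxed_iff.1 (Finset.mem_inter.1 hx).2
    rwa [← (underlyingPartition D).part_eq_of_mem hA (Finset.mem_inter.1 hx).1,
      hD.part_inter_boxed hB hxB]

theorem exists_toMarking_eq (hD : P.IsDecoration D) :
    ∃ f, P.toMarking (underlyingPartition D) f = D := by
  have hpart (x : P.freeMinima (underlyingPartition D)) :
      ∃ A : (underlyingPartition D).parts, (A : Finset (Fin n)) ∩ P.boxed = D.hue x := by
    obtain ⟨-, A, hA, heq⟩ := hD.mem_hues_iff.1 (hD.hue_mem x (mem_freeMinima.1 x.2).1)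
    exact ⟨⟨A, hA⟩, heq⟩
  choose f hf using hpart
  refine ⟨f, Marking.ext (Finset.ext fun B => ?_) (funext fun x => ?_)
    hD.nonMinima_underlyingPartition⟩
  · rw [mem_hues_toMarking, hD.mem_hues_iff]
  by_cases hcrossed : x ∈ P.crossed
  · rw [hue_toMarking_of_mem_crossed hcrossed, hD.hue_crossed x hcrossed]
  by_cases hfree : x ∈ P.freeMinima (underlyingPartition D)
  · rw [hue_toMarking_of_mem_freeMinima hfree, hf]
  · have hmin := mem_nonMinima_of_notMem_freeMinima hfree hcrossed
    rw [hue_toMarking_of_mem_nonMinima (fun _ => hD.monochromatic_underlyingPartition) hmin]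
    exact hD.part_inter_boxed_eq_hue (hD.nonMinima_underlyingPartition ▸ hmin)

end IsDecoration

theorem card_fiber_add (hQ : ∀ A ∈ Q.parts, P.Monochromatic A)
    (hD : P.IsDecoration (P.toMarking Q f)) (hA : A ∈ Q.parts) :
    (Finset.univ.filter fun x => f x = ⟨A, hA⟩).card + (A.card - 1) = P.kSum A := by
  rw [← kSum_inter_boxed]
  by_cases hne : (A ∩ P.boxed).Nonempty
  · rw [← card_hue_toMarking_eq hQ hA hne,
      hD.hue_card _ (mem_hues_toMarking.2 ⟨hne, A, hA, rfl⟩)]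
  have hue_ne {x : Fin n} (hx : x ∉ P.crossed) : (P.toMarking Q f).hue x ≠ A ∩ P.boxed :=
    fun h => hne (h ▸ hD.hues_nonempty _ (hD.hue_mem x hx))
  have hfiber : (Finset.univ.filter fun x => f x = ⟨A, hA⟩) = ∅ := by
    refine Finset.filter_eq_empty_iff.2 fun x _ hx => ?_
    have hfree := mem_freeMinima.1 x.2
    refine hue_ne hfree.1 ?_
    rw [hue_toMarking_of_mem_freeMinima x.2, hx]
  have hmin : (nonMinima Q).filter (· ∈ A) = ∅ := by
    refine Finset.filter_eq_empty_iff.2 fun x hx hxA => ?_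
    refine hue_ne (notMem_crossed_of_mem_nonMinima hQ hx) ?_
    rw [hue_toMarking_of_mem_nonMinima hQ hx, Q.part_eq_of_mem hA hxA]
  rw [← card_filter_nonMinima hA, hfiber, hmin, Finset.not_nonempty_iff_eq_empty.1 hne]
  rfl

theorem isDecoration_toMarking_iff (hQ : ∀ A ∈ Q.parts, P.Monochromatic A) :
    P.IsDecoration (P.toMarking Q f) ↔ P.Admissible Q ∧ f ∈ P.partAssignments Q := by
  refine ⟨fun hD => ⟨⟨hQ, fun A hA => ?_⟩, mem_partAssignments.2 fun ⟨A, hA⟩ => ?_⟩,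
    fun ⟨hQ, hf⟩ => isDecoration_toMarking hQ hf⟩
  · have := card_fiber_add hQ hD hA
    omega
  · have hcard := card_fiber_add hQ hD hA
    have hpos := Finset.card_pos.2 (Q.nonempty_of_mem_parts hA)
    simp only
    omega

theorem underlyingPartition_toMarking (hQ : ∀ A ∈ Q.parts, P.Monochromatic A)
    (hD : P.IsDecoration (P.toMarking Q f)) : underlyingPartition (P.toMarking Q f) = Q := by
  have hmem (x : Fin n) : partMin (P.toMarking Q f) x ∈ Q.part x := by
    by_cases hx : x ∈ (P.toMarking Q f).under
    · have := hD.partMin_mem_hue hx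
      rw [hue_toMarking_of_mem_nonMinima hQ hx] at this
      exact (Finset.mem_inter.1 this).1
    · rw [partMin_of_notMem_under hx]
      exact mem_part_self x
  refine eq_of_forall_part_eq fun x _ => Finset.ext fun y => ?_
  rw [mem_part_underlyingPartition]
  constructor
  · intro h
    rw [Q.eq_of_mem_parts (part_mem_parts x) (part_mem_parts y) (hmem x) (h ▸ hmem y)]
    exact mem_part_self y
  · intro hy
    have hy' := hmem y
    rw [Q.part_eq_of_mem (part_mem_parts x) hy] at hy'
    exact eq_of_mem_part_of_notMem_nonMinima (hmem x) hy' (hD.partMin_notMem_under x)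
      (hD.partMin_notMem_under y)

theorem injOn_toMarking : Set.InjOn (P.toMarking Q) (P.partAssignments Q) := by
  intro f hf g _ hfg
  funext x
  have hue_eq := congrFun (congrArg Marking.hue hfg) x
  rw [hue_toMarking_of_mem_freeMinima x.2, hue_toMarking_of_mem_freeMinima x.2] at hue_eq
  exact Subtype.ext
    (eq_of_inter_boxed_eq (f x).2 (g x).2 (assigned_inter_boxed_nonempty hf x) hue_eq)

theorem filter_underlyingPartition_eq (hQ : P.Admissible Q) :
    P.decorations.filter (underlyingPartition · = Q) =
      (P.partAssignments Q).image (P.toMarking Q) := by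
  ext D
  rw [Finset.mem_filter, mem_decorations, Finset.mem_image]
  constructor
  · rintro ⟨hD, rfl⟩
    obtain ⟨f, hf⟩ := hD.exists_toMarking_eq
    exact ⟨f, ((isDecoration_toMarking_iff hQ.monochromatic).1 (by rwa [hf])).2, hf⟩
  · rintro ⟨f, hf, rfl⟩
    have hD := isDecoration_toMarking hQ hf
    exact ⟨hD, underlyingPartition_toMarking hQ.monochromatic hD⟩

theorem IsDecoration.admissible_underlyingPartition (hD : P.IsDecoration D) :
    P.Admissible (underlyingPartition D) := by
  obtain ⟨f, hf⟩ := hD.exists_toMarking_eq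
  exact ((isDecoration_toMarking_iff fun _ => hD.monochromatic_underlyingPartition).1
    (by rwa [hf])).1

theorem card_filter_underlyingPartition (hQ : ∀ A ∈ Q.parts, P.Monochromatic A) :
    (P.decorations.filter (underlyingPartition · = Q)).card = P.multinomialTerm Q := by
  by_cases hle : ∀ A ∈ Q.parts, A.card ≤ P.kSum A + 1
  · rw [filter_underlyingPartition_eq ⟨hQ, hle⟩, Finset.card_image_of_injOn injOn_toMarking,
      card_partAssignments ⟨hQ, hle⟩]
  · rw [multinomialTerm, if_neg hle, Finset.card_eq_zero, Finset.filter_eq_empty_iff]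
    rintro D hD rfl
    exact hle (mem_decorations.1 hD).admissible_underlyingPartition.card_le

theorem alternatingSum_eq (P : ColoredExponents n m) :
    P.alternatingSum = ∑ D ∈ P.decorations, D.sign := by
  have hmaps : ∀ D ∈ P.decorations, underlyingPartition D ∈
      Finset.univ.filter fun Q : Finpartition (Finset.univ : Finset (Fin n)) =>
        ∀ A ∈ Q.parts, P.Monochromatic A := fun D hD =>
    Finset.mem_filter.2 ⟨Finset.mem_univ _, fun _ =>
      (mem_decorations.1 hD).monochromatic_underlyingPartition⟩
  rw [alternatingSum, ← Finset.sum_fiberwise_of_maps_to hmaps]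
  refine Finset.sum_congr rfl fun Q hQ => ?_
  have hsign : ∀ D ∈ P.decorations.filter (underlyingPartition · = Q),
      D.sign = (-1) ^ ∑ A ∈ Q.parts, (A.card - 1) := by
    intro D hD
    obtain ⟨hmem, rfl⟩ := Finset.mem_filter.1 hD
    have hdec : P.IsDecoration D := mem_decorations.1 hmem
    rw [Marking.sign, ← hdec.nonMinima_underlyingPartition, card_nonMinima]
  rw [Finset.sum_congr rfl hsign, Finset.sum_const,
    card_filter_underlyingPartition (Finset.mem_filter.1 hQ).2, nsmul_eq_mul, mul_comm]

end ColoredExponents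

theorem mainTheorem6 {n m : ℕ} (P : ColoredExponents n m) :
    -- the alternating sum is the signed count of all decorations
    P.alternatingSum = ∑ D ∈ P.decorations, D.sign ∧
    -- the first involution, its fixed points, and the reduced sum
    IsSignReversingInvolution P.decorations Marking.sign P.phiUnder ∧
    (∀ D ∈ P.decorations, P.phiUnder D = D ↔ D ∈ P.mismatchedDecorations) ∧
    P.alternatingSum = ∑ D ∈ P.mismatchedDecorations, D.sign ∧
    -- a hue has permission to merge with at most one hue
    (∀ D ∈ P.mismatchedDecorations, ∀ t B B',
      P.HasPermission D t B → P.HasPermission D t B' → B = B') ∧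
    -- the second involution
    IsSignReversingInvolution P.mismatchedDecorations Marking.sign P.phiHue ∧
    -- its fixed points are the fixed point decorations, without underlines and of positive sign
    (∀ D ∈ P.mismatchedDecorations, P.phiHue D = D ↔ P.IsFixedPoint D) ∧
    (∀ D ∈ P.mismatchedDecorations, P.phiHue D = D → D.under = ∅ ∧ D.sign = 1) ∧
    -- the resulting positive formula
    P.alternatingSum = (P.fixedPointDecorations.card : ℤ) := by
  open ColoredExponents in
  have sum_decorations := P.alternatingSum_eq
  have sum_mismatched := sum_decorations.trans sum_decorations_eq
  refine ⟨sum_decorations, isSignReversingInvolution_phiUnder, fun D hD => ?_, sum_mismatched,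
    fun D hD _ _ _ h h' => (mem_mismatchedDecorations.1 hD).1.hasPermission_unique h h',
    isSignReversingInvolution_phiHue, fun D hD => phiHue_eq_self_iff_isFixedPoint hD,
    fun D hD h => ?_, sum_mismatched.trans sum_mismatchedDecorations_eq⟩
  · rw [phiUnder_eq_self_iff, mem_mismatchedDecorations, and_iff_right (mem_decorations.1 hD)]
  · have hfixed := (phiHue_eq_self_iff_isFixedPoint hD).1 h
    exact ⟨hfixed.under_eq_empty, hfixed.sign_eq_one⟩
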